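/- \textbf{Setting.} Let $\mu$ be the spherical Lebesgue measure on $\mathbb{S}^{n-1}\subset\mathbb{R}^n$, and for $h\in C^2(\mathbb{S}^{n-1})$ put $D^2h=\nabla^2h+h\,I$, where $\nabla$ is the Levi-Civita connection of the round metric. Let $\mathcal{K}_+^2$ be the class of convex bodies $K\subset\mathbb{R}^n$ that contain the origin in their interior and have a $C^2$ boundary with positive Gaussian curvature. For $K\in\mathcal{K}_+^2$ let $h_K(x)=\max_{y\in K}\langle x,y\rangle$ be its support function on $\mathbb{S}^{n-1}$, let $dS_2K=h_K^{-1}\det(D^2h_K)\,d\mu$ be its $L_2$-surface-area measure and $dV_K=\frac1n h_K\det(D^2h_K)\,d\mu$ its cone-volume measure. $K$ is called $S_2$-isotropic if $$\int_{\mathbb{S}^{n-1}}\langle x,w\rangle^2\,dS_2K(x)=\frac{S_2K(\mathbb{S}^{n-1})}{n}\,|w|^2\qquad\text{for all } w\in\mathbb{R}^n .$$ The Hilbert--Brunn--Minkowski operator of $K$ is $$L_Kz=\frac1{n-1}\operatorname{tr}\!\left((D^2h_K)^{-1}D^2(z\,h_K)\right)-z,\qquad z\in C^2(\mathbb{S}^{n-1}).$$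 The operator $-L_K$ on $C^2(\mathbb{S}^{n-1})$ has a unique self-adjoint extension in $L^2(V_K)$ (its closure), whose spectrum is discrete; list the distinct points of the spectrum in increasing order as $\lambda_0(-L_K)<\lambda_1(-L_K)<\lambda_2(-L_K)<\cdots$ (here $\lambda_0=0$ and $\lambda_1=1$). \textbf{Theorem.} Let $n\ge 3$ and $\frac{1-3n^2}{2n}\le p<-n$. Suppose that $K\in\mathcal{K}_+^2$ is $S_2$-isotropic, solves the isotropic $L_p$ Minkowski equation $$h_K^{1-p}\,\det(\nabla^2h_K+h_K I)=1\quad\text{on }\mathbb{S}^{n-1},$$ and satisfies $$\lambda_2(-L_K)\ge\frac{n-1}{2n-1+p}.$$ Then $K$ is the (origin-centred closed) unit ball. It is not assumed that the centroid of $K$ lies at the origin. -/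

import Mathlib

open MeasureTheory Metric Set Filter Topology

noncomputable section

namespace LpMinkowski

/-- Euclidean space `ℝⁿ`. -/
abbrev E (n : ℕ) : Type := EuclideanSpace ℝ (Fin n)

/-- The unit sphere `𝕊ⁿ⁻¹ ⊂ ℝⁿ`. -/
abbrev S (n : ℕ) : Type := sphere (0 : E n) 1

/-- The spherical Lebesgue measure on `𝕊ⁿ⁻¹`. -/
def sphereMeasure (n : ℕ) : Measure (S n) := (volume : Measure (E n)).toSphere

/-! ### Calculus on the sphere -/

/-- The extension of `h : 𝕊ⁿ⁻¹ → ℝ` to a positively 1-homogeneous function on `ℝⁿ`,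
`y ↦ ‖y‖ h (y / ‖y‖)`, with value `0` at the origin. -/
def homExt {n : ℕ} (h : S n → ℝ) (y : E n) : ℝ :=
  open Classical in
  if hy : y = 0 then 0
  else ‖y‖ * h ⟨‖y‖⁻¹ • y, by simp [norm_smul, hy]⟩

/-- `h ∈ C²(𝕊ⁿ⁻¹)`: the homogeneous extension is `C²` away from the origin. -/
def IsC2 {n : ℕ} (h : S n → ℝ) : Prop := ContDiffOn ℝ 2 (homExt h) {0}ᶜ

/-- The tangent space `T_x 𝕊ⁿ⁻¹ = x^⊥`. -/
abbrev tangent {n : ℕ} (x : S n) : Submodule ℝ (E n) := (Submodule.span ℝ {(x : E n)})ᗮ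

/-- `D²h (x) = ∇²h (x) + h (x) I`, as an endomorphism of `T_x 𝕊ⁿ⁻¹`. It is the Euclidean Hessian
of the 1-homogeneous extension of `h`, restricted to the tangent space. -/
def D2 {n : ℕ} (h : S n → ℝ) (x : S n) : Module.End ℝ (tangent x) :=
  ((tangent x).orthogonalProjectionOnto ∘L
    fderiv ℝ (gradient (homExt h)) (x : E n) ∘L (tangent x).subtypeL).toLinearMap

/-! ### Convex bodies -/

/-- The support function `h_K (x) = max_{y ∈ K} ⟨x, y⟩` on the sphere. -/
def supportFn {n : ℕ} (K : ConvexBody (E n)) (x : S n) : ℝ :=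
  sSup ((fun y : E n => inner ℝ (x : E n) y) '' (K : Set (E n)))

/-- The class `𝒦₊²`: convex bodies with the origin in their interior whose boundary is a `C²`
hypersurface with positive Gaussian curvature. Near each of its boundary points `x`, the body is
`{ρ ≤ 0}` for a `C²` function `ρ` with `dρ (x) ≠ 0`. The second fundamental form at `x` with
respect to the outer normal is `D²ρ (x) / ‖∇ρ (x)‖` on the tangent space `ker dρ (x)`; by convexity
it is positive semidefinite, so its determinant, the Gaussian curvature, is positive exactly when
it is positive definite. -/
structure IsKPlus2 {n : ℕ} (K : ConvexBody (E n)) : Prop where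
  zero_mem_interior : (0 : E n) ∈ interior (K : Set (E n))
  boundary : ∀ x ∈ frontier (K : Set (E n)), ∃ ρ : E n → ℝ,
    ContDiffAt ℝ 2 ρ x ∧ fderiv ℝ ρ x ≠ 0 ∧
    (∀ᶠ y in 𝓝 x, y ∈ (K : Set (E n)) ↔ ρ y ≤ 0) ∧
    ∀ v : E n, v ≠ 0 → fderiv ℝ ρ x v = 0 → 0 < fderiv ℝ (fderiv ℝ ρ) x v v

/-- The `L_p`-surface-area measure `dS_p K = h_K^{1-p} det (∇²h_K + h_K I) dμ`. -/
def lpSurfaceArea {n : ℕ} (K : ConvexBody (E n)) (p : ℝ) : Measure (S n) :=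
  (sphereMeasure n).withDensity fun x =>
    ENNReal.ofReal (supportFn K x ^ (1 - p) * LinearMap.det (D2 (supportFn K) x))

/-- The cone-volume measure `V_K = (1/n) S_0 K`. -/
def coneVolume {n : ℕ} (K : ConvexBody (E n)) : Measure (S n) :=
  (n : ENNReal)⁻¹ • lpSurfaceArea K 0

/-- A measure on the sphere is isotropic if `∫ ⟨x, w⟩² dm(x) = (‖m‖ / n) |w|²` for all `w`. -/
def IsIsotropic {n : ℕ} (m : Measure (S n)) : Prop :=
  ∀ w : E n, ∫ x : S n, (inner ℝ (x : E n) w) ^ 2 ∂m = m.real univ / n * ‖w‖ ^ 2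

/-- `K` is `S₂`-isotropic if its `L₂`-surface-area measure is isotropic. -/
def IsS2Isotropic {n : ℕ} (K : ConvexBody (E n)) : Prop := IsIsotropic (lpSurfaceArea K 2)

/-- The isotropic `L_p` Minkowski equation `h_K^{1-p} det (∇²h_K + h_K I) = 1` on the sphere. -/
def SolvesIsotropicLp {n : ℕ} (K : ConvexBody (E n)) (p : ℝ) : Prop :=
  ∀ x : S n, supportFn K x ^ (1 - p) * LinearMap.det (D2 (supportFn K) x) = 1

/-! ### The Hilbert–Brunn–Minkowski operator and its spectrum -/

/-- The Hilbert–Brunn–Minkowski operator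
`L_K z = (1/(n-1)) tr ((D²h_K)⁻¹ D²(z h_K)) - z`. -/
def hbmOperator {n : ℕ} (K : ConvexBody (E n)) (z : S n → ℝ) (x : S n) : ℝ :=
  1 / ((n : ℝ) - 1) * LinearMap.trace ℝ (tangent x)
    (Ring.inverse (D2 (supportFn K) x) * D2 (fun u => z u * supportFn K u) x) - z x

/-- The real Hilbert space `L²(V_K)`. -/
abbrev L2 {n : ℕ} (K : ConvexBody (E n)) : Type := Lp ℝ 2 (coneVolume K)

/-- The graph in `L²(V_K) × L²(V_K)` of `-L_K` with domain `C²(𝕊ⁿ⁻¹)`. -/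
def graphC2 {n : ℕ} (K : ConvexBody (E n)) : Set (L2 K × L2 K) :=
  {fg | ∃ z : S n → ℝ, IsC2 z ∧ fg.1 =ᵐ[coneVolume K] z ∧
    fg.2 =ᵐ[coneVolume K] fun x => -hbmOperator K z x}

/-- The graph of the self-adjoint extension of `-L_K` in `L²(V_K)`: the unique self-adjoint
extension of the essentially self-adjoint operator `-L_K` on `C²(𝕊ⁿ⁻¹)` is its closure. (The set
`graphC2 K` is already a linear subspace for `K ∈ 𝒦₊²`, so that the span adds nothing.) -/
def graphSA {n : ℕ} (K : ConvexBody (E n)) : Submodule ℝ (L2 K × L2 K) :=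
  (Submodule.span ℝ (graphC2 K)).topologicalClosure

/-- The (real) spectrum of the operator `A` with graph `G`: `r` lies outside it when
`A - r : Dom A → H` is bijective. For a closed `A` in a Banach space the inverse is then bounded
by the closed graph theorem; a self-adjoint operator has real spectrum. -/
def graphSpectrum {H : Type*} [NormedAddCommGroup H] [NormedSpace ℝ H]
    (G : Submodule ℝ (H × H)) : Set ℝ :=
  {r | ¬ ∀ g : H, ∃! f : H, (f, g + r • f) ∈ G}

/-- The elements of a set of reals listed in increasing order, each once, starting from index `0`
(meaningful for a nonempty discrete set that is bounded below, as long as elements remain). -/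
def increasingEnum (σ : Set ℝ) : ℕ → ℝ
  | 0 => sInf σ
  | k + 1 => sInf (σ ∩ Ioi (increasingEnum σ k))

/-- `λ_i(-L_K)`, the `i`-th distinct eigenvalue of `-L_K`:
`σ(-L_K) = {λ₀ < λ₁ < λ₂ < ⋯}`. -/
def hbmEigenvalue {n : ℕ} (K : ConvexBody (E n)) (i : ℕ) : ℝ :=
  increasingEnum (graphSpectrum (graphSA K)) i

end LpMinkowski

end

/-!
The support function `h` of `K` is replaced throughout by its 1-homogeneous extension `H`, so that
`∇²h + h I` is the Euclidean Hessian of `H` on the tangent space and the boundary point with outer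
normal `x` is `∇H (x)`. Write `V` for the cone-volume measure and `𝓔` for the Dirichlet form of `-L`.

The components of the position vector `∇H` are the test functions. They are only `C¹`, but the
Dirichlet principle `𝓔 (f) ≥ 2 ⟨f, b⟩ - ⟨a, b⟩`, for every pair `(a, b)` in the graph of the closure
of `-L`, is still available for them (`two_mul_inner_sub_le_energy`). The divergence theorem
computes their products with the eigenfunctions `⟨x, w⟩ / h` of the eigenvalue `1`, and
`S₂`-isotropy says that these eigenfunctions form, up to a factor, an orthonormal system. Together
with the bound `c = (n - 1) / (2 n - 1 + p)` for the second eigenvalue this gives a lower bound for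
the energy of each component (`le_energy`). The total energy is computed from
`V = h ^ p dμ / n`, by integration by parts on the round sphere (`sum_energy`), which also bounds
the mean of the position vector by its tangential part (`inner_oneL2_posL2`). For this `c` the terms
with the tangential part cancel in the sum, and what is left is
`∫ h² dV · ∫ h⁻² dV ≤ V(𝕊ⁿ⁻¹)²` (`supportSq_le`). This is the reverse of the Cauchy–Schwarz
inequality, so `h` is constant, and the Minkowski equation makes the constant `1`.

Using the spectral hypothesis requires some theory of the operator `L`.

* `IsKPlus2.strictlyConvex`: `H` is `C²` away from the origin with Hessian positive definite on the
  tangent spaces. The inverse function theorem is applied to `(y, s) ↦ (s ∇ρ (y), ρ (y))`, where `ρ`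
  is a local defining function of `K`.
* `green`: symmetry of `L` and the formula for `𝓔`, from the fact that the cofactor matrix of the
  Hessian of `H² / 2` is divergence free. The latter is proved in weak form
  (`integral_det_mul_tr_eq_zero`) from the vanishing of the integral of the Jacobian determinant of a
  compactly supported map (`integral_det_fderiv_eq_zero`), which is a change of variables.
* `bochner`: the integrated Bochner formula, the first variation of `green` with respect to `H`. It
  shows that `-L ≤ L²`, hence that there is no spectrum in `(0, 1)`.
* `exists_poincare`: the Poincaré inequality on the sphere. With Bochner's formula it identifies the
  kernels of the closures of `-L` and of `-L - 1` (`exists_eq_smul_oneL2`, `exists_eq_linL2`).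
* `exists_preimage_of_gap`: if the spectrum of a symmetric relation `A ≥ 0` with `A² ≥ A` avoids
  `(1, c)`, then `A ≥ c` on the orthogonal complement of the kernels of `A` and `A - 1`. The proof
  uses only the resolvent at the midpoint of `(1, c)`, in place of the spectral theorem.
-/

set_option linter.unusedSectionVars false

namespace LpMinkowski

open InnerProductSpace

/-! ### Linear algebra -/

section LinearAlgebra

variable {V : Type*} [NormedAddCommGroup V] [InnerProductSpace ℝ V] [FiniteDimensional ℝ V]

/-- The trace of a continuous endomorphism. -/
noncomputable def tr (A : V →L[ℝ] V) : ℝ := LinearMap.trace ℝ V A.toLinearMap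

lemma clm_mul_apply (A B : V →L[ℝ] V) (v : V) : (A * B) v = A (B v) := rfl

lemma tr_add (A B : V →L[ℝ] V) : tr (A + B) = tr A + tr B := by simp [tr]
lemma tr_sub (A B : V →L[ℝ] V) : tr (A - B) = tr A - tr B := by simp [tr]
lemma tr_smul (c : ℝ) (A : V →L[ℝ] V) : tr (c • A) = c * tr A := by simp [tr]
lemma tr_rankOne (a b : V) : tr (rankOne ℝ a b) = inner ℝ b a := by
  simp [tr, InnerProductSpace.trace_rankOne]
lemma tr_one : tr (1 : V →L[ℝ] V) = Module.finrank ℝ V := by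
  unfold tr
  exact LinearMap.trace_one ℝ V
lemma tr_mul_comm (A B : V →L[ℝ] V) : tr (A * B) = tr (B * A) :=
  LinearMap.trace_mul_comm ℝ A.toLinearMap B.toLinearMap
lemma tr_zero : tr (0 : V →L[ℝ] V) = 0 := by simp [tr]

lemma tr_eq_sum_inner {ι : Type*} [Fintype ι] (A : V →L[ℝ] V) (b : OrthonormalBasis ι ℝ V) :
    tr A = ∑ i, inner ℝ (b i) (A (b i)) := by
  simpa [tr] using LinearMap.trace_eq_sum_inner A.toLinearMap b

lemma det_mul (A B : V →L[ℝ] V) : (A * B).det = A.det * B.det :=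
  LinearMap.det_comp A.toLinearMap B.toLinearMap

lemma det_one : (1 : V →L[ℝ] V).det = 1 := LinearMap.det_id

lemma isUnit_iff_det_ne_zero (A : V →L[ℝ] V) : IsUnit A ↔ A.det ≠ 0 := by
  rw [ContinuousLinearMap.det, ← isUnit_iff_ne_zero, ← LinearMap.isUnit_iff_isUnit_det]
  constructor
  · rintro ⟨u, rfl⟩
    exact ⟨⟨u.1.toLinearMap, u.2.toLinearMap, by
      ext v; exact congrArg (fun f : V →L[ℝ] V => f v) u.mul_inv, by
      ext v; exact congrArg (fun f : V →L[ℝ] V => f v) u.inv_mul⟩, rfl⟩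
  · rintro ⟨u, hu⟩
    refine ⟨⟨A, LinearMap.toContinuousLinearMap u.2, ?_, ?_⟩, rfl⟩
    · ext v; simpa [hu] using congrArg (fun f => f v) u.mul_inv
    · ext v; simpa [hu] using congrArg (fun f => f v) u.inv_mul

/-- The tangential block of an endomorphism fixing the unit vector `x` has the same
determinant. -/
lemma det_eq_det_of_block {x : V} (B : V →L[ℝ] V) (hBx : B x = x)
    (B' : Module.End ℝ (Submodule.span ℝ {x})ᗮ) (hB : ∀ v, (B' v : V) = B v) :
    LinearMap.det B' = B.det := by
  have hc := (Submodule.isCompl_orthogonal (K := (Submodule.span ℝ {x})))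
  let e := Submodule.prodEquivOfIsCompl _ _ hc
  have key : B.toLinearMap = e.conj (LinearMap.prodMap LinearMap.id B') := by
    ext v
    obtain ⟨⟨⟨a, ha⟩, b⟩, rfl⟩ := e.surjective v
    obtain ⟨c, rfl⟩ := Submodule.mem_span_singleton.1 ha
    have h1 : B' b = B b := hB b
    simp only [LinearEquiv.conj_apply, LinearMap.comp_apply, LinearEquiv.coe_coe,
      LinearEquiv.symm_apply_apply, LinearMap.prodMap_apply, e]
    simp [Submodule.coe_prodEquivOfIsCompl', hBx, hB]
  rw [ContinuousLinearMap.det, key, LinearEquiv.conj_apply, LinearMap.comp_assoc, LinearMap.det_conj,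
    LinearMap.det_prodMap]
  simp

/-- The tangential block of an endomorphism killing the unit vector `x` has the same trace. -/
lemma trace_eq_tr_of_block {x : V} (B : V →L[ℝ] V) (hBx : B x = 0)
    (B' : Module.End ℝ (Submodule.span ℝ {x})ᗮ) (hB : ∀ v, (B' v : V) = B v) :
    LinearMap.trace ℝ _ B' = tr B := by
  have hc := (Submodule.isCompl_orthogonal (K := (Submodule.span ℝ {x})))
  let e := Submodule.prodEquivOfIsCompl _ _ hc
  have key : B.toLinearMap = e.conj (LinearMap.prodMap 0 B') := by
    ext v
    obtain ⟨⟨⟨a, ha⟩, b⟩, rfl⟩ := e.surjective v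
    obtain ⟨c, rfl⟩ := Submodule.mem_span_singleton.1 ha
    have h1 : B' b = B b := hB b
    simp only [LinearEquiv.conj_apply, LinearMap.comp_apply, LinearEquiv.coe_coe,
      LinearEquiv.symm_apply_apply, LinearMap.prodMap_apply, e]
    simp [Submodule.coe_prodEquivOfIsCompl', hBx, hB]
  rw [tr, key, LinearMap.trace_conj', LinearMap.trace_prodMap']
  simp


lemma mul_rankOne (a b : V) (A : V →L[ℝ] V) : A * rankOne ℝ a b = rankOne ℝ (A a) b := by
  ext v; simp

lemma det_one_add_rankOne (a b : V) : (1 + rankOne ℝ a b).det = 1 + inner ℝ b a := by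
  let e := stdOrthonormalBasis ℝ V
  have h : LinearMap.toMatrix e.toBasis e.toBasis (1 + rankOne ℝ a b).toLinearMap =
      1 + Matrix.replicateCol Unit (fun i => inner ℝ (e i) a) *
        Matrix.replicateRow Unit (fun i => inner ℝ b (e i)) := by
    ext i j
    simp [LinearMap.toMatrix_apply, Matrix.mul_apply, Matrix.one_apply, e.repr_apply_apply,
      mul_comm]
  rw [ContinuousLinearMap.det, ← LinearMap.det_toMatrix e.toBasis, h,
    Matrix.det_one_add_replicateCol_mul_replicateRow]
  congr 1
  rw [← e.sum_inner_mul_inner b a]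
  rfl

lemma det_smul_one (c : ℝ) : (c • (1 : V →L[ℝ] V)).det = c ^ Module.finrank ℝ V := by
  have := LinearMap.det_smul c (LinearMap.id : V →ₗ[ℝ] V)
  rwa [LinearMap.det_id, mul_one] at this

/-- The determinant of the Hessian of `H² / 2`, which is `H D²H + ∇H ⊗ ∇H`, in terms of the
tangential Hessian of `H`. -/
lemma det_add_rankOne_self {x : V} (hx : ‖x‖ = 1) {S : V →L[ℝ] V} (hSx : S x = 0)
    (hS : ∀ v w, inner ℝ (S v) w = inner ℝ v (S w)) (X : V) {h : ℝ} (hh : h ≠ 0)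
    (hX : inner ℝ X x = h) :
    (h • S + rankOne ℝ X X).det = h ^ (Module.finrank ℝ V + 1) * (S + rankOne ℝ x x).det := by
  have hxx : inner ℝ x x = (1 : ℝ) := by simp [hx]
  have hxS : ∀ v, inner ℝ x (S v) = (0 : ℝ) := fun v => by rw [← hS, hSx, inner_zero_left]
  have e1 : h • S + rankOne ℝ X X = (1 + rankOne ℝ (X - x) x) *
      (((h • (1 : V →L[ℝ] V)) * (1 + rankOne ℝ ((h⁻¹ - 1) • x) x) * (S + rankOne ℝ x x)) *
      (1 + rankOne ℝ x (X - x))) := by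
    ext v
    simp only [add_apply, smul_apply, rankOne_apply,
      clm_mul_apply, one_apply_eq_self, map_add, map_smul,
      inner_sub_left, inner_zero_right, hSx, hxS, hxx, smul_zero]
    match_scalars <;> field_simp <;> ring
  rw [e1, det_mul, det_mul, det_mul, det_mul, det_one_add_rankOne, det_one_add_rankOne,
    det_one_add_rankOne, det_smul_one]
  simp only [inner_sub_left, inner_sub_right, inner_smul_right, hxx, real_inner_comm X x, hX]
  field_simp
  ring

/-- The standing situation at a point `x` of the sphere: `S` is the Hessian of a 1-homogeneous
function, so it kills `x`, and `S + x ⊗ x` is invertible. Its inverse `R` inverts `S` on the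
tangent space. -/
structure HessAt (x : V) (S : V →L[ℝ] V) : Prop where
  norm_eq : ‖x‖ = 1
  apply_self : S x = 0
  symm : ∀ v w, inner ℝ (S v) w = inner ℝ v (S w)
  isUnit : IsUnit (S + rankOne ℝ x x)

namespace HessAt

variable {x : V} {S : V →L[ℝ] V} (hS : HessAt x S)
include hS

lemma inner_self : inner ℝ x x = (1 : ℝ) := by simp [hS.norm_eq]

lemma inner_apply (v : V) : inner ℝ x (S v) = (0 : ℝ) := by
  rw [← hS.symm, hS.apply_self, inner_zero_left]

lemma mul_inverse (v : V) : S (Ring.inverse (S + rankOne ℝ x x) v) +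
    inner ℝ x (Ring.inverse (S + rankOne ℝ x x) v) • x = v :=
  congrArg (fun f : V →L[ℝ] V => f v) (Ring.mul_inverse_cancel _ hS.isUnit)

lemma inverse_apply_add (v : V) :
    Ring.inverse (S + rankOne ℝ x x) (S v + inner ℝ x v • x) = v :=
  congrArg (fun f : V →L[ℝ] V => f v) (Ring.inverse_mul_cancel _ hS.isUnit)

lemma inverse_self : Ring.inverse (S + rankOne ℝ x x) x = x := by
  simpa [hS.apply_self, hS.norm_eq] using hS.inverse_apply_add x

lemma inverse_symm (v w : V) : inner ℝ (Ring.inverse (S + rankOne ℝ x x) v) w =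
    inner ℝ v (Ring.inverse (S + rankOne ℝ x x) w) := by
  conv_lhs => rw [← hS.mul_inverse w]
  conv_rhs => rw [← hS.mul_inverse v]
  simp only [inner_add_left, inner_add_right, inner_smul_left, inner_smul_right, hS.symm,
    real_inner_comm x]
  simp [mul_comm]

lemma inner_inverse (v : V) :
    inner ℝ x (Ring.inverse (S + rankOne ℝ x x) v) = inner ℝ x v := by
  rw [← hS.inverse_symm, hS.inverse_self]

lemma apply_inverse (v : V) :
    S (Ring.inverse (S + rankOne ℝ x x) v) = v - inner ℝ x v • x := by
  rw [eq_sub_iff_add_eq, ← hS.inner_inverse, hS.mul_inverse]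

lemma inverse_apply (v : V) :
    Ring.inverse (S + rankOne ℝ x x) (S v) = v - inner ℝ x v • x := by
  have := hS.inverse_apply_add v
  rw [map_add, map_smul, hS.inverse_self] at this
  rw [eq_sub_iff_add_eq, this]

lemma inverse_mul : Ring.inverse (S + rankOne ℝ x x) * S = 1 - rankOne ℝ x x := by
  ext v; simp [hS.inverse_apply]

lemma tr_inverse_mul :
    tr (Ring.inverse (S + rankOne ℝ x x) * S) = Module.finrank ℝ V - 1 := by
  rw [hS.inverse_mul, tr_sub, tr_one, tr_rankOne, hS.inner_self]

variable {X : V} {h : ℝ} (hh : h ≠ 0) (hX : inner ℝ X x = h)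
include hh hX

lemma isUnit_add_rankOne : IsUnit (h • S + rankOne ℝ X X) := by
  rw [isUnit_iff_det_ne_zero,
    det_add_rankOne_self hS.norm_eq hS.apply_self hS.symm X hh hX]
  exact mul_ne_zero (pow_ne_zero _ hh) ((isUnit_iff_det_ne_zero _).1 hS.isUnit)

lemma inverse_add_rankOne_apply {b : V} (hb : inner ℝ x b = (0 : ℝ)) :
    Ring.inverse (h • S + rankOne ℝ X X) b =
      h⁻¹ • (Ring.inverse (S + rankOne ℝ x x) b -
        (h⁻¹ * inner ℝ X (Ring.inverse (S + rankOne ℝ x x) b)) • x) := by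
  have hu := hS.isUnit_add_rankOne hh hX
  have e : (h • S + rankOne ℝ X X) (h⁻¹ • (Ring.inverse (S + rankOne ℝ x x) b -
        (h⁻¹ * inner ℝ X (Ring.inverse (S + rankOne ℝ x x) b)) • x)) = b := by
    simp only [add_apply, smul_apply, rankOne_apply,
      map_smul, map_sub, hS.apply_inverse, hb, hS.apply_self, hX]
    match_scalars <;> field_simp <;> ring
  have := congrArg (fun f : V →L[ℝ] V => f (h⁻¹ • (Ring.inverse (S + rankOne ℝ x x) b -
    (h⁻¹ * inner ℝ X (Ring.inverse (S + rankOne ℝ x x) b)) • x))) (Ring.inverse_mul_cancel _ hu)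
  simp only [clm_mul_apply, e] at this
  exact this

lemma inverse_add_rankOne_self : Ring.inverse (h • S + rankOne ℝ X X) X = h⁻¹ • x := by
  have hu := hS.isUnit_add_rankOne hh hX
  have e : (h • S + rankOne ℝ X X) (h⁻¹ • x) = X := by
    simp [hS.apply_self, hX, hh]
  have := congrArg (fun f : V →L[ℝ] V => f (h⁻¹ • x)) (Ring.inverse_mul_cancel _ hu)
  simp only [clm_mul_apply, e] at this
  exact this

lemma tr_inverse_add_rankOne_mul {U W : V →L[ℝ] V} {a : V} {z : ℝ}
    (ha : inner ℝ x a = (0 : ℝ)) (hU : U x = 0)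
    (hUs : ∀ v w, inner ℝ (U v) w = inner ℝ v (U w))
    (hW : h • W = U - z • S - rankOne ℝ a X - rankOne ℝ X a) :
    h ^ 2 * tr (Ring.inverse (h • S + rankOne ℝ X X) * W) =
      tr (Ring.inverse (S + rankOne ℝ x x) * U) - z * (Module.finrank ℝ V - 1) := by
  set N := Ring.inverse (h • S + rankOne ℝ X X) with hN
  set R := Ring.inverse (S + rankOne ℝ x x) with hR
  have key : ∀ U : V →L[ℝ] V, U x = 0 → (∀ v w, inner ℝ (U v) w = inner ℝ v (U w)) →
      h * tr (N * U) = tr (R * U) := by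
    intro U hU hUs
    have e : h • (N * U) = R * U - rankOne ℝ (h⁻¹ • x) (U (R X)) := by
      ext v
      have hb : inner ℝ x (U v) = (0 : ℝ) := by rw [← hUs, hU, inner_zero_left]
      simp only [smul_apply, clm_mul_apply,
        sub_apply, rankOne_apply]
      rw [hN, hS.inverse_add_rankOne_apply hh hX hb, smul_inv_smul₀ hh, hUs, hS.inverse_symm,
        smul_smul, mul_comm h⁻¹]
    rw [← tr_smul, e, tr_sub, tr_rankOne, inner_smul_right, hUs, hU]
    simp
  have e2 : h * (h * tr (N * W)) = h * tr (N * (h • W)) := by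
    rw [mul_smul_comm, tr_smul]
  rw [pow_two, mul_assoc, e2, hW]
  simp only [mul_sub, tr_sub, mul_smul_comm, tr_smul, mul_rankOne, tr_rankOne]
  rw [key U hU hUs, hN, hS.inverse_add_rankOne_self hh hX,
    hS.inverse_add_rankOne_apply hh hX ha, ← hN, ← hR]
  have := key S hS.apply_self hS.symm
  rw [hR, hS.tr_inverse_mul] at this
  simp only [inner_smul_right, inner_sub_right, hX]
  rw [real_inner_comm x a, ha]
  have h3 : h * (z * tr (N * S)) = z * (Module.finrank ℝ V - 1) := by rw [← this]; ring
  rw [h3]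
  field_simp
  ring

end HessAt

lemma tr_mul_self_eq_sum_norm_sq {ι : Type*} [Fintype ι] {W : V →L[ℝ] V}
    (hW : ∀ v w, inner ℝ (W v) w = inner ℝ v (W w)) (d : OrthonormalBasis ι ℝ V) :
    tr (W * W) = ∑ i, ‖W (d i)‖ ^ 2 := by
  rw [tr_eq_sum_inner _ d]
  refine Finset.sum_congr rfl fun i _ => ?_
  rw [clm_mul_apply, ← hW, real_inner_self_eq_norm_sq]

/-- For positive definite `A ≤ Λ`, the form `W ↦ tr (A⁻¹ W A⁻¹ W)` on symmetric endomorphisms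
dominates the Hilbert–Schmidt norm. -/
lemma sum_norm_sq_le_tr {ι : Type*} [Fintype ι] (b : OrthonormalBasis ι ℝ V) {A W : V →L[ℝ] V}
    (hA : ∀ v w, inner ℝ (A v) w = inner ℝ v (A w)) (hpos : ∀ v ≠ 0, 0 < inner ℝ (A v) v)
    (hW : ∀ v w, inner ℝ (W v) w = inner ℝ v (W w)) {Λ : ℝ} (hΛ : ‖A‖ ≤ Λ) (hA' : IsUnit A) :
    ∑ i, ‖W (b i)‖ ^ 2 ≤ Λ ^ 2 * tr (Ring.inverse A * W * (Ring.inverse A * W)) := by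
  have hAs : A.toLinearMap.IsSymmetric := hA
  let c := hAs.eigenvectorBasis rfl
  let s := hAs.eigenvalues rfl
  have hc : ∀ i, A (c i) = s i • c i := fun i => hAs.apply_eigenvectorBasis rfl i
  have hn : ∀ i, ‖c i‖ = 1 := fun i => c.orthonormal.1 i
  have hs : ∀ i, s i = inner ℝ (A (c i)) (c i) := fun i => by
    rw [hc, inner_smul_left]; simp [hn]
  have hs0 : ∀ i, 0 < s i := fun i => by
    rw [hs]; exact hpos _ (by intro h; simpa [h] using hn i)
  have hsΛ : ∀ i, s i ≤ Λ := fun i => by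
    rw [hs]
    refine (real_inner_le_norm _ _).trans ?_
    rw [hn, mul_one]
    refine (A.le_opNorm _).trans ?_
    rw [hn, mul_one]; exact hΛ
  have hR : ∀ i, Ring.inverse A (c i) = (s i)⁻¹ • c i := fun i => by
    have : A ((s i)⁻¹ • c i) = c i := by rw [map_smul, hc, inv_smul_smul₀ (hs0 i).ne']
    conv_lhs => rw [← this]
    exact congrArg (fun f : V →L[ℝ] V => f _) (Ring.inverse_mul_cancel _ hA')
  have hRs : ∀ v w, inner ℝ (Ring.inverse A v) w = inner ℝ v (Ring.inverse A w) := by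
    intro v w
    have e : ∀ v, A (Ring.inverse A v) = v := fun v =>
      congrArg (fun f : V →L[ℝ] V => f v) (Ring.mul_inverse_cancel _ hA')
    conv_lhs => rw [← e w]
    rw [← hA, e]
  have e1 : ∑ i, ‖W (b i)‖ ^ 2 = ∑ i, ‖W (c i)‖ ^ 2 := by
    rw [← tr_mul_self_eq_sum_norm_sq hW b, tr_mul_self_eq_sum_norm_sq hW c]
  rw [e1, tr_eq_sum_inner _ c, Finset.mul_sum]
  refine Finset.sum_le_sum fun i _ => ?_
  simp only [clm_mul_apply]
  rw [← hRs, hR, inner_smul_left, ← hW]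
  have e3 : inner ℝ (W (c i)) (Ring.inverse A (W (c i))) =
      ∑ j, (s j)⁻¹ * (inner ℝ (c j) (W (c i)) : ℝ) ^ 2 := by
    rw [← c.sum_inner_mul_inner]
    refine Finset.sum_congr rfl fun j _ => ?_
    rw [← hRs, hR, inner_smul_left, real_inner_comm (c j)]
    simp; ring
  have e4 : ‖W (c i)‖ ^ 2 = ∑ j, (inner ℝ (c j) (W (c i)) : ℝ) ^ 2 := by
    rw [← c.sum_sq_norm_inner_right (W (c i))]; simp
  rw [e3, e4, Finset.mul_sum, Finset.mul_sum]
  refine Finset.sum_le_sum fun j _ => ?_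
  have hΛ0 : 0 < Λ := (hs0 i).trans_le (hsΛ i)
  have : 1 ≤ Λ ^ 2 * ((s i)⁻¹ * (s j)⁻¹) := by
    rw [← mul_inv, ← div_eq_mul_inv, le_div_iff₀ (mul_pos (hs0 i) (hs0 j)), one_mul, pow_two]
    exact mul_le_mul (hsΛ i) (hsΛ j) (hs0 j).le hΛ0.le
  simp only [RCLike.conj_to_real]
  nlinarith [sq_nonneg (inner ℝ (c j) (W (c i)) : ℝ)]

end LinearAlgebra

/-! ### Determinants along lines and polynomial identities under the integral -/

section Polynomials

open Polynomial

/-- If the evaluations at infinitely many points of a family of polynomials of bounded degree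
have integral zero, then so has each coefficient: by Lagrange interpolation a coefficient is a
fixed linear combination of evaluations. -/
lemma integral_coeff_eq_zero {α : Type*} [MeasurableSpace α] {μ : Measure α} {P : α → ℝ[X]} {d : ℕ}
    (hd : ∀ x, (P x).natDegree ≤ d) {T : Set ℝ} (hT : T.Infinite)
    (hint : ∀ t ∈ T, Integrable (fun x => (P x).eval t) μ)
    (h0 : ∀ t ∈ T, ∫ x, (P x).eval t ∂μ = 0) (k : ℕ) : ∫ x, (P x).coeff k ∂μ = 0 := by
  obtain ⟨s, hsT, hs⟩ := hT.exists_subset_card_eq (d + 1)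
  have key : ∀ x, (P x).coeff k =
      ∑ t ∈ s, (P x).eval t * (Lagrange.basis s id t).coeff k := by
    intro x
    have hdeg : (P x).degree < s.card := by
      rw [hs]
      exact (degree_le_of_natDegree_le (hd x)).trans_lt (by exact_mod_cast Nat.lt_succ_self d)
    conv_lhs => rw [Lagrange.eq_interpolate (v := id) (injOn_id _) hdeg]
    simp [Lagrange.interpolate_apply, finsetSum_coeff, coeff_C_mul]
  simp_rw [key]
  rw [integral_finsetSum _ fun t ht => (hint t (hsT ht)).mul_const _]
  exact Finset.sum_eq_zero fun t ht => by rw [integral_mul_const, h0 t (hsT ht), zero_mul]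

variable {V : Type*} [NormedAddCommGroup V] [InnerProductSpace ℝ V] [FiniteDimensional ℝ V]

/-- The polynomial `t ↦ det (A + t B)`. -/
noncomputable def detPoly (A B : V →L[ℝ] V) : ℝ[X] :=
  let e := (stdOrthonormalBasis ℝ V).toBasis
  Matrix.det ((X : ℝ[X]) • (LinearMap.toMatrix e e B.toLinearMap).map C +
    (LinearMap.toMatrix e e A.toLinearMap).map C)

lemma natDegree_detPoly_le (A B : V →L[ℝ] V) :
    (detPoly A B).natDegree ≤ Module.finrank ℝ V := by
  simpa [detPoly] using natDegree_det_X_add_C_le (LinearMap.toMatrix _ _ B.toLinearMap)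
    (LinearMap.toMatrix (stdOrthonormalBasis ℝ V).toBasis (stdOrthonormalBasis ℝ V).toBasis
      A.toLinearMap)

lemma eval_detPoly (A B : V →L[ℝ] V) (t : ℝ) : (detPoly A B).eval t = (A + t • B).det := by
  rw [ContinuousLinearMap.det, ← LinearMap.det_toMatrix (stdOrthonormalBasis ℝ V).toBasis, detPoly,
    ← coe_evalRingHom, RingHom.map_det]
  congr 1
  ext i j
  simp [LinearMap.toMatrix_apply, add_comm]
  ring

lemma hasDerivAt_det_one_add_smul (M : V →L[ℝ] V) :
    HasDerivAt (fun s : ℝ => (1 + s • M).det) (tr M) 0 := by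
  let e := (stdOrthonormalBasis ℝ V).toBasis
  let m := LinearMap.toMatrix e e M.toLinearMap
  have h1 : ∀ s : ℝ, (1 + s • M).det =
      (Matrix.det (1 + (X : ℝ[X]) • m.map C)).eval s := by
    intro s
    rw [Matrix.det_one_add_X_smul, ContinuousLinearMap.det, ← LinearMap.det_toMatrix e]
    have : LinearMap.toMatrix e e (1 + s • M).toLinearMap = 1 + s • m := by
      ext i j; simp [LinearMap.toMatrix_apply, m, Matrix.one_apply, Finsupp.single_apply, eq_comm]
    rw [this, Matrix.det_one_add_smul]
    simp
  have h2 := (Matrix.det (1 + (X : ℝ[X]) • m.map C)).hasDerivAt 0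
  rw [Matrix.derivative_det_one_add_X_smul] at h2
  have h3 : tr M = m.trace := LinearMap.trace_eq_matrix_trace ℝ e _
  rw [h3]
  exact h2.congr_of_eventuallyEq (.of_forall h1)

/-- Jacobi's formula along a line. -/
lemma hasDerivAt_det {A B : V →L[ℝ] V} {t : ℝ} (hA : IsUnit (A + t • B)) :
    HasDerivAt (fun s : ℝ => (A + s • B).det)
      ((A + t • B).det * tr (Ring.inverse (A + t • B) * B)) t := by
  have h1 : ∀ s : ℝ, (A + s • B).det =
      (A + t • B).det * (1 + (s - t) • (Ring.inverse (A + t • B) * B)).det := by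
    intro s
    rw [← det_mul, mul_add, mul_one, mul_smul_comm, ← mul_assoc, Ring.mul_inverse_cancel _ hA,
      one_mul]
    congr 1
    module
  have h2 : HasDerivAt (fun s : ℝ => (1 + (s - t) • (Ring.inverse (A + t • B) * B)).det)
      (tr (Ring.inverse (A + t • B) * B)) t := by
    have := hasDerivAt_det_one_add_smul (Ring.inverse (A + t • B) * B)
    rw [← sub_self t] at this
    simpa using this.comp_sub_const t t
  exact (h2.const_mul _).congr_of_eventuallyEq (.of_forall h1)

lemma eval_derivative_detPoly {A B : V →L[ℝ] V} {t : ℝ} (hA : IsUnit (A + t • B)) :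
    (derivative (detPoly A B)).eval t =
      (A + t • B).det * tr (Ring.inverse (A + t • B) * B) := by
  refine ((detPoly A B).hasDerivAt t).unique ?_
  simp_rw [eval_detPoly]
  exact hasDerivAt_det hA

lemma coeff_one_eq_eval_derivative (P : ℝ[X]) : P.coeff 1 = (derivative P).eval 0 := by
  rw [← coeff_zero_eq_eval_zero, coeff_derivative]; simp

lemma coeff_one_detPoly {A B : V →L[ℝ] V} (hA : IsUnit A) :
    (detPoly A B).coeff 1 = A.det * tr (Ring.inverse A * B) := by
  have := eval_derivative_detPoly (A := A) (B := B) (t := 0) (by simpa using hA)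
  rw [coeff_one_eq_eval_derivative, this]; simp

/-- The second derivative of `t ↦ det (A + t B)` at `0`. -/
lemma two_mul_coeff_two_detPoly {A B : V →L[ℝ] V} (hA : IsUnit A) :
    2 * (detPoly A B).coeff 2 = A.det * (tr (Ring.inverse A * B) ^ 2 -
      tr (Ring.inverse A * B * (Ring.inverse A * B))) := by
  have h1 : 2 * (detPoly A B).coeff 2 = (derivative (derivative (detPoly A B))).eval 0 := by
    rw [← coeff_zero_eq_eval_zero, coeff_derivative, coeff_derivative]; norm_num; ring
  have hcont : ContinuousAt (fun s : ℝ => A + s • B) 0 := by fun_prop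
  have hev : ∀ᶠ s : ℝ in 𝓝 0, IsUnit (A + s • B) := by
    refine hcont.eventually ?_
    have : IsUnit (A + (0 : ℝ) • B) := by simpa using hA
    exact Units.isOpen.mem_nhds this
  rw [h1]
  refine ((derivative (detPoly A B)).hasDerivAt 0).unique ?_
  have hinv : HasDerivAt (fun s : ℝ => Ring.inverse (A + s • B))
      (-(Ring.inverse A * B * Ring.inverse A)) 0 := by
    obtain ⟨u, rfl⟩ := hA
    have h3 : HasDerivAt (fun s : ℝ => (u : V →L[ℝ] V) + s • B) B 0 := by
      simpa using ((hasDerivAt_id (0 : ℝ)).smul_const B).const_add (u : V →L[ℝ] V)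
    have h4 := hasFDerivAt_ringInverse (𝕜 := ℝ) u
    have h5 : HasFDerivAt (𝕜 := ℝ) Ring.inverse
      (-ContinuousLinearMap.mulLeftRight ℝ (V →L[ℝ] V) ↑u⁻¹ ↑u⁻¹) ((u : V →L[ℝ] V) + (0:ℝ) • B) := by
      simpa using h4
    have h6 := h5.comp_hasDerivAt (0 : ℝ) h3
    refine h6.congr_deriv ?_
    simp
  have htr : HasDerivAt (fun s : ℝ => tr (Ring.inverse (A + s • B) * B))
      (-tr (Ring.inverse A * B * (Ring.inverse A * B))) 0 := by
    let l : (V →L[ℝ] V) →ₗ[ℝ] ℝ :=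
      { toFun := fun M => tr (M * B)
        map_add' := fun M N => by rw [add_mul, tr_add]
        map_smul' := fun c M => by rw [smul_mul_assoc, tr_smul]; rfl }
    have := (LinearMap.toContinuousLinearMap l).hasFDerivAt.comp_hasDerivAt (0 : ℝ) hinv
    refine this.congr_deriv ?_
    change tr (-(Ring.inverse A * B * Ring.inverse A) * B) = _
    rw [neg_mul, ← neg_one_smul ℝ, tr_smul, neg_one_mul, mul_assoc _ _ B]
  have hdet : HasDerivAt (fun s : ℝ => (A + s • B).det) (A.det * tr (Ring.inverse A * B)) 0 := by
    simpa using hasDerivAt_det (A := A) (B := B) (t := 0) (by simpa using hA)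
  have := hdet.mul htr
  refine (this.congr_of_eventuallyEq ?_).congr_deriv ?_
  · filter_upwards [hev] with s hs
    exact eval_derivative_detPoly hs
  · simp; ring

end Polynomials

/-! ### Null Lagrangians -/

section NullLagrangian

open Polynomial

variable {V : Type*} [NormedAddCommGroup V] [InnerProductSpace ℝ V] [FiniteDimensional ℝ V]

lemma coeff_finrank_detPoly_one (B : V →L[ℝ] V) :
    (detPoly 1 B).coeff (Module.finrank ℝ V) = B.det := by
  have := coeff_det_X_add_C_card
    (LinearMap.toMatrix (stdOrthonormalBasis ℝ V).toBasis (stdOrthonormalBasis ℝ V).toBasis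
      B.toLinearMap)
    (LinearMap.toMatrix (stdOrthonormalBasis ℝ V).toBasis (stdOrthonormalBasis ℝ V).toBasis
      (1 : V →L[ℝ] V).toLinearMap)
  rw [Fintype.card_fin] at this
  rw [detPoly, this, ContinuousLinearMap.det, LinearMap.det_toMatrix]

lemma continuous_det : Continuous fun A : V →L[ℝ] V => A.det :=
  ContinuousLinearMap.continuous_det

variable [MeasurableSpace V] [BorelSpace V]

lemma image_closedBall_id_add {Y : V → V} {C : NNReal} (hY : LipschitzWith C Y) (hC : C < 1)
    {R : ℝ} (hR : ∀ x ∉ closedBall (0 : V) R, Y x = 0) :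
    InjOn (fun x => x + Y x) (closedBall 0 R) ∧
      (fun x => x + Y x) '' closedBall 0 R = closedBall 0 R := by
  have happ : ApproximatesLinearOn (fun x => x + Y x)
      ((ContinuousLinearEquiv.refl ℝ V : V ≃L[ℝ] V) : V →L[ℝ] V) univ C := by
    intro x _ y _
    have : x + Y x - (y + Y y) - (x - y) = Y x - Y y := by abel
    simpa [this] using hY.norm_sub_le x y
  rcases subsingleton_or_nontrivial V with hs | hs
  · refine ⟨fun x _ y _ _ => Subsingleton.elim _ _, ?_⟩
    have : (fun x : V => x + Y x) = id := by ext x; exact Subsingleton.elim _ _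
    rw [this, image_id]
  have hc : Subsingleton V ∨ C < ‖((ContinuousLinearEquiv.refl ℝ V).symm : V →L[ℝ] V)‖₊⁻¹ := by
    right
    have : ‖((ContinuousLinearEquiv.refl ℝ V).symm : V →L[ℝ] V)‖₊ = 1 := by
      simp
    rw [this]; simpa using hC
  have hinj : Function.Injective (fun x => x + Y x) := by
    have := happ.injOn hc
    exact injOn_univ.1 this
  have hsurj := happ.surjective hc
  refine ⟨hinj.injOn, Subset.antisymm ?_ ?_⟩
  · rintro _ ⟨x, hx, rfl⟩
    by_contra h
    -- A point mapped outside the ball, where the map is the identity, would equal its image.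
    have h1 : (fun x => x + Y x) (x + Y x) = (fun x => x + Y x) x := by
      simp [hR _ h]
    have h2 : x + Y x = x := hinj h1
    have h3 : x + Y x ∉ closedBall (0 : V) R := h
    rw [h2] at h3
    exact h3 hx
  · intro y hy
    obtain ⟨x, rfl⟩ := hsurj y
    by_cases hx : x ∈ closedBall (0 : V) R
    · exact ⟨x, hx, rfl⟩
    · simp only [hR x hx, add_zero] at hy
      exact absurd hy hx

variable [Nontrivial V]

/-- The Jacobian determinant of a compactly supported map has integral zero: for small `ε` the map
`x + ε Y x` is a diffeomorphism of a large ball, so the polynomial `ε ↦ ∫ det (1 + ε DY)` over the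
ball is constant, and the integral of `det DY` is its top coefficient. -/
theorem integral_det_fderiv_eq_zero (μ : Measure V) [μ.IsAddHaarMeasure] {Y : V → V} (hY : ContDiff ℝ 1 Y)
    (hc : HasCompactSupport Y) : ∫ x, (fderiv ℝ Y x).det ∂μ = 0 := by
  obtain ⟨K, hK⟩ := hY.lipschitzWith_of_hasCompactSupport hc one_ne_zero
  obtain ⟨R, hR⟩ := hc.isCompact.isBounded.subset_closedBall (0 : V)
  have hR' : ∀ x ∉ closedBall (0 : V) R, Y x = 0 := fun x hx =>
    image_eq_zero_of_notMem_tsupport fun h => hx (hR h)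
  have hcont : Continuous (fderiv ℝ Y) := hY.continuous_fderiv one_ne_zero
  have hd : ∀ x, DifferentiableAt ℝ Y x := fun x => hY.differentiable one_ne_zero x
  have hDK : ∀ x, ‖fderiv ℝ Y x‖ ≤ K := fun x => norm_fderiv_le_of_lipschitz ℝ hK
  have hdet : ∀ᶠ ε : ℝ in 𝓝[>] 0, ∀ x, 0 < (1 + ε • fderiv ℝ Y x).det := by
    have h1 : ∀ᶠ A in 𝓝 (1 : V →L[ℝ] V), 0 < A.det :=
      continuous_det.continuousAt.eventually (lt_mem_nhds (by simp only [det_one]; exact one_pos))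
    obtain ⟨δ, hδ, h2⟩ := Metric.eventually_nhds_iff.1 h1
    have h3 : ∀ᶠ ε : ℝ in 𝓝[>] 0, ε * K < δ := by
      have : Tendsto (fun ε : ℝ => ε * K) (𝓝[>] 0) (𝓝 0) := by
        have : ContinuousAt (fun ε : ℝ => ε * K) 0 := by fun_prop
        simpa using this.tendsto.mono_left nhdsWithin_le_nhds
      exact this.eventually (gt_mem_nhds hδ)
    filter_upwards [h3, self_mem_nhdsWithin] with ε hε hε0 x
    apply h2
    rw [dist_eq_norm, add_sub_cancel_left, norm_smul, Real.norm_of_nonneg (le_of_lt hε0)]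
    exact (mul_le_mul_of_nonneg_left (hDK x) (le_of_lt hε0)).trans_lt hε
  have hlip : ∀ᶠ ε : ℝ in 𝓝[>] 0, ε * K < 1 := by
    have : Tendsto (fun ε : ℝ => ε * K) (𝓝[>] 0) (𝓝 0) := by
      have : ContinuousAt (fun ε : ℝ => ε * K) 0 := by fun_prop
      simpa using this.tendsto.mono_left nhdsWithin_le_nhds
    exact this.eventually (gt_mem_nhds one_pos)
  have hB : μ (closedBall (0 : V) R) < ⊤ := (isCompact_closedBall 0 R).measure_lt_top
  have hvol : ∀ᶠ ε : ℝ in 𝓝[>] 0,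
      ∫ x in closedBall (0 : V) R, (1 + ε • fderiv ℝ Y x).det ∂μ = μ.real (closedBall 0 R) := by
    filter_upwards [hdet, hlip, self_mem_nhdsWithin] with ε hε1 hε2 hε0
    have hε0' : (0 : ℝ) ≤ ε := le_of_lt hε0
    have hl : LipschitzWith (ε.toNNReal * K) (fun x => ε • Y x) := by
      refine LipschitzWith.of_dist_le_mul fun x y => ?_
      rw [dist_eq_norm, ← smul_sub, norm_smul, Real.norm_of_nonneg hε0', ← dist_eq_norm,
        NNReal.coe_mul, mul_assoc, Real.coe_toNNReal _ hε0']
      exact mul_le_mul_of_nonneg_left (hK.dist_le_mul x y) hε0'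
    obtain ⟨hinj, himg⟩ := image_closedBall_id_add hl (by
        rw [← NNReal.coe_lt_coe, NNReal.coe_mul, Real.coe_toNNReal _ hε0']; exact hε2) (R := R)
      (fun x hx => by rw [hR' x hx, smul_zero])
    have := integral_image_eq_integral_abs_det_fderiv_smul μ (s := closedBall (0 : V) R)
      measurableSet_closedBall (f := fun x => x + ε • Y x) (f' := fun x => 1 + ε • fderiv ℝ Y x)
      (fun x _ => ((hasFDerivAt_id x).add ((hd x).hasFDerivAt.const_smul ε)).hasFDerivWithinAt)
      hinj (fun _ => (1 : ℝ))
    rw [himg] at this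
    simp only [integral_const, smul_eq_mul, mul_one, measureReal_restrict_apply_univ] at this
    rw [this]
    exact integral_congr_ae (.of_forall fun x => by simp only [abs_of_pos (hε1 x)])
  obtain ⟨ε₀, hε₀, hvol⟩ := (nhdsGT_basis (0 : ℝ)).eventually_iff.1 hvol
  have hint : ∀ ε : ℝ, IntegrableOn (fun x => (1 + ε • fderiv ℝ Y x).det) (closedBall 0 R) μ := by
    intro ε
    refine ContinuousOn.integrableOn_compact (isCompact_closedBall 0 R) ?_
    exact (continuous_det.comp (by fun_prop)).continuousOn
  have h0 := integral_coeff_eq_zero (μ := μ.restrict (closedBall (0 : V) R))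
    (P := fun x => detPoly 1 (fderiv ℝ Y x) - C 1) (d := Module.finrank ℝ V)
    (fun x => (natDegree_sub_le _ _).trans (by simpa using natDegree_detPoly_le _ _))
    (T := Ioo 0 ε₀) (Ioo_infinite hε₀)
    (fun t _ => by
      simp only [eval_sub, eval_detPoly, eval_C]
      exact (hint t).sub (integrableOn_const hB.ne))
    (fun t ht => by
      simp only [eval_sub, eval_detPoly, eval_C]
      rw [integral_sub (hint t) (integrableOn_const hB.ne), hvol ht]
      simp)
    (Module.finrank ℝ V)
  have hn : Module.finrank ℝ V ≠ 0 := Module.finrank_pos.ne'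
  simp only [coeff_sub, coeff_finrank_detPoly_one, coeff_C, hn, if_false, sub_zero] at h0
  rw [← h0, setIntegral_eq_integral_of_forall_compl_eq_zero]
  intro x hx
  have : fderiv ℝ Y x = 0 := by
    have : x ∉ tsupport (fderiv ℝ Y) := fun h => hx (hR (tsupport_fderiv_subset ℝ h))
    exact image_eq_zero_of_notMem_tsupport this
  rw [this]
  simp [ContinuousLinearMap.det]

/-- The cofactor matrix of a `C¹` map is divergence free, in weak form. -/
theorem integral_det_mul_tr_eq_zero (μ : Measure V) [μ.IsAddHaarMeasure] {Y W : V → V}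
    (hY : ContDiffOn ℝ 1 Y {0}ᶜ) (hu : ∀ x ≠ 0, IsUnit (fderiv ℝ Y x)) (hW : ContDiff ℝ 1 W)
    (hc : HasCompactSupport W) (h0 : (0 : V) ∉ tsupport W) :
    ∫ x, (fderiv ℝ Y x).det * tr (Ring.inverse (fderiv ℝ Y x) * fderiv ℝ W x) ∂μ = 0 := by
  obtain ⟨R, hR⟩ := hc.isCompact.isBounded.subset_ball (0 : V)
  obtain ⟨η, hη0, hη1, -⟩ := exists_contMDiffMap_zero_one_nhds_of_isClosed (n := 1)
    (modelWithCornersSelf ℝ V) (s := {0} ∪ (ball (0 : V) R)ᶜ) (t := tsupport W)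
    (isClosed_singleton.union isOpen_ball.isClosed_compl) (isClosed_tsupport W) (by
      rw [Set.disjoint_left]
      rintro x (hx | hx) hxW
      · rw [mem_singleton_iff] at hx; exact h0 (hx ▸ hxW)
      · exact hx (hR hxW))
  have hηs : ContDiff ℝ 1 η := η.contMDiff.contDiff
  have hη00 : ∀ᶠ x in 𝓝 (0 : V), η x = 0 :=
    hη0.filter_mono (nhds_le_nhdsSet (by simp))
  have hηY : ContDiff ℝ 1 (fun x => η x • Y x) := by
    rw [contDiff_iff_contDiffAt]
    intro x
    by_cases hx : x = 0
    · subst hx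
      refine (contDiffAt_const (c := (0 : V))).congr_of_eventuallyEq ?_
      filter_upwards [hη00] with y hy
      simp [hy]
    · exact hηs.contDiffAt.smul (hY.contDiffAt (isOpen_compl_singleton.mem_nhds hx))
  have hηYc : HasCompactSupport (fun x => η x • Y x) := by
    refine HasCompactSupport.of_support_subset_isCompact (isCompact_closedBall (0 : V) R) ?_
    intro x hx
    by_contra h
    have : x ∈ {0} ∪ (ball (0 : V) R)ᶜ := Or.inr fun h' => h (ball_subset_closedBall h')
    exact hx (by simp [(hη0.filter_mono (nhds_le_nhdsSet this)).self_of_nhds])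
  have hder : ∀ x (t : ℝ), fderiv ℝ (fun x => η x • Y x + t • W x) x =
      fderiv ℝ (fun x => η x • Y x) x + t • fderiv ℝ W x := by
    intro x t
    exact (((hηY.differentiable one_ne_zero x).hasFDerivAt).add
      ((hW.differentiable one_ne_zero x).hasFDerivAt.const_smul t)).fderiv
  have hcs : ∀ t : ℝ, HasCompactSupport (fun x => η x • Y x + t • W x) := fun t =>
    hηYc.add (hc.smul_left (f := fun _ => t))
  have hcd : ∀ t : ℝ, ContDiff ℝ 1 (fun x => η x • Y x + t • W x) := fun t =>
    hηY.add (hW.const_smul t)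
  have hzero : ∀ t : ℝ, ∫ x, (fderiv ℝ (fun x => η x • Y x) x + t • fderiv ℝ W x).det ∂μ = 0 := by
    intro t
    simp_rw [← hder]
    exact integral_det_fderiv_eq_zero μ (hcd t) (hcs t)
  have hint : ∀ t : ℝ,
      Integrable (fun x => (fderiv ℝ (fun x => η x • Y x) x + t • fderiv ℝ W x).det) μ := by
    intro t
    simp_rw [← hder]
    refine Continuous.integrable_of_hasCompactSupport
      (continuous_det.comp ((hcd t).continuous_fderiv one_ne_zero)) ?_
    refine ((hcs t).fderiv ℝ).comp_left (g := fun A : V →L[ℝ] V => A.det) ?_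
    simp [ContinuousLinearMap.det]
  have h1 := integral_coeff_eq_zero (μ := μ)
    (P := fun x => detPoly (fderiv ℝ (fun x => η x • Y x) x) (fderiv ℝ W x))
    (fun x => natDegree_detPoly_le _ _) (T := univ) infinite_univ
    (fun t _ => by simpa only [eval_detPoly] using hint t)
    (fun t _ => by simpa only [eval_detPoly] using hzero t) 1
  rw [← h1]
  refine integral_congr_ae (.of_forall fun x => ?_)
  by_cases hx : x ∈ tsupport W
  · have hx0 : x ≠ 0 := fun h => h0 (h ▸ hx)
    have : fderiv ℝ (fun x => η x • Y x) x = fderiv ℝ Y x := by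
      refine Filter.EventuallyEq.fderiv_eq ?_
      filter_upwards [hη1.filter_mono (nhds_le_nhdsSet hx)] with y hy
      simp [hy]
    simp only [this]
    rw [coeff_one_detPoly (hu x hx0)]
  · have hW0 : fderiv ℝ W x = 0 :=
      image_eq_zero_of_notMem_tsupport fun h => hx (tsupport_fderiv_subset ℝ h)
    simp only [hW0, mul_zero, tr_zero]
    have : ∀ A : V →L[ℝ] V, detPoly A 0 = C A.det := by
      intro A
      refine Polynomial.funext fun t => ?_
      simp [eval_detPoly]
    rw [this, coeff_C]
    simp

end NullLagrangian

/-! ### Homogeneous functions -/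

section Homogeneous

variable {V : Type*} [NormedAddCommGroup V] [InnerProductSpace ℝ V] [FiniteDimensional ℝ V]
variable {F : Type*} [NormedAddCommGroup F] [NormedSpace ℝ F]

/-- The Hessian as an endomorphism: the derivative of the gradient field. -/
noncomputable def hess (f : V → ℝ) (x : V) : V →L[ℝ] V := fderiv ℝ (gradient f) x

/-- Positive homogeneity of degree `0`. -/
def IsHom0 (f : V → F) : Prop := ∀ r : ℝ, 0 < r → ∀ x, f (r • x) = f x

/-- Positive homogeneity of degree `1`. -/
def IsHom1 (f : V → F) : Prop := ∀ r : ℝ, 0 < r → ∀ x, f (r • x) = r • f x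

lemma IsHom1.map_zero {f : V → ℝ} (hf : IsHom1 f) : f 0 = 0 := by
  have := hf 2 two_pos 0
  simp at this
  linarith

lemma IsHom0.fderiv_smul {f : V → F} (hf : IsHom0 f) {r : ℝ} (hr : 0 < r) (x : V) :
    fderiv ℝ f (r • x) = r⁻¹ • fderiv ℝ f x := by
  have h : (fun y => f (r • y)) = f := funext fun y => hf r hr y
  have := fderiv_comp_smul (𝕜 := ℝ) (f := f) (x := x) r
  rw [h] at this
  rw [this, inv_smul_smul₀ hr.ne']

lemma IsHom1.fderiv_smul {f : V → F} (hf : IsHom1 f) {r : ℝ} (hr : 0 < r) (x : V) :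
    fderiv ℝ f (r • x) = fderiv ℝ f x := by
  have h : (fun y => f (r • y)) = r • f := funext fun y => hf r hr y
  have := fderiv_comp_smul (𝕜 := ℝ) (f := f) (x := x) r
  rw [h, fderiv_const_smul_field] at this
  exact (smul_right_injective _ hr.ne' this).symm

lemma IsHom0.fderiv_apply_self {f : V → F} (hf : IsHom0 f) {x : V}
    (hd : DifferentiableAt ℝ f x) : fderiv ℝ f x x = 0 := by
  have h1 : HasDerivAt (fun r : ℝ => r • x) x 1 := by
    simpa using (hasDerivAt_id (1 : ℝ)).smul_const x
  have h2 : HasDerivAt (fun r : ℝ => f (r • x)) (fderiv ℝ f x x) 1 := by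
    have : HasFDerivAt f (fderiv ℝ f x) ((1 : ℝ) • x) := by simpa using hd.hasFDerivAt
    exact this.comp_hasDerivAt (1 : ℝ) h1
  refine h2.unique ((hasDerivAt_const (1 : ℝ) (f x)).congr_of_eventuallyEq ?_)
  filter_upwards [lt_mem_nhds (zero_lt_one (α := ℝ))] with r hr using hf r hr x

lemma IsHom1.fderiv_apply_self {f : V → F} (hf : IsHom1 f) {x : V}
    (hd : DifferentiableAt ℝ f x) : fderiv ℝ f x x = f x := by
  have h1 : HasDerivAt (fun r : ℝ => r • x) x 1 := by
    simpa using (hasDerivAt_id (1 : ℝ)).smul_const x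
  have h2 : HasDerivAt (fun r : ℝ => f (r • x)) (fderiv ℝ f x x) 1 := by
    have : HasFDerivAt f (fderiv ℝ f x) ((1 : ℝ) • x) := by simpa using hd.hasFDerivAt
    exact this.comp_hasDerivAt (1 : ℝ) h1
  have h3 : HasDerivAt (fun r : ℝ => r • f x) (f x) 1 := by
    simpa using (hasDerivAt_id (1 : ℝ)).smul_const (f x)
  refine h2.unique (h3.congr_of_eventuallyEq ?_)
  filter_upwards [lt_mem_nhds (zero_lt_one (α := ℝ))] with r hr using hf r hr x

lemma inner_gradient (f : V → ℝ) (x v : V) : inner ℝ (gradient f x) v = fderiv ℝ f x v := by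
  simp [gradient]

lemma gradient_congr_fderiv {f g : V → ℝ} {x y : V} {c : ℝ} (h : fderiv ℝ f x = c • fderiv ℝ g y) :
    gradient f x = c • gradient g y := by
  rw [gradient, h, map_smul]; rfl

lemma contDiffOn_gradient {f : V → ℝ} (hf : ContDiffOn ℝ 2 f {0}ᶜ) :
    ContDiffOn ℝ 1 (gradient f) {0}ᶜ := by
  have h := hf.fderiv_of_isOpen isOpen_compl_singleton (m := 1) (by norm_num)
  exact (toDual ℝ V).symm.contDiff.comp_contDiffOn h

lemma continuousOn_gradient {f : V → ℝ} (hf : ContDiffOn ℝ 1 f {0}ᶜ) :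
    ContinuousOn (gradient f) {0}ᶜ := by
  have h := hf.continuousOn_fderiv_of_isOpen isOpen_compl_singleton le_rfl
  exact (toDual ℝ V).symm.continuous.comp_continuousOn h

lemma continuousOn_hess {f : V → ℝ} (hf : ContDiffOn ℝ 2 f {0}ᶜ) :
    ContinuousOn (hess f) {0}ᶜ :=
  (contDiffOn_gradient hf).continuousOn_fderiv_of_isOpen isOpen_compl_singleton le_rfl

lemma differentiableAt_of_contDiffOn {f : V → F} {k : WithTop ℕ∞} (hf : ContDiffOn ℝ k f {0}ᶜ)
    (hk : k ≠ 0) {x : V} (hx : x ≠ 0) : DifferentiableAt ℝ f x :=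
  (hf.contDiffAt (isOpen_compl_singleton.mem_nhds hx)).differentiableAt hk

lemma hasFDerivAt_gradient {f : V → ℝ} (hf : ContDiffOn ℝ 2 f {0}ᶜ) {x : V} (hx : x ≠ 0) :
    HasFDerivAt (gradient f) (hess f x) x :=
  (differentiableAt_of_contDiffOn (contDiffOn_gradient hf) one_ne_zero hx).hasFDerivAt

lemma inner_hess_symm {f : V → ℝ} (hf : ContDiffOn ℝ 2 f {0}ᶜ) {x : V} (hx : x ≠ 0) (v w : V) :
    inner ℝ (hess f x v) w = inner ℝ v (hess f x w) := by
  have hc : ContDiffAt ℝ 2 f x := hf.contDiffAt (isOpen_compl_singleton.mem_nhds hx)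
  have hs := hc.isSymmSndFDerivAt (by simp)
  have hd : DifferentiableAt ℝ (fderiv ℝ f) x :=
    (hc.fderiv_right (m := 1) (by norm_num)).differentiableAt one_ne_zero
  have e : ∀ v w, inner ℝ (hess f x v) w = fderiv ℝ (fderiv ℝ f) x v w := by
    intro v w
    have h1 := (hasFDerivAt_gradient hf hx).inner ℝ (hasFDerivAt_const w x)
    have h2 := hd.hasFDerivAt.clm_apply (hasFDerivAt_const w x)
    have h3 : (fun y => inner ℝ (gradient f y) w) = fun y => fderiv ℝ f y w :=
      funext fun y => inner_gradient f y w
    rw [h3] at h1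
    simpa [real_inner_comm] using congrArg (fun l : V →L[ℝ] ℝ => l v) (h1.unique h2)
  rw [real_inner_comm _ v, e, e]
  exact hs v w

lemma gradient_mul {f g : V → ℝ} {x : V} (hf : DifferentiableAt ℝ f x)
    (hg : DifferentiableAt ℝ g x) :
    gradient (fun y => f y * g y) x = f x • gradient g x + g x • gradient f x := by
  rw [gradient, fderiv_fun_mul hf hg]
  simp [gradient]

lemma gradient_add {f g : V → ℝ} {x : V} (hf : DifferentiableAt ℝ f x)
    (hg : DifferentiableAt ℝ g x) :
    gradient (fun y => f y + g y) x = gradient f x + gradient g x := by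
  rw [gradient, fderiv_fun_add hf hg]
  simp [gradient]

lemma gradient_const_mul {f : V → ℝ} {x : V} (c : ℝ) :
    gradient (fun y => c * f y) x = c • gradient f x := by
  have h2 : (fun y => c * f y) = c • f := rfl
  rw [gradient, h2, fderiv_const_smul_field]
  simp [gradient]

lemma gradient_comp {f : V → ℝ} {g : ℝ → ℝ} {g' : ℝ} {x : V} (hg : HasDerivAt g g' (f x))
    (hf : DifferentiableAt ℝ f x) : gradient (fun y => g (f y)) x = g' • gradient f x := by
  have : fderiv ℝ (fun y => g (f y)) x = g' • fderiv ℝ f x :=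
    (hg.comp_hasFDerivAt x hf.hasFDerivAt).fderiv
  rw [gradient, this]
  simp [gradient]

lemma hess_add {f g : V → ℝ} (hf : ContDiffOn ℝ 2 f {0}ᶜ) (hg : ContDiffOn ℝ 2 g {0}ᶜ) {x : V}
    (hx : x ≠ 0) : hess (fun y => f y + g y) x = hess f x + hess g x := by
  have h : gradient (fun y => f y + g y) =ᶠ[𝓝 x] fun y => gradient f y + gradient g y := by
    filter_upwards [isOpen_compl_singleton.mem_nhds hx] with y hy
    exact gradient_add (differentiableAt_of_contDiffOn hf two_ne_zero hy)
      (differentiableAt_of_contDiffOn hg two_ne_zero hy)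
  rw [hess, h.fderiv_eq]
  exact ((hasFDerivAt_gradient hf hx).add (hasFDerivAt_gradient hg hx)).fderiv

lemma hess_const_mul {f : V → ℝ} (hf : ContDiffOn ℝ 2 f {0}ᶜ) (c : ℝ) {x : V}
    (hx : x ≠ 0) : hess (fun y => c * f y) x = c • hess f x := by
  have h : gradient (fun y => c * f y) = fun y => c • gradient f y :=
    funext fun y => gradient_const_mul c
  rw [hess, h]
  exact ((hasFDerivAt_gradient hf hx).const_smul c).fderiv

lemma hess_mul {f g : V → ℝ} (hf : ContDiffOn ℝ 2 f {0}ᶜ) (hg : ContDiffOn ℝ 2 g {0}ᶜ) {x : V}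
    (hx : x ≠ 0) : hess (fun y => f y * g y) x = f x • hess g x + g x • hess f x +
      rankOne ℝ (gradient g x) (gradient f x) + rankOne ℝ (gradient f x) (gradient g x) := by
  have h : gradient (fun y => f y * g y) =ᶠ[𝓝 x]
      fun y => f y • gradient g y + g y • gradient f y := by
    filter_upwards [isOpen_compl_singleton.mem_nhds hx] with y hy
    exact gradient_mul (differentiableAt_of_contDiffOn hf two_ne_zero hy)
      (differentiableAt_of_contDiffOn hg two_ne_zero hy)
  rw [hess, h.fderiv_eq]
  have h1 := ((differentiableAt_of_contDiffOn hf two_ne_zero hx).hasFDerivAt).smul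
    (hasFDerivAt_gradient hg hx)
  have h2 := ((differentiableAt_of_contDiffOn hg two_ne_zero hx).hasFDerivAt).smul
    (hasFDerivAt_gradient hf hx)
  refine (h1.add h2).fderiv.trans ?_
  ext v
  simp
  abel

lemma gradient_linear (w x : V) : gradient (fun y => inner ℝ y w) x = w := by
  have h : HasFDerivAt (fun y : V => (inner ℝ y w : ℝ)) (innerSL ℝ w) x := by
    have : (fun y : V => (inner ℝ y w : ℝ)) = innerSL ℝ w := by
      ext y; simp [real_inner_comm]
    rw [this]; exact (innerSL ℝ w).hasFDerivAt
  rw [gradient, h.fderiv]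
  refine ext_inner_right ℝ fun v => ?_
  simp

lemma hess_linear (w x : V) : hess (fun y => inner ℝ y w) x = 0 := by
  have : gradient (fun y : V => (inner ℝ y w : ℝ)) = fun _ => w := funext (gradient_linear w)
  rw [hess, this]
  simp

lemma contDiff_linear (w : V) : ContDiff ℝ 2 (fun y : V => (inner ℝ y w : ℝ)) :=
  contDiff_id.inner ℝ contDiff_const

lemma contDiffOn_norm : ContDiffOn ℝ 2 (fun y : V => ‖y‖) {0}ᶜ :=
  fun _ hx => (contDiffAt_norm ℝ hx).contDiffWithinAt

lemma gradient_norm {x : V} (hx : x ≠ 0) : gradient (fun y : V => ‖y‖) x = ‖x‖⁻¹ • x := by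
  have h1 : HasFDerivAt (fun y : V => ‖y‖) (fderiv ℝ (fun y : V => ‖y‖) x) x :=
    (differentiableAt_of_contDiffOn contDiffOn_norm two_ne_zero hx).hasFDerivAt
  have h2 := (hasStrictFDerivAt_norm_sq x).hasFDerivAt
  have h3 := (h1.pow 2).unique h2
  refine ext_inner_right ℝ fun v => ?_
  rw [inner_gradient]
  have := congrArg (fun l : V →L[ℝ] ℝ => l v) h3
  simp at this
  rw [inner_smul_left]
  have hn : ‖x‖ ≠ 0 := norm_ne_zero_iff.2 hx
  simp
  field_simp
  linarith

lemma hess_norm {x : V} (hx : ‖x‖ = 1) :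
    hess (fun y : V => ‖y‖) x = 1 - rankOne ℝ x x := by
  have hx0 : x ≠ 0 := by rintro rfl; simp at hx
  have h1 : HasFDerivAt (fun y : V => ‖y‖) (fderiv ℝ (fun y : V => ‖y‖) x) x :=
    (differentiableAt_of_contDiffOn contDiffOn_norm two_ne_zero hx0).hasFDerivAt
  have h : gradient (fun y : V => ‖y‖) =ᶠ[𝓝 x] fun y => ‖y‖⁻¹ • y := by
    filter_upwards [isOpen_compl_singleton.mem_nhds hx0] with y hy using gradient_norm hy
  have h2 := ((hasDerivAt_inv (by rw [hx]; exact one_ne_zero)).comp_hasFDerivAt x h1).smul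
    (hasFDerivAt_id x)
  rw [hess, h.fderiv_eq]
  refine h2.fderiv.trans ?_
  ext v
  have : fderiv ℝ (fun y : V => ‖y‖) x v = inner ℝ x v := by
    rw [← inner_gradient, gradient_norm hx0, hx]; simp
  simp [hx, this, sub_eq_add_neg]

/-- A positive 1-homogeneous function that is `C²` away from the origin. -/
structure C2Hom1 (H : V → ℝ) : Prop where
  contDiffOn : ContDiffOn ℝ 2 H {0}ᶜ
  hom : IsHom1 H

/-- A 0-homogeneous function that is `C²` away from the origin. -/
structure C2Hom0 (Z : V → ℝ) : Prop where
  contDiffOn : ContDiffOn ℝ 2 Z {0}ᶜ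
  hom : IsHom0 Z

/-- A 0-homogeneous function that is `C¹` away from the origin. -/
structure C1Hom0 (f : V → ℝ) : Prop where
  contDiffOn : ContDiffOn ℝ 1 f {0}ᶜ
  hom : IsHom0 f

lemma C2Hom0.c1 {Z : V → ℝ} (hZ : C2Hom0 Z) : C1Hom0 Z :=
  ⟨hZ.contDiffOn.of_le (by norm_num), hZ.hom⟩

lemma C2Hom0.mul {Z H : V → ℝ} (hZ : C2Hom0 Z) (hH : C2Hom1 H) : C2Hom1 (fun y => Z y * H y) :=
  ⟨hZ.contDiffOn.mul hH.contDiffOn, fun r hr x => by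
    simp [hZ.hom r hr, hH.hom r hr]; ring⟩

lemma C2Hom1.add {G H : V → ℝ} (hG : C2Hom1 G) (hH : C2Hom1 H) : C2Hom1 (fun y => G y + H y) :=
  ⟨hG.contDiffOn.add hH.contDiffOn, fun r hr x => by
    simp [hG.hom r hr, hH.hom r hr]; ring⟩

lemma C2Hom1.const_mul {H : V → ℝ} (hH : C2Hom1 H) (c : ℝ) : C2Hom1 (fun y => c * H y) :=
  ⟨contDiffOn_const.mul hH.contDiffOn, fun r hr x => by
    simp [hH.hom r hr]; ring⟩

lemma C2Hom1.div {G H : V → ℝ} (hG : C2Hom1 G) (hH : C2Hom1 H) (h0 : ∀ x ≠ 0, H x ≠ 0) :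
    C2Hom0 (fun y => G y / H y) :=
  ⟨hG.contDiffOn.div hH.contDiffOn h0, fun r hr x => by
    simp [hG.hom r hr, hH.hom r hr, mul_div_mul_left _ _ hr.ne']⟩

lemma c2Hom1_norm : C2Hom1 (fun y : V => ‖y‖) :=
  ⟨contDiffOn_norm, fun r hr x => by simp [norm_smul, abs_of_pos hr]⟩

lemma c2Hom1_linear (w : V) : C2Hom1 (fun y : V => (inner ℝ y w : ℝ)) :=
  ⟨(contDiff_linear w).contDiffOn, fun r hr x => by simp [inner_smul_left]⟩

lemma C2Hom1.inner_gradient_self {H : V → ℝ} (hH : C2Hom1 H) {x : V} (hx : x ≠ 0) :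
    inner ℝ (gradient H x) x = H x := by
  rw [inner_gradient,
    hH.hom.fderiv_apply_self (differentiableAt_of_contDiffOn hH.contDiffOn two_ne_zero hx)]

lemma C2Hom1.gradient_hom {H : V → ℝ} (hH : C2Hom1 H) : IsHom0 (gradient H) := fun r hr x => by
  rw [gradient, hH.hom.fderiv_smul hr]; rfl

lemma C2Hom1.hess_self {H : V → ℝ} (hH : C2Hom1 H) {x : V} (hx : x ≠ 0) : hess H x x = 0 :=
  hH.gradient_hom.fderiv_apply_self (hasFDerivAt_gradient hH.contDiffOn hx).differentiableAt

lemma C1Hom0.inner_gradient_self {f : V → ℝ} (hf : C1Hom0 f) {x : V} (hx : x ≠ 0) :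
    inner ℝ x (gradient f x) = (0 : ℝ) := by
  rw [real_inner_comm, inner_gradient,
    hf.hom.fderiv_apply_self (differentiableAt_of_contDiffOn hf.contDiffOn one_ne_zero hx)]

lemma IsHom0.gradient_smul {f : V → ℝ} (hf : IsHom0 f) {r : ℝ} (hr : 0 < r) (x : V) :
    gradient f (r • x) = r⁻¹ • gradient f x :=
  gradient_congr_fderiv (hf.fderiv_smul hr x)

/-- The components of the gradient of a 1-homogeneous `C²` function. -/
lemma C2Hom1.c1Hom0_gradient {H : V → ℝ} (hH : C2Hom1 H) (w : V) :
    C1Hom0 (fun y => inner ℝ (gradient H y) w) :=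
  ⟨(contDiffOn_gradient hH.contDiffOn).inner ℝ contDiffOn_const, fun r hr x => by
    simp only [hH.gradient_hom r hr]⟩

lemma C2Hom1.gradient_inner_gradient {H : V → ℝ} (hH : C2Hom1 H) (w : V) {x : V} (hx : x ≠ 0) :
    gradient (fun y => inner ℝ (gradient H y) w) x = hess H x w := by
  have h := (hasFDerivAt_gradient hH.contDiffOn hx).inner ℝ (hasFDerivAt_const w x)
  refine ext_inner_right ℝ fun v => ?_
  rw [inner_gradient, h.fderiv, inner_hess_symm hH.contDiffOn hx]
  simp [real_inner_comm]

end Homogeneous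

/-! ### Polar coordinates -/

section Polar

variable {V : Type*} [NormedAddCommGroup V] [InnerProductSpace ℝ V] [FiniteDimensional ℝ V]
  [MeasurableSpace V] [BorelSpace V] [Nontrivial V] (μ : Measure V) [μ.IsAddHaarMeasure]

lemma lintegral_polar {g : V → ENNReal} (hg : Measurable g) :
    ∫⁻ x, g x ∂μ = ∫⁻ s : sphere (0 : V) 1, (∫⁻ r in Ioi (0 : ℝ),
      ENNReal.ofReal (r ^ (Module.finrank ℝ V - 1)) * g (r • (s : V))) ∂μ.toSphere := by
  have h1 : ∫⁻ x, g x ∂μ = ∫⁻ x : ({0}ᶜ : Set V), g x ∂(μ.comap (↑)) := by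
    rw [lintegral_subtype_comap (measurableSet_singleton _).compl, restrict_compl_singleton]
  have h2 := (μ.measurePreserving_homeomorphUnitSphereProd).lintegral_comp_emb
    (Homeomorph.measurableEmbedding _)
    (fun p => g (((homeomorphUnitSphereProd V).symm p : ({0}ᶜ : Set V)) : V))
  simp only [Homeomorph.symm_apply_apply] at h2
  rw [h1, h2, lintegral_prod]
  · refine lintegral_congr fun s => ?_
    rw [Measure.volumeIoiPow, lintegral_withDensity_eq_lintegral_mul]
    · rw [← lintegral_subtype_comap measurableSet_Ioi]
      rfl
    · fun_prop
    · exact hg.comp (by fun_prop)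
  · exact (hg.comp (measurable_subtype_coe.comp
      (homeomorphUnitSphereProd V).symm.measurable)).aemeasurable

lemma integral_polar {g : V → ℝ} (hg : Integrable g μ) :
    ∫ x, g x ∂μ = ∫ s : sphere (0 : V) 1, (∫ r in Ioi (0 : ℝ),
      r ^ (Module.finrank ℝ V - 1) * g (r • (s : V))) ∂μ.toSphere := by
  have h1 : ∫ x, g x ∂μ = ∫ x : ({0}ᶜ : Set V), g x ∂(μ.comap (↑)) := by
    rw [integral_subtype_comap (measurableSet_singleton _).compl, restrict_compl_singleton]
  have h2 := (μ.measurePreserving_homeomorphUnitSphereProd).integral_comp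
    (Homeomorph.measurableEmbedding _)
    (fun p => g (((homeomorphUnitSphereProd V).symm p : ({0}ᶜ : Set V)) : V))
  have hi : Integrable (fun p => g (((homeomorphUnitSphereProd V).symm p : ({0}ᶜ : Set V)) : V))
      (μ.toSphere.prod (Measure.volumeIoiPow (Module.finrank ℝ V - 1))) := by
    rw [← (μ.measurePreserving_homeomorphUnitSphereProd).integrable_comp_emb
      (Homeomorph.measurableEmbedding _)]
    have : Integrable (fun x : ({0}ᶜ : Set V) => g x) (μ.comap (↑)) := by
      have := (integrableOn_iff_comap_subtypeVal (μ := μ) (f := g)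
        (measurableSet_singleton (0 : V)).compl).1 hg.integrableOn
      exact this
    refine this.congr (.of_forall fun x => ?_)
    have hx : ‖(x : V)‖ ≠ 0 := norm_ne_zero_iff.2 x.2
    simp [smul_inv_smul₀ hx]
  simp only [Homeomorph.symm_apply_apply] at h2
  rw [h1, h2, integral_prod _ hi]
  refine integral_congr_ae (.of_forall fun s => ?_)
  simp only
  rw [Measure.volumeIoiPow, integral_withDensity_eq_integral_toReal_smul]
  · rw [← integral_subtype_comap measurableSet_Ioi]
    refine integral_congr_ae (.of_forall fun r => ?_)
    have : (0 : ℝ) ≤ (r : ℝ) ^ (Module.finrank ℝ V - 1) := pow_nonneg (le_of_lt r.2) _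
    simp [ENNReal.toReal_ofReal this]
  · fun_prop
  · exact .of_forall fun r => ENNReal.ofReal_lt_top

end Polar

section Bounds

variable {V : Type*} [NormedAddCommGroup V] [InnerProductSpace ℝ V] [FiniteDimensional ℝ V]

lemma IsHom1.eq_norm_mul {H : V → ℝ} (hH : IsHom1 H) {x : V} (hx : x ≠ 0) :
    H x = ‖x‖ * H (‖x‖⁻¹ • x) := by
  have := hH ‖x‖ (norm_pos_iff.2 hx) (‖x‖⁻¹ • x)
  rwa [smul_inv_smul₀ (norm_ne_zero_iff.2 hx), smul_eq_mul] at this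

lemma norm_inv_norm_smul {x : V} (hx : x ≠ 0) : ‖‖x‖⁻¹ • x‖ = 1 := by
  simp [norm_smul, hx]

lemma ne_zero_of_norm_eq_one {x : V} (hx : ‖x‖ = 1) : x ≠ 0 := by
  rintro rfl; simp at hx

variable [Nontrivial V]

lemma IsHom1.exists_bounds {H : V → ℝ} (hH : IsHom1 H) (hc : ContinuousOn H {0}ᶜ)
    (hpos : ∀ x ≠ 0, 0 < H x) :
    ∃ m M : ℝ, 0 < m ∧ 0 < M ∧ ∀ x, m * ‖x‖ ≤ H x ∧ H x ≤ M * ‖x‖ := by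
  have hcs : ContinuousOn H (sphere (0 : V) 1) :=
    hc.mono fun x hx => ne_zero_of_norm_eq_one (by simpa using hx)
  have hne : (sphere (0 : V) 1).Nonempty := NormedSpace.sphere_nonempty.2 zero_le_one
  obtain ⟨a, ha, hmin⟩ := (isCompact_sphere (0 : V) 1).exists_isMinOn hne hcs
  obtain ⟨b, hb, hmax⟩ := (isCompact_sphere (0 : V) 1).exists_isMaxOn hne hcs
  have hpos' : ∀ x ∈ sphere (0 : V) 1, 0 < H x := fun x hx =>
    hpos x (ne_zero_of_norm_eq_one (by simpa using hx))
  refine ⟨H a, H b, hpos' a ha, hpos' b hb, fun x => ?_⟩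
  by_cases hx : x = 0
  · subst hx; simp [hH.map_zero]
  have hs : ‖x‖⁻¹ • x ∈ sphere (0 : V) 1 := by simp [norm_inv_norm_smul hx]
  rw [hH.eq_norm_mul hx, mul_comm (H a), mul_comm (H b)]
  exact ⟨mul_le_mul_of_nonneg_left (hmin hs) (norm_nonneg _),
    mul_le_mul_of_nonneg_left (hmax hs) (norm_nonneg _)⟩

end Bounds

/-! ### Green's formula for the Hilbert–Brunn–Minkowski operator -/

section Green

variable {V : Type*} [NormedAddCommGroup V] [InnerProductSpace ℝ V] [FiniteDimensional ℝ V]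

/-- The Hessian of a 1-homogeneous function at a unit vector `x`, made invertible by adding the
projection onto the line of `x`. -/
noncomputable def hatHess (H : V → ℝ) (x : V) : V →L[ℝ] V := hess H x + rankOne ℝ x x

/-- A positive 1-homogeneous `C²` function with invertible tangential Hessian. -/
structure Nondeg (H : V → ℝ) : Prop extends C2Hom1 H where
  pos : ∀ x ≠ 0, 0 < H x
  isUnit : ∀ x, ‖x‖ = 1 → IsUnit (hatHess H x)

lemma C2Hom1.hessAt {H : V → ℝ} (hH : C2Hom1 H) {x : V} (hx : ‖x‖ = 1)
    (hu : IsUnit (hatHess H x)) : HessAt x (hess H x) :=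
  ⟨hx, hH.hess_self (ne_zero_of_norm_eq_one hx),
    inner_hess_symm hH.contDiffOn (ne_zero_of_norm_eq_one hx), hu⟩

lemma Nondeg.hessAt {H : V → ℝ} (hH : Nondeg H) {x : V} (hx : ‖x‖ = 1) : HessAt x (hess H x) :=
  hH.toC2Hom1.hessAt hx (hH.isUnit x hx)

lemma C2Hom1.contDiffOn_smul_gradient {H : V → ℝ} (hH : C2Hom1 H) :
    ContDiffOn ℝ 1 (fun x => H x • gradient H x) {0}ᶜ :=
  (hH.contDiffOn.of_le (by norm_num)).smul (contDiffOn_gradient hH.contDiffOn)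

lemma C2Hom1.isHom1_smul_gradient {H : V → ℝ} (hH : C2Hom1 H) :
    IsHom1 (fun x => H x • gradient H x) := fun r hr x => by
  simp only [hH.hom r hr, hH.gradient_hom r hr, smul_assoc]

lemma C2Hom1.fderiv_smul_gradient {H : V → ℝ} (hH : C2Hom1 H) {x : V} (hx : x ≠ 0) :
    fderiv ℝ (fun x => H x • gradient H x) x =
      H x • hess H x + rankOne ℝ (gradient H x) (gradient H x) := by
  have h1 := ((differentiableAt_of_contDiffOn hH.contDiffOn two_ne_zero hx).hasFDerivAt).smul
    (hasFDerivAt_gradient hH.contDiffOn hx)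
  refine h1.fderiv.trans ?_
  ext v
  simp

lemma C2Hom0.hess_smul {Z : V → ℝ} (hZ : C2Hom0 Z) {r : ℝ} (hr : 0 < r) {x : V} :
    hess Z (r • x) = (r ^ 2)⁻¹ • hess Z x := by
  have h : (fun y => gradient Z (r • y)) = r⁻¹ • gradient Z :=
    funext fun y => hZ.hom.gradient_smul hr y
  have := fderiv_comp_smul (𝕜 := ℝ) (f := gradient Z) (x := x) r
  rw [h, fderiv_const_smul_field] at this
  rw [hess, hess, ← inv_smul_smul₀ hr.ne' (fderiv ℝ (gradient Z) (r • x)), ← this]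
  simp only [smul_smul, Pi.smul_apply]
  congr 1
  field_simp

/-- The derivative of the vector field tested against the divergence free cofactor field in Green's
formula. -/
lemma fderiv_field {f Z H : V → ℝ} {ρ : ℝ → ℝ} (hf : C1Hom0 f) (hZ : C2Hom0 Z) (hH : C2Hom1 H)
    (hρ : ContDiff ℝ 1 ρ) {x : V} (hx : x ≠ 0) :
    fderiv ℝ (fun y => (f y * ρ (H y)) • gradient Z y) x =
      (f x * ρ (H x)) • hess Z x + rankOne ℝ (gradient Z x)
        (ρ (H x) • gradient f x + (f x * deriv ρ (H x)) • gradient H x) := by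
  have hfd := differentiableAt_of_contDiffOn hf.contDiffOn one_ne_zero hx
  have hHd := differentiableAt_of_contDiffOn hH.contDiffOn two_ne_zero hx
  have h1 : HasFDerivAt (fun y => ρ (H y)) (deriv ρ (H x) • fderiv ℝ H x) x :=
    (hρ.differentiable one_ne_zero (H x)).hasDerivAt.comp_hasFDerivAt x hHd.hasFDerivAt
  have h2 := (hfd.hasFDerivAt.mul h1).smul (hasFDerivAt_gradient hZ.contDiffOn hx)
  refine h2.fderiv.trans ?_
  ext v
  simp only [add_apply, smul_apply, ContinuousLinearMap.smulRight_apply, rankOne_apply,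
    inner_add_left, inner_smul_left, inner_gradient, smul_eq_mul]
  congr 2
  simp
  ring

/-- The pointwise content of Green's formula, in the direction `s` at distance `r`. -/
lemma green_pointwise {f Z H : V → ℝ} {ρ : ℝ → ℝ} (hf : C1Hom0 f) (hZ : C2Hom0 Z) (hH : Nondeg H)
    (hρ : ContDiff ℝ 1 ρ) {s : V} (hs : ‖s‖ = 1) {r : ℝ} (hr : 0 < r) :
    (fderiv ℝ (fun x => H x • gradient H x) (r • s)).det *
      tr (Ring.inverse (fderiv ℝ (fun x => H x • gradient H x) (r • s)) *
        fderiv ℝ (fun y => (f y * ρ (H y)) • gradient Z y) (r • s)) =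
    (r ^ 2)⁻¹ * ρ (r * H s) * ((H s ^ (Module.finrank ℝ V + 1) * (H s ^ 2)⁻¹) *
      ((hatHess H s).det * (f s * (tr (Ring.inverse (hatHess H s) * hess (fun y => Z y * H y) s)
        - (Module.finrank ℝ V - 1) * Z s) +
        H s * inner ℝ (gradient f s) (Ring.inverse (hatHess H s) (gradient Z s))))) := by
  have hs0 : s ≠ 0 := ne_zero_of_norm_eq_one hs
  have hrs : r • s ≠ 0 := smul_ne_zero hr.ne' hs0
  have hA := hH.hessAt hs
  have hh : H s ≠ 0 := (hH.pos s hs0).ne'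
  have hX := hH.toC2Hom1.inner_gradient_self hs0
  have hZs : inner ℝ s (gradient Z s) = (0 : ℝ) := hZ.c1.inner_gradient_self hs0
  have hfs : inner ℝ s (gradient f s) = (0 : ℝ) := hf.inner_gradient_self hs0
  have hXZ : inner ℝ (gradient H s)
      (Ring.inverse (H s • hess H s + rankOne ℝ (gradient H s) (gradient H s)) (gradient Z s))
      = (0 : ℝ) := by
    rw [hA.inverse_add_rankOne_apply hh hX hZs]
    simp only [inner_smul_right, inner_sub_right, hX]
    field_simp
    ring
  have hfZ : inner ℝ (gradient f s)
      (Ring.inverse (H s • hess H s + rankOne ℝ (gradient H s) (gradient H s)) (gradient Z s))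
      = (H s)⁻¹ * inner ℝ (gradient f s) (Ring.inverse (hatHess H s) (gradient Z s)) := by
    rw [hA.inverse_add_rankOne_apply hh hX hZs]
    simp only [inner_smul_right, inner_sub_right]
    rw [real_inner_comm s (gradient f s), hfs]
    simp [hatHess]
  have hW := hA.tr_inverse_add_rankOne_mul hh hX (W := hess Z s) (z := Z s) hZs
    ((hZ.mul hH.toC2Hom1).hess_self hs0)
    (inner_hess_symm (hZ.mul hH.toC2Hom1).contDiffOn hs0) (by
      rw [hess_mul hZ.contDiffOn hH.contDiffOn hs0]
      abel)
  rw [fderiv_field hf hZ hH.toC2Hom1 hρ hrs, hH.isHom1_smul_gradient.fderiv_smul hr,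
    hH.fderiv_smul_gradient hs0, hZ.hess_smul hr, hf.hom r hr, hH.hom r hr,
    hZ.hom.gradient_smul hr, hf.hom.gradient_smul hr, hH.gradient_hom r hr, smul_eq_mul,
    det_add_rankOne_self hs (hA.apply_self) hA.symm _ hh hX]
  rw [mul_add, tr_add, mul_smul_comm, mul_smul_comm, tr_smul, tr_smul, mul_rankOne, tr_rankOne,
    map_smul, inner_smul_right, inner_add_left, inner_smul_left, inner_smul_left, inner_smul_left,
    hXZ, hfZ]
  change _ = _ * ((_) * ((hatHess H s).det * (_ * (tr (Ring.inverse (hatHess H s) * _) - _) + _)))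
  have hW' : tr (Ring.inverse (H s • hess H s + rankOne ℝ (gradient H s) (gradient H s)) * hess Z s)
      = (H s ^ 2)⁻¹ * (tr (Ring.inverse (hatHess H s) * hess (fun y => Z y * H y) s)
        - (Module.finrank ℝ V - 1) * Z s) := by
    rw [mul_comm _ (Z s)]
    rw [eq_inv_mul_iff_mul_eq₀ (pow_ne_zero 2 hh)]
    exact hW
  rw [hW']
  simp only [hatHess, RCLike.conj_to_real]
  field_simp
  ring

variable [MeasurableSpace V] [BorelSpace V] [Nontrivial V] (μ : Measure V) [μ.IsAddHaarMeasure]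

/-- Green's formula: `∫ (f · L z + h Q(∇z, ∇f) / (n - 1)) dV = 0`, up to normalization, for the
Hilbert–Brunn–Minkowski operator `L` of `H`. It is the weak divergence-freeness of the cofactor of
the Hessian of `H² / 2`, tested against the field `f ρ(H) ∇Z`, where `ρ` is a radial cutoff. -/
theorem green {f Z H : V → ℝ} (hf : C1Hom0 f) (hZ : C2Hom0 Z) (hH : Nondeg H) :
    ∫ s : sphere (0 : V) 1, (hatHess H s).det * (H s * f s *
      (tr (Ring.inverse (hatHess H s) * hess (fun y => Z y * H y) s)
        - (Module.finrank ℝ V - 1) * Z s) +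
      H s ^ 2 * inner ℝ (gradient f s) (Ring.inverse (hatHess H s) (gradient Z s)))
      ∂μ.toSphere = 0 := by
  let ρ : ContDiffBump (2 : ℝ) := ⟨1 / 2, 1, by norm_num, by norm_num⟩
  have hρ : ContDiff ℝ 1 ρ := ρ.contDiff
  have hρ0 : ∀ t, t ∉ Ioo (1 : ℝ) 3 → ρ t = 0 := by
    intro t ht
    by_contra h
    have : t ∈ Function.support ρ := h
    rw [ρ.support_eq, Real.ball_eq_Ioo] at this
    norm_num [ρ] at this
    exact ht this
  obtain ⟨m, M, hm, hM, hb⟩ := hH.hom.exists_bounds hH.contDiffOn.continuousOn hH.pos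
  set Y : V → V := fun x => H x • gradient H x with hY
  set W : V → V := fun y => (f y * ρ (H y)) • gradient Z y with hW
  -- The field lives in this shell.
  set K : Set V := {x | 1 ≤ M * ‖x‖} ∩ closedBall 0 (3 / m) with hK
  have hKc : IsCompact K := (isCompact_closedBall (0 : V) (3 / m)).inter_left
    (isClosed_le continuous_const (by fun_prop))
  have hK0 : (0 : V) ∉ K := fun h => by
    have := h.1; simp at this; linarith
  have hWK : ∀ x ∉ K, W x = 0 := by
    intro x hx
    have : ρ (H x) = 0 := by
      apply hρ0
      rintro ⟨h1, h2⟩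
      apply hx
      refine ⟨h1.le.trans (hb x).2, ?_⟩
      rw [mem_closedBall_zero_iff, le_div_iff₀ hm, mul_comm]
      exact ((hb x).1.trans_lt h2).le
    simp [hW, this]
  have hsupp : tsupport W ⊆ K :=
    closure_minimal (fun x hx => by_contra fun h => hx (hWK x h)) hKc.isClosed
  have hWc : HasCompactSupport W := hKc.of_isClosed_subset isClosed_closure hsupp
  have hWon : ContDiffOn ℝ 1 W {0}ᶜ :=
    (hf.contDiffOn.mul (hρ.comp_contDiffOn (hH.contDiffOn.of_le (by norm_num)))).smul
      (contDiffOn_gradient hZ.contDiffOn)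
  have hWs : ContDiff ℝ 1 W := by
    rw [contDiff_iff_contDiffAt]
    intro x
    by_cases hx : x = 0
    · subst hx
      refine (contDiffAt_const (c := (0 : V))).congr_of_eventuallyEq ?_
      filter_upwards [hKc.isClosed.isOpen_compl.mem_nhds hK0] with y hy using hWK y hy
    · exact hWon.contDiffAt (isOpen_compl_singleton.mem_nhds hx)
  have hunit : ∀ x ≠ 0, IsUnit (fderiv ℝ Y x) := by
    intro x hx
    have hs := norm_inv_norm_smul hx
    have hs0 := ne_zero_of_norm_eq_one hs
    have h1 := hH.isHom1_smul_gradient.fderiv_smul (norm_pos_iff.2 hx) (‖x‖⁻¹ • x)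
    rw [smul_inv_smul₀ (norm_ne_zero_iff.2 hx)] at h1
    rw [hY, h1, hH.fderiv_smul_gradient hs0]
    exact (hH.hessAt hs).isUnit_add_rankOne (hH.pos _ hs0).ne' (hH.inner_gradient_self hs0)
  have hmain := integral_det_mul_tr_eq_zero μ hH.contDiffOn_smul_gradient hunit hWs hWc
    (fun h => hK0 (hsupp h))
  have hint : Integrable (fun x => (fderiv ℝ Y x).det *
      tr (Ring.inverse (fderiv ℝ Y x) * fderiv ℝ W x)) μ := by
    rw [← integrableOn_iff_integrable_of_support_subset (s := K)]
    · refine ContinuousOn.integrableOn_compact hKc ?_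
      have hKs : K ⊆ {0}ᶜ := fun x hx h => hK0 (h ▸ hx)
      have hYc : ContinuousOn (fderiv ℝ Y) K :=
        (hH.contDiffOn_smul_gradient.continuousOn_fderiv_of_isOpen isOpen_compl_singleton
          le_rfl).mono hKs
      have hYi : ContinuousOn (fun x => Ring.inverse (fderiv ℝ Y x)) K := by
        intro x hx
        obtain ⟨u, hu⟩ := hunit x (hKs hx)
        have : ContinuousAt Ring.inverse (fderiv ℝ Y x) := by
          rw [← hu]; exact NormedRing.inverse_continuousAt u
        exact this.comp_continuousWithinAt (hYc x hx)
      have htr : Continuous (tr : (V →L[ℝ] V) → ℝ) :=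
        (LinearMap.toContinuousLinearMap (⟨⟨tr, tr_add⟩, tr_smul⟩ :
          (V →L[ℝ] V) →ₗ[ℝ] ℝ)).continuous
      exact (continuous_det.comp_continuousOn hYc).mul (htr.comp_continuousOn
        (hYi.mul (hWs.continuous_fderiv one_ne_zero).continuousOn))
    · intro x hx
      by_contra h
      apply hx
      have : fderiv ℝ W x = 0 :=
        image_eq_zero_of_notMem_tsupport fun h' => h (hsupp (tsupport_fderiv_subset ℝ h'))
      simp [this, tr_zero]
  rw [integral_polar μ hint] at hmain
  set d := Module.finrank ℝ V with hd
  set c : ℝ := ∫ t in Ioi (0 : ℝ), t ^ (d - 1) * ((t ^ 2)⁻¹ * ρ t) with hc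
  have hcpos : 0 < c := by
    rw [hc, setIntegral_pos_iff_support_of_nonneg_ae]
    · refine lt_of_lt_of_le ?_ (measure_mono (show Ioo (1 : ℝ) 3 ⊆ _ from fun t ht => ?_))
      · simp
      · have ht0 : 0 < t := zero_lt_one.trans ht.1
        refine ⟨?_, ht0⟩
        have : t ∈ Function.support ρ := by
          rw [ρ.support_eq, Real.ball_eq_Ioo]
          norm_num [ρ]
          exact ht
        exact mul_ne_zero (pow_pos ht0 _).ne' (mul_ne_zero (by positivity) this)
    · filter_upwards [ae_restrict_mem measurableSet_Ioi] with t ht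
      have ht0 : (0 : ℝ) < t := ht
      have := ρ.nonneg (x := t)
      simp only [Pi.zero_apply]
      positivity
    · have h1 : IntegrableOn (fun t : ℝ => t ^ (d - 1) * ((t ^ 2)⁻¹ * ρ t)) (Icc 1 3) := by
        refine ContinuousOn.integrableOn_compact isCompact_Icc ?_
        refine ContinuousOn.mul (by fun_prop) (ContinuousOn.mul (ContinuousOn.inv₀ (by fun_prop)
          fun t ht => ?_) hρ.continuous.continuousOn)
        have : (0 : ℝ) < t := zero_lt_one.trans_le ht.1
        positivity
      have h2 : Integrable (fun t : ℝ => t ^ (d - 1) * ((t ^ 2)⁻¹ * ρ t)) := by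
        rw [← integrableOn_iff_integrable_of_support_subset (s := Icc (1 : ℝ) 3)]
        · exact h1
        · intro t ht
          by_contra h
          apply ht
          simp [hρ0 t fun h' => h (Ioo_subset_Icc_self h')]
      exact h2.integrableOn
  have hfin : ∀ s : sphere (0 : V) 1, ∫ r in Ioi (0 : ℝ), r ^ (d - 1) *
      ((fderiv ℝ Y (r • (s : V))).det *
        tr (Ring.inverse (fderiv ℝ Y (r • (s : V))) * fderiv ℝ W (r • (s : V)))) =
      c * ((hatHess H s).det * (H s * f s *
      (tr (Ring.inverse (hatHess H s) * hess (fun y => Z y * H y) s)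
        - (Module.finrank ℝ V - 1) * Z s) +
      H s ^ 2 * inner ℝ (gradient f s) (Ring.inverse (hatHess H s) (gradient Z s)))) := by
    intro s
    have hs : ‖(s : V)‖ = 1 := by simp
    have hh : 0 < H s := hH.pos _ (ne_zero_of_norm_eq_one hs)
    set A := ((hatHess H s).det * (f s *
      (tr (Ring.inverse (hatHess H s) * hess (fun y => Z y * H y) s)
        - (Module.finrank ℝ V - 1) * Z s) +
        H s * inner ℝ (gradient f s) (Ring.inverse (hatHess H s) (gradient Z s)))) with hA
    have e1 : ∀ r ∈ Ioi (0 : ℝ), r ^ (d - 1) * ((fderiv ℝ Y (r • (s : V))).det *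
        tr (Ring.inverse (fderiv ℝ Y (r • (s : V))) * fderiv ℝ W (r • (s : V)))) =
        (H s ^ 2 * A) * ((r * H s) ^ (d - 1) * (((r * H s) ^ 2)⁻¹ * ρ (r * H s))) := by
      intro r hr
      have hr0 : (0 : ℝ) < r := hr
      rw [green_pointwise hf hZ hH hρ hs hr]
      have : d + 1 = (d - 1) + 2 := by
        have : 0 < d := Module.finrank_pos
        omega
      rw [← hd, this, ← hA, mul_pow, pow_add (H s)]
      field_simp
    rw [setIntegral_congr_fun measurableSet_Ioi e1, integral_const_mul,
      integral_comp_mul_right_Ioi (fun t : ℝ => t ^ (d - 1) * ((t ^ 2)⁻¹ * ρ t)) 0 hh]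
    rw [zero_mul, ← hc, hA, smul_eq_mul]
    field_simp
  rw [integral_congr_ae (.of_forall hfin), integral_const_mul] at hmain
  exact (mul_eq_zero.1 hmain).resolve_left hcpos.ne'

end Green

/-! ### The Poincaré inequality on the sphere -/

section Poincare

variable {V : Type*} [NormedAddCommGroup V] [InnerProductSpace ℝ V] [FiniteDimensional ℝ V]

/-- The simultaneous rotation `(a, b) ↦ (cos θ a + sin θ b, - sin θ a + cos θ b)`. -/
noncomputable def pairRot (V : Type*) [NormedAddCommGroup V] [InnerProductSpace ℝ V] (θ : ℝ) :
    (V × V) →ₗ[ℝ] (V × V) :=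
  (Real.cos θ • LinearMap.fst ℝ V V + Real.sin θ • LinearMap.snd ℝ V V).prod
    (-Real.sin θ • LinearMap.fst ℝ V V + Real.cos θ • LinearMap.snd ℝ V V)

lemma pairRot_apply (θ : ℝ) (p : V × V) : pairRot V θ p =
    (Real.cos θ • p.1 + Real.sin θ • p.2, -Real.sin θ • p.1 + Real.cos θ • p.2) := rfl

/-- The Euclidean unit ball of `V × V`. -/
def pairBall (V : Type*) [NormedAddCommGroup V] : Set (V × V) := {p | ‖p.1‖ ^ 2 + ‖p.2‖ ^ 2 < 1}

lemma isOpen_pairBall : IsOpen (pairBall V) :=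
  isOpen_lt (by fun_prop) continuous_const

lemma pairRot_mem_pairBall (θ : ℝ) (p : V × V) : pairRot V θ p ∈ pairBall V ↔ p ∈ pairBall V := by
  have : ‖(pairRot V θ p).1‖ ^ 2 + ‖(pairRot V θ p).2‖ ^ 2 = ‖p.1‖ ^ 2 + ‖p.2‖ ^ 2 := by
    simp only [pairRot_apply, norm_add_sq_real, norm_smul, inner_smul_left, inner_smul_right,
      mul_pow, Real.norm_eq_abs, sq_abs, abs_neg, RCLike.conj_to_real]
    linear_combination (‖p.1‖ ^ 2 + ‖p.2‖ ^ 2) * Real.sin_sq_add_cos_sq θ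
  simp only [pairBall, mem_ofPred_eq, this]

lemma det_pairRot_ne_zero (θ : ℝ) : LinearMap.det (pairRot V θ) ≠ 0 := by
  have : pairRot V (-θ) ∘ₗ pairRot V θ = LinearMap.id := by
    refine LinearMap.ext fun p => ?_
    have h := Real.sin_sq_add_cos_sq θ
    simp only [LinearMap.comp_apply, pairRot_apply, Real.cos_neg, Real.sin_neg, LinearMap.id_apply]
    ext1
    · simp only
      have e : Real.cos θ • (Real.cos θ • p.1 + Real.sin θ • p.2) +
          -Real.sin θ • (-Real.sin θ • p.1 + Real.cos θ • p.2) =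
          (Real.sin θ ^ 2 + Real.cos θ ^ 2) • p.1 := by module
      rw [e, h, one_smul]
    · simp only
      have e : - -Real.sin θ • (Real.cos θ • p.1 + Real.sin θ • p.2) +
          Real.cos θ • (-Real.sin θ • p.1 + Real.cos θ • p.2) =
          (Real.sin θ ^ 2 + Real.cos θ ^ 2) • p.2 := by module
      rw [e, h, one_smul]
  intro h
  have h2 := congrArg LinearMap.det this
  rw [LinearMap.det_comp, h, mul_zero, LinearMap.det_id] at h2
  exact zero_ne_one h2

variable [MeasurableSpace V] [BorelSpace V] [Nontrivial V] (μ : Measure V) [μ.IsAddHaarMeasure]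

lemma measure_pairBall_ne : (μ.prod μ) (pairBall V) ≠ 0 ∧ (μ.prod μ) (pairBall V) ≠ ⊤ := by
  constructor
  · exact isOpen_pairBall.measure_ne_zero _ ⟨0, by simp [pairBall]⟩
  · have hsub : pairBall V ⊆ closedBall (0 : V) 1 ×ˢ closedBall (0 : V) 1 := by
      intro p hp
      have hp' : ‖p.1‖ ^ 2 + ‖p.2‖ ^ 2 < 1 := hp
      simp only [mem_prod, mem_closedBall_zero_iff]
      constructor <;> nlinarith [norm_nonneg p.1, norm_nonneg p.2, sq_nonneg ‖p.1‖, sq_nonneg ‖p.2‖]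
    refine ((measure_mono hsub).trans_lt ?_).ne
    exact ((isCompact_closedBall _ _).prod (isCompact_closedBall _ _)).measure_lt_top

lemma measurePreserving_pairRot (θ : ℝ) :
    MeasurePreserving (pairRot V θ) (μ.prod μ) (μ.prod μ) := by
  have hm : Measurable (pairRot V θ) :=
    (LinearMap.continuous_of_finiteDimensional (pairRot V θ)).measurable
  refine ⟨hm, ?_⟩
  have h := Measure.map_linearMap_addHaar_eq_smul_addHaar (μ.prod μ) (det_pairRot_ne_zero (V := V) θ)
  -- The invariant ball pins down the scaling factor.
  have h1 : (Measure.map (pairRot V θ) (μ.prod μ)) (pairBall V) = (μ.prod μ) (pairBall V) := by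
    rw [Measure.map_apply hm isOpen_pairBall.measurableSet]
    congr 1
    ext p
    exact pairRot_mem_pairBall θ p
  obtain ⟨h0, htop⟩ := measure_pairBall_ne μ
  rw [h, Measure.smul_apply, smul_eq_mul] at h1
  have h2 : ENNReal.ofReal |(LinearMap.det (pairRot V θ))⁻¹| = 1 := by
    conv_rhs at h1 => rw [← one_mul ((μ.prod μ) (pairBall V))]
    exact (ENNReal.mul_left_inj h0 htop).1 h1
  rw [h, h2, one_smul]

/-- Almost every pair is linearly independent, so that the arcs joining its members avoid the
origin. -/
lemma ae_pairRot_fst_ne_zero (hd : 2 ≤ Module.finrank ℝ V) :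
    ∀ᵐ p ∂(μ.prod μ), ∀ θ : ℝ, (pairRot V θ p).1 ≠ 0 := by
  let N : Set (V × V) := {p | ‖p.1‖ ^ 2 * ‖p.2‖ ^ 2 = (inner ℝ p.1 p.2 : ℝ) ^ 2}
  have hN : MeasurableSet N :=
    (isClosed_eq (by fun_prop) (by fun_prop)).measurableSet
  have hN0 : (μ.prod μ) N = 0 := by
    rw [Measure.measure_prod_null hN]
    have h0 : ∀ᵐ a ∂μ, a ≠ 0 := by
      rw [ae_iff]; simp
    filter_upwards [h0] with a ha
    have hsub : Prod.mk a ⁻¹' N ⊆ (Submodule.span ℝ {a} : Submodule ℝ V) := by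
      intro b hb
      have hb' : ‖a‖ ^ 2 * ‖b‖ ^ 2 = (inner ℝ a b : ℝ) ^ 2 := hb
      have : ‖‖a‖ ^ 2 • b - (inner ℝ a b : ℝ) • a‖ ^ 2 = 0 := by
        rw [norm_sub_sq_real, norm_smul, norm_smul, inner_smul_left, inner_smul_right,
          real_inner_comm a b]
        simp only [mul_pow, Real.norm_eq_abs, sq_abs, abs_pow, abs_norm, RCLike.conj_to_real]
        linear_combination ‖a‖ ^ 2 * hb'
      have h2 : ‖a‖ ^ 2 • b = (inner ℝ a b : ℝ) • a :=
        sub_eq_zero.1 (norm_eq_zero.1 (pow_eq_zero_iff two_ne_zero |>.1 this))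
      rw [SetLike.mem_coe, Submodule.mem_span_singleton]
      refine ⟨(‖a‖ ^ 2)⁻¹ * inner ℝ a b, ?_⟩
      rw [mul_smul, ← h2, inv_smul_smul₀ (pow_ne_zero 2 (norm_ne_zero_iff.2 ha))]
    refine measure_mono_null hsub (Measure.addHaar_submodule μ _ fun h => ?_)
    have h1 := finrank_span_singleton (K := ℝ) ha
    rw [h, finrank_top] at h1
    omega
  have : ∀ᵐ p ∂(μ.prod μ), p ∉ N := measure_eq_zero_iff_ae_notMem.1 hN0
  filter_upwards [this] with p hp θ h
  apply hp
  have h1 : Real.cos θ • p.1 = -(Real.sin θ • p.2) := eq_neg_of_add_eq_zero_left h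
  have e1 : ‖Real.cos θ • p.1‖ ^ 2 = ‖Real.sin θ • p.2‖ ^ 2 := by rw [h1, norm_neg]
  have e2 : inner ℝ (Real.cos θ • p.1) p.2 = (inner ℝ (-(Real.sin θ • p.2)) p.2 : ℝ) := by rw [h1]
  have e3 : inner ℝ p.1 (Real.cos θ • p.1) = (inner ℝ p.1 (-(Real.sin θ • p.2)) : ℝ) := by rw [h1]
  simp only [norm_smul, mul_pow, Real.norm_eq_abs, sq_abs, inner_smul_left, inner_smul_right,
    inner_neg_left, inner_neg_right, real_inner_self_eq_norm_sq, RCLike.conj_to_real] at e1 e2 e3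
  have h3 := Real.sin_sq_add_cos_sq θ
  change ‖p.1‖ ^ 2 * ‖p.2‖ ^ 2 = (inner ℝ p.1 p.2 : ℝ) ^ 2
  have f1 : Real.cos θ ^ 2 * (‖p.1‖ ^ 2 * ‖p.2‖ ^ 2 - (inner ℝ p.1 p.2 : ℝ) ^ 2) = 0 := by
    linear_combination ‖p.2‖ ^ 2 * e1 - (Real.cos θ * inner ℝ p.1 p.2 - Real.sin θ * ‖p.2‖ ^ 2) * e2
  have f2 : Real.sin θ ^ 2 * (‖p.1‖ ^ 2 * ‖p.2‖ ^ 2 - (inner ℝ p.1 p.2 : ℝ) ^ 2) = 0 := by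
    linear_combination -‖p.1‖ ^ 2 * e1 + (Real.cos θ * ‖p.1‖ ^ 2 - Real.sin θ * inner ℝ p.1 p.2) * e3
  linear_combination f1 + f2 - (‖p.1‖ ^ 2 * ‖p.2‖ ^ 2 - (inner ℝ p.1 p.2 : ℝ) ^ 2) * h3

/-- The fundamental theorem of calculus along the arc from `a` to `b`, with Cauchy–Schwarz. -/
lemma sq_sub_le_arc {f : V → ℝ} (hf : C1Hom0 f) {p : V × V}
    (hp : ∀ θ : ℝ, (pairRot V θ p).1 ≠ 0) :
    ENNReal.ofReal ((f p.2 - f p.1) ^ 2) ≤ ENNReal.ofReal (Real.pi / 2) *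
      ∫⁻ θ in Ioc 0 (Real.pi / 2),
        ENNReal.ofReal ((fderiv ℝ f (pairRot V θ p).1 (pairRot V θ p).2) ^ 2) := by
  set g : ℝ → ℝ := fun θ => fderiv ℝ f (pairRot V θ p).1 (pairRot V θ p).2 with hg
  have hγ : ∀ θ, HasDerivAt (fun θ => (pairRot V θ p).1) (pairRot V θ p).2 θ := by
    intro θ
    simp only [pairRot_apply]
    exact ((Real.hasDerivAt_cos θ).smul_const p.1).add ((Real.hasDerivAt_sin θ).smul_const p.2)
  have hder : ∀ θ, HasDerivAt (fun θ => f (pairRot V θ p).1) (g θ) θ := fun θ =>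
    (differentiableAt_of_contDiffOn hf.contDiffOn one_ne_zero (hp θ)).hasFDerivAt.comp_hasDerivAt θ
      (hγ θ)
  have hgc : Continuous g := by
    have h1 : Continuous fun θ => (pairRot V θ p).1 := by simp only [pairRot_apply]; fun_prop
    have h2 : Continuous fun θ => (pairRot V θ p).2 := by simp only [pairRot_apply]; fun_prop
    have h3 := hf.contDiffOn.continuousOn_fderiv_of_isOpen isOpen_compl_singleton le_rfl
    exact (h3.comp_continuous h1 hp).clm_apply h2
  have hftc : ∫ θ in (0)..(Real.pi / 2), g θ = f p.2 - f p.1 := by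
    rw [intervalIntegral.integral_eq_sub_of_hasDerivAt (fun θ _ => hder θ)
      (hgc.intervalIntegrable _ _)]
    simp [pairRot_apply]
  have hL : 0 < Real.pi / 2 := by positivity
  have hcs : (∫ θ in (0)..(Real.pi / 2), g θ) ^ 2 ≤
      (Real.pi / 2) * ∫ θ in (0)..(Real.pi / 2), g θ ^ 2 := by
    set I := ∫ θ in (0)..(Real.pi / 2), g θ with hI
    have h0 : 0 ≤ ∫ θ in (0)..(Real.pi / 2), (g θ - I / (Real.pi / 2)) ^ 2 :=
      intervalIntegral.integral_nonneg hL.le fun θ _ => sq_nonneg _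
    have h1 : ∫ θ in (0)..(Real.pi / 2), (g θ - I / (Real.pi / 2)) ^ 2 =
        (∫ θ in (0)..(Real.pi / 2), g θ ^ 2) - 2 * (I / (Real.pi / 2)) * I +
          (I / (Real.pi / 2)) ^ 2 * (Real.pi / 2) := by
      have e : ∀ θ, (g θ - I / (Real.pi / 2)) ^ 2 =
          g θ ^ 2 - 2 * (I / (Real.pi / 2)) * g θ + (I / (Real.pi / 2)) ^ 2 := fun θ => by ring
      simp_rw [e]
      rw [intervalIntegral.integral_add, intervalIntegral.integral_sub,
        intervalIntegral.integral_const_mul, intervalIntegral.integral_const]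
      · simp [mul_comm, ← hI]
      all_goals exact Continuous.intervalIntegrable (by fun_prop) _ _
    rw [h1] at h0
    have h2 := mul_le_mul_of_nonneg_left h0 hL.le
    field_simp at h2 ⊢
    nlinarith
  have hint : IntegrableOn (fun θ => g θ ^ 2) (Ioc 0 (Real.pi / 2)) :=
    (Continuous.intervalIntegrable (by fun_prop) 0 (Real.pi / 2)).1
  rw [← hftc]
  refine (ENNReal.ofReal_le_ofReal hcs).trans ?_
  rw [ENNReal.ofReal_mul hL.le, intervalIntegral.integral_of_le hL.le,
    ofReal_integral_eq_lintegral_ofReal hint (.of_forall fun θ => sq_nonneg _)]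

lemma C1Hom0.measurable {f : V → ℝ} (hf : C1Hom0 f) : Measurable f :=
  measurable_of_continuousOn_compl_singleton 0 hf.contDiffOn.continuousOn

/-- The inequality along arcs, averaged over the pairs in the unit ball of `V × V`. The rotations
preserve the measure, so each point of the arc contributes the same amount. -/
lemma lintegral_pair_le (hd : 2 ≤ Module.finrank ℝ V) {f : V → ℝ} (hf : C1Hom0 f) :
    ∫⁻ p in pairBall V, ENNReal.ofReal ((f p.2 - f p.1) ^ 2) ∂(μ.prod μ) ≤
      ENNReal.ofReal (Real.pi / 2) ^ 2 *
        ∫⁻ p in pairBall V, ENNReal.ofReal ((fderiv ℝ f p.1 p.2) ^ 2) ∂(μ.prod μ) := by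
  have hmeas : Measurable fun p : V × V => ENNReal.ofReal ((fderiv ℝ f p.1 p.2) ^ 2) := by
    refine ENNReal.measurable_ofReal.comp (Measurable.pow_const ?_ 2)
    have h1 : Measurable (fun p : V × V => fderiv ℝ f p.1) := (measurable_fderiv ℝ f).comp measurable_fst
    exact (isBoundedBilinearMap_apply.continuous.measurable).comp (h1.prodMk measurable_snd)
  have hrot : Measurable fun q : (V × V) × ℝ => pairRot V q.2 q.1 := by
    simp only [pairRot_apply]; fun_prop
  calc ∫⁻ p in pairBall V, ENNReal.ofReal ((f p.2 - f p.1) ^ 2) ∂(μ.prod μ)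
      ≤ ∫⁻ p in pairBall V, ENNReal.ofReal (Real.pi / 2) * (∫⁻ θ in Ioc 0 (Real.pi / 2),
        ENNReal.ofReal ((fderiv ℝ f (pairRot V θ p).1 (pairRot V θ p).2) ^ 2)) ∂(μ.prod μ) := by
        refine lintegral_mono_ae (ae_restrict_of_ae ?_)
        filter_upwards [ae_pairRot_fst_ne_zero μ hd] with p hp using sq_sub_le_arc hf hp
    _ = ENNReal.ofReal (Real.pi / 2) * ∫⁻ θ in Ioc 0 (Real.pi / 2), (∫⁻ p in pairBall V,
        ENNReal.ofReal ((fderiv ℝ f (pairRot V θ p).1 (pairRot V θ p).2) ^ 2) ∂(μ.prod μ)) := by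
        rw [lintegral_const_mul' _ _ ENNReal.ofReal_ne_top, lintegral_lintegral_swap]
        exact (hmeas.comp hrot).aemeasurable
    _ = ENNReal.ofReal (Real.pi / 2) * ∫⁻ θ in Ioc 0 (Real.pi / 2), (∫⁻ p in pairBall V,
        ENNReal.ofReal ((fderiv ℝ f p.1 p.2) ^ 2) ∂(μ.prod μ)) := by
        congr 1
        refine lintegral_congr fun θ => ?_
        have := (measurePreserving_pairRot μ θ).setLIntegral_comp_preimage
          isOpen_pairBall.measurableSet hmeas
        rw [← this]
        congr 2
        ext p
        exact (pairRot_mem_pairBall θ p).symm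
    _ = _ := by
        rw [lintegral_const]
        simp [mul_comm, mul_assoc, sq]

lemma lintegral_pair_ge {f : V → ℝ} (hf : C1Hom0 f) :
    (∫⁻ r in Ioi (0 : ℝ), ENNReal.ofReal (r ^ (Module.finrank ℝ V - 1)) *
        (Iio (1 / 2 : ℝ)).indicator 1 r) ^ 2 *
      (∫⁻ s : sphere (0 : V) 1, (∫⁻ t : sphere (0 : V) 1, ENNReal.ofReal ((f t - f s) ^ 2)
        ∂μ.toSphere) ∂μ.toSphere) ≤
    ∫⁻ p in pairBall V, ENNReal.ofReal ((f p.2 - f p.1) ^ 2) ∂(μ.prod μ) := by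
  have hfm := hf.measurable
  set c := ∫⁻ r in Ioi (0 : ℝ), ENNReal.ofReal (r ^ (Module.finrank ℝ V - 1)) *
        (Iio (1 / 2 : ℝ)).indicator 1 r with hc
  have hpol : ∀ g : V → ENNReal, Measurable g → (∀ r : ℝ, 0 < r → ∀ x, g (r • x) = g x) →
      ∫⁻ a in ball (0 : V) (1 / 2), g a ∂μ = c * ∫⁻ s : sphere (0 : V) 1, g s ∂μ.toSphere := by
    intro g hg hg0
    rw [← lintegral_indicator measurableSet_ball, lintegral_polar μ (hg.indicator measurableSet_ball),
      ← lintegral_const_mul _ (show Measurable fun s : sphere (0 : V) 1 => g s from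
        hg.comp measurable_subtype_coe)]
    refine lintegral_congr fun s => ?_
    rw [hc, ← lintegral_mul_const _ (by
      refine Measurable.mul (by fun_prop) (measurable_one.indicator measurableSet_Iio))]
    refine setLIntegral_congr_fun measurableSet_Ioi fun r hr => ?_
    have hr0 : (0 : ℝ) < r := hr
    have hn : ‖r • (s : V)‖ = r := by simp [norm_smul, abs_of_pos hr0]
    simp only [indicator, mem_ball_zero_iff, hn, mem_Iio, hg0 r hr0]
    split_ifs <;> simp
  have hsub : ball (0 : V) (1 / 2) ×ˢ ball (0 : V) (1 / 2) ⊆ pairBall V := by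
    rintro ⟨a, b⟩ ⟨ha, hb⟩
    simp only [mem_ball_zero_iff] at ha hb
    simp only [pairBall, mem_ofPred_eq]
    nlinarith [norm_nonneg a, norm_nonneg b]
  refine le_trans (le_of_eq ?_) (lintegral_mono_set hsub)
  rw [← Measure.prod_restrict, lintegral_prod _ (by fun_prop)]
  have h1 : ∀ a, ∫⁻ b in ball (0 : V) (1 / 2), ENNReal.ofReal ((f b - f a) ^ 2) ∂μ =
      c * ∫⁻ t : sphere (0 : V) 1, ENNReal.ofReal ((f t - f a) ^ 2) ∂μ.toSphere := fun a =>
    hpol (fun b => ENNReal.ofReal ((f b - f a) ^ 2)) (by fun_prop)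
      fun r hr x => by simp only [hf.hom r hr]
  have hm2 : Measurable fun a =>
      ∫⁻ t : sphere (0 : V) 1, ENNReal.ofReal ((f t - f a) ^ 2) ∂μ.toSphere := by
    refine Measurable.lintegral_prod_right ?_
    fun_prop
  simp_rw [h1]
  rw [lintegral_const_mul _ hm2, hpol _ hm2 fun r hr x => by simp only [hf.hom r hr], sq, mul_assoc]

/-- In polar coordinates the squared gradient of the degree-zero function `f` grows like `r⁻²` at the
origin, which is compensated by the factor `r ^ (d - 1)` once the dimension `d` is at least `3`. -/
lemma lintegral_pair_fderiv_le (hd : 3 ≤ Module.finrank ℝ V) {f : V → ℝ} (hf : C1Hom0 f) :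
    ∫⁻ p in pairBall V, ENNReal.ofReal ((fderiv ℝ f p.1 p.2) ^ 2) ∂(μ.prod μ) ≤
      μ (ball 0 1) * ∫⁻ s : sphere (0 : V) 1, ENNReal.ofReal (‖gradient f s‖ ^ 2) ∂μ.toSphere := by
  have hgm : Measurable (gradient f) :=
    (toDual ℝ V).symm.continuous.measurable.comp (measurable_fderiv ℝ f)
  have hsub : pairBall V ⊆ ball (0 : V) 1 ×ˢ ball (0 : V) 1 := by
    intro p hp
    have hp' : ‖p.1‖ ^ 2 + ‖p.2‖ ^ 2 < 1 := hp
    simp only [mem_prod, mem_ball_zero_iff]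
    constructor <;> nlinarith [norm_nonneg p.1, norm_nonneg p.2, sq_nonneg ‖p.1‖, sq_nonneg ‖p.2‖]
  have hm1 : Measurable fun a : V => ENNReal.ofReal (‖gradient f a‖ ^ 2) := by fun_prop
  calc ∫⁻ p in pairBall V, ENNReal.ofReal ((fderiv ℝ f p.1 p.2) ^ 2) ∂(μ.prod μ)
      ≤ ∫⁻ p in ball (0 : V) 1 ×ˢ ball (0 : V) 1, ENNReal.ofReal (‖gradient f p.1‖ ^ 2)
          ∂(μ.prod μ) := by
        refine (setLIntegral_mono' isOpen_pairBall.measurableSet fun p hp => ?_).trans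
          (lintegral_mono_set hsub)
        have hp2 : ‖p.2‖ ≤ 1 := (mem_ball_zero_iff.1 (hsub hp).2).le
        refine ENNReal.ofReal_le_ofReal ?_
        rw [← inner_gradient, ← sq_abs]
        refine pow_le_pow_left₀ (abs_nonneg _) ((abs_real_inner_le_norm _ _).trans ?_) 2
        exact mul_le_of_le_one_right (norm_nonneg _) hp2
    _ = μ (ball 0 1) * ∫⁻ a in ball (0 : V) 1, ENNReal.ofReal (‖gradient f a‖ ^ 2) ∂μ := by
        rw [← Measure.prod_restrict, lintegral_prod _ (by fun_prop)]
        simp only [lintegral_const, Measure.restrict_apply MeasurableSet.univ, univ_inter]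
        rw [lintegral_mul_const _ hm1, mul_comm]
    _ ≤ _ := by
        gcongr
        rw [← lintegral_indicator measurableSet_ball,
          lintegral_polar μ (hm1.indicator measurableSet_ball)]
        refine lintegral_mono fun s => ?_
        have h1 : ∀ r ∈ Ioi (0 : ℝ), ENNReal.ofReal (r ^ (Module.finrank ℝ V - 1)) *
            (ball (0 : V) 1).indicator (fun a => ENNReal.ofReal (‖gradient f a‖ ^ 2)) (r • (s : V)) ≤
            (Ioc (0 : ℝ) 1).indicator (fun _ => ENNReal.ofReal (‖gradient f s‖ ^ 2)) r := by
          intro r hr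
          have hr0 : (0 : ℝ) < r := hr
          have hn : ‖r • (s : V)‖ = r := by simp [norm_smul, abs_of_pos hr0]
          by_cases hr1 : r < 1
          · have hmem : r • (s : V) ∈ ball (0 : V) 1 := by rwa [mem_ball_zero_iff, hn]
            rw [indicator_of_mem hmem, indicator_of_mem (show r ∈ Ioc (0 : ℝ) 1 from ⟨hr0, hr1.le⟩),
              ← ENNReal.ofReal_mul (by positivity)]
            refine ENNReal.ofReal_le_ofReal ?_
            rw [hf.hom.gradient_smul hr0, norm_smul, mul_pow, norm_inv, Real.norm_eq_abs,
              abs_of_pos hr0]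
            obtain ⟨k, hk⟩ : ∃ k, Module.finrank ℝ V - 1 = k + 2 := ⟨Module.finrank ℝ V - 3, by omega⟩
            rw [hk, pow_add]
            have : r ^ k * r ^ 2 * (r⁻¹ ^ 2 * ‖gradient f s‖ ^ 2) = r ^ k * ‖gradient f s‖ ^ 2 := by
              field_simp
            rw [this]
            exact mul_le_of_le_one_left (by positivity) (pow_le_one₀ hr0.le hr1.le)
          · have hmem : r • (s : V) ∉ ball (0 : V) 1 := by rwa [mem_ball_zero_iff, hn]
            rw [indicator_of_notMem hmem, mul_zero]
            exact zero_le
        refine (setLIntegral_mono' measurableSet_Ioi h1).trans ?_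
        refine (setLIntegral_le_lintegral _ _).trans ?_
        rw [lintegral_indicator measurableSet_Ioc]
        simp

/-- **Poincaré inequality** on the sphere, for the degree-zero extension of a `C¹` function. The
difference of the values at two points is integrated along the great circle through them. -/
theorem exists_poincare (hd : 3 ≤ Module.finrank ℝ V) :
    ∃ C : ℝ, 0 ≤ C ∧ ∀ f : V → ℝ, C1Hom0 f → ∃ m : ℝ,
      ∫ s : sphere (0 : V) 1, (f s - m) ^ 2 ∂μ.toSphere ≤
        C * ∫ s : sphere (0 : V) 1, ‖gradient f s‖ ^ 2 ∂μ.toSphere := by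
  set c := ∫⁻ r in Ioi (0 : ℝ), ENNReal.ofReal (r ^ (Module.finrank ℝ V - 1)) *
        (Iio (1 / 2 : ℝ)).indicator 1 r with hc
  have hcm : Measurable fun r : ℝ => ENNReal.ofReal (r ^ (Module.finrank ℝ V - 1)) *
        (Iio (1 / 2 : ℝ)).indicator (1 : ℝ → ENNReal) r :=
    Measurable.mul (by fun_prop) (measurable_one.indicator measurableSet_Iio)
  have hc0 : c ≠ 0 := by
    rw [hc, Ne, setLIntegral_eq_zero_iff measurableSet_Ioi hcm]
    intro h
    rw [ae_iff] at h
    have : Ioo (0 : ℝ) (1 / 2) ⊆ {a | ¬ (a ∈ Ioi (0 : ℝ) →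
        ENNReal.ofReal (a ^ (Module.finrank ℝ V - 1)) *
        (Iio (1 / 2 : ℝ)).indicator (1 : ℝ → ENNReal) a = 0)} := by
      intro r hr
      have : r < 1 / 2 := hr.2
      have h1 : 0 < r ^ (Module.finrank ℝ V - 1) := pow_pos hr.1 _
      simp only [mem_ofPred_eq, mem_Ioi, hr.1, forall_true_left, indicator,
        mem_Iio, this, if_true, Pi.one_apply, mul_one, ENNReal.ofReal_eq_zero, not_le, h1]
    have h2 := measure_mono_null this h
    rw [Real.volume_Ioo] at h2
    norm_num at h2
  have hct : c ≠ ⊤ := by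
    have h1 : c ≤ ∫⁻ r, (Ioc (0 : ℝ) 1).indicator 1 r := by
      rw [hc, ← lintegral_indicator measurableSet_Ioi]
      refine lintegral_mono fun r => ?_
      simp only [indicator, mem_Ioi, mem_Iio, mem_Ioc, Pi.one_apply]
      split_ifs with h1 h2 h3 h4 <;> try simp
      · exact pow_le_one₀ h1.le (by linarith)
      · exact absurd ⟨h1, by linarith⟩ h3
    rw [lintegral_indicator_one measurableSet_Ioc] at h1
    refine ne_top_of_le_ne_top ?_ h1
    simp
  have hσ : μ.toSphere ≠ 0 := by
    obtain ⟨x, hx⟩ := exists_ne (0 : V)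
    have : (μ.toSphere) univ ≠ 0 :=
      isOpen_univ.measure_ne_zero _ ⟨⟨‖x‖⁻¹ • x, by simp [norm_smul, hx]⟩, trivial⟩
    intro h
    simp [h] at this
  set K : ENNReal := (c ^ 2)⁻¹ * (ENNReal.ofReal (Real.pi / 2) ^ 2 * μ (ball 0 1)) *
    (μ.toSphere univ)⁻¹ with hK
  have hσ0 : μ.toSphere univ ≠ 0 := by rwa [Ne, Measure.measure_univ_eq_zero]
  have hKt : K ≠ ⊤ := by
    rw [hK]
    refine ENNReal.mul_ne_top (ENNReal.mul_ne_top ?_ (ENNReal.mul_ne_top ?_ ?_)) ?_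
    · exact ENNReal.inv_ne_top.2 (pow_ne_zero 2 hc0)
    · exact ENNReal.pow_ne_top ENNReal.ofReal_ne_top
    · exact measure_ball_lt_top.ne
    · exact ENNReal.inv_ne_top.2 hσ0
  refine ⟨K.toReal, ENNReal.toReal_nonneg, fun f hf => ?_⟩
  have hfm := hf.measurable
  have hm2 : Measurable fun a : sphere (0 : V) 1 =>
      ∫⁻ t : sphere (0 : V) 1, ENNReal.ofReal ((f t - f a) ^ 2) ∂μ.toSphere := by
    refine Measurable.lintegral_prod_right ?_
    fun_prop
  obtain ⟨s, hs⟩ := exists_le_laverage hσ hm2.aemeasurable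
  refine ⟨f s, ?_⟩
  have h1 := (lintegral_pair_ge μ hf).trans ((lintegral_pair_le μ (by omega) hf).trans
    (mul_le_mul_right (lintegral_pair_fderiv_le μ hd hf) _))
  rw [← hc] at h1
  have h2 : ∫⁻ t : sphere (0 : V) 1, ENNReal.ofReal ((f t - f s) ^ 2) ∂μ.toSphere ≤
      K * ∫⁻ s : sphere (0 : V) 1, ENNReal.ofReal (‖gradient f s‖ ^ 2) ∂μ.toSphere := by
    refine hs.trans ?_
    rw [laverage_eq, ENNReal.div_eq_inv_mul]
    have h3 := mul_le_mul_right h1 ((c ^ 2)⁻¹)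
    rw [← mul_assoc, ENNReal.inv_mul_cancel (pow_ne_zero 2 hc0) (ENNReal.pow_ne_top hct),
      one_mul] at h3
    refine (mul_le_mul_right h3 _).trans (le_of_eq ?_)
    rw [hK]
    ring
  have hfc : Continuous fun t : sphere (0 : V) 1 => f t :=
    hf.contDiffOn.continuousOn.comp_continuous continuous_subtype_val
      fun t => ne_zero_of_norm_eq_one (by simp)
  have hgc : Continuous fun t : sphere (0 : V) 1 => gradient f t :=
    (continuousOn_gradient hf.contDiffOn).comp_continuous continuous_subtype_val
      fun t => ne_zero_of_norm_eq_one (by simp)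
  have hi : Integrable (fun t : sphere (0 : V) 1 => ‖gradient f t‖ ^ 2) μ.toSphere :=
    (by fun_prop : Continuous fun t : sphere (0 : V) 1 => ‖gradient f t‖ ^ 2).integrable_of_hasCompactSupport
      (HasCompactSupport.of_compactSpace _)
  rw [integral_eq_lintegral_of_nonneg_ae (.of_forall fun t => sq_nonneg _)
    (show Continuous fun t : sphere (0 : V) 1 => (f t - f s) ^ 2 from
      (hfc.sub continuous_const).pow 2).aestronglyMeasurable,
    integral_eq_lintegral_of_nonneg_ae (.of_forall fun t => by positivity)
    hi.aestronglyMeasurable, ← ENNReal.toReal_mul]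
  exact ENNReal.toReal_mono (ENNReal.mul_ne_top hKt hi.lintegral_lt_top.ne) h2

end Poincare

/-! ### The Bochner identity -/

section Bochner

variable {V : Type*} [NormedAddCommGroup V] [InnerProductSpace ℝ V] [FiniteDimensional ℝ V]

lemma ne_zero_of_mem_sphere (s : sphere (0 : V) 1) : (s : V) ≠ 0 :=
  ne_zero_of_norm_eq_one (by simp)

lemma continuous_sphere_of_continuousOn {X : Type*} [TopologicalSpace X] {f : V → X}
    (hf : ContinuousOn f {0}ᶜ) : Continuous fun s : sphere (0 : V) 1 => f s :=
  hf.comp_continuous continuous_subtype_val ne_zero_of_mem_sphere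

lemma continuous_tr : Continuous (tr : (V →L[ℝ] V) → ℝ) :=
  (LinearMap.toContinuousLinearMap (⟨⟨tr, tr_add⟩, tr_smul⟩ : (V →L[ℝ] V) →ₗ[ℝ] ℝ)).continuous

lemma C2Hom1.continuous {H : V → ℝ} (hH : C2Hom1 H) : Continuous fun s : sphere (0 : V) 1 => H s :=
  continuous_sphere_of_continuousOn hH.contDiffOn.continuousOn

lemma C2Hom1.continuous_hess {H : V → ℝ} (hH : C2Hom1 H) :
    Continuous fun s : sphere (0 : V) 1 => hess H s :=
  continuous_sphere_of_continuousOn (continuousOn_hess hH.contDiffOn)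

lemma C2Hom1.continuous_gradient {H : V → ℝ} (hH : C2Hom1 H) :
    Continuous fun s : sphere (0 : V) 1 => gradient H s :=
  continuous_sphere_of_continuousOn (continuousOn_gradient (hH.contDiffOn.of_le (by norm_num)))

lemma C1Hom0.continuous {f : V → ℝ} (hf : C1Hom0 f) : Continuous fun s : sphere (0 : V) 1 => f s :=
  continuous_sphere_of_continuousOn hf.contDiffOn.continuousOn

lemma C1Hom0.continuous_gradient {f : V → ℝ} (hf : C1Hom0 f) :
    Continuous fun s : sphere (0 : V) 1 => gradient f s :=
  continuous_sphere_of_continuousOn (continuousOn_gradient hf.contDiffOn)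

lemma continuous_rankOne_self : Continuous fun x : V => rankOne ℝ x x := by
  have h : ∀ x : V, rankOne ℝ x x = (innerSL ℝ x).smulRight x := fun x => by
    ext v; simp
  simp_rw [h]
  exact ((ContinuousLinearMap.smulRightL ℝ V V).continuous₂).comp
    ((innerSL ℝ).continuous.prodMk continuous_id)

lemma C2Hom1.continuous_hatHess {H : V → ℝ} (hH : C2Hom1 H) :
    Continuous fun s : sphere (0 : V) 1 => hatHess H s :=
  hH.continuous_hess.add (continuous_rankOne_self.comp continuous_subtype_val)

lemma Nondeg.continuous_inverse {H : V → ℝ} (hH : Nondeg H) :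
    Continuous fun s : sphere (0 : V) 1 => Ring.inverse (hatHess H s) := by
  rw [continuous_iff_continuousAt]
  intro s
  obtain ⟨u, hu⟩ := hH.isUnit s (by simp)
  have : ContinuousAt Ring.inverse (hatHess H s) := by
    rw [← hu]; exact NormedRing.inverse_continuousAt u
  exact ContinuousAt.comp (f := fun s : sphere (0 : V) 1 => hatHess H s) this
    hH.continuous_hatHess.continuousAt

lemma Nondeg.continuous_tr {H U : V → ℝ} (hH : Nondeg H) (hU : C2Hom1 U) :
    Continuous fun s : sphere (0 : V) 1 => tr (Ring.inverse (hatHess H s) * hess U s) :=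
  LpMinkowski.continuous_tr.comp (hH.continuous_inverse.mul hU.continuous_hess)

lemma Nondeg.continuous_tr_sq {H U : V → ℝ} (hH : Nondeg H) (hU : C2Hom1 U) :
    Continuous fun s : sphere (0 : V) 1 => tr (Ring.inverse (hatHess H s) * hess U s *
      (Ring.inverse (hatHess H s) * hess U s)) :=
  LpMinkowski.continuous_tr.comp ((hH.continuous_inverse.mul hU.continuous_hess).mul
    (hH.continuous_inverse.mul hU.continuous_hess))

lemma C2Hom1.continuous_det {H : V → ℝ} (hH : C2Hom1 H) :
    Continuous fun s : sphere (0 : V) 1 => (hatHess H s).det :=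
  LpMinkowski.continuous_det.comp hH.continuous_hatHess

lemma hatHess_add_const_mul {H U : V → ℝ} (hH : C2Hom1 H) (hU : C2Hom1 U) (t : ℝ) {x : V}
    (hx : x ≠ 0) : hatHess (fun y => H y + t * U y) x = hatHess H x + t • hess U x := by
  simp only [hatHess]
  rw [hess_add hH.contDiffOn (hU.const_mul t).contDiffOn hx, hess_const_mul hU.contDiffOn t hx]
  abel

/-- Nondegeneracy is an open condition. -/
lemma Nondeg.eventually_add {H U : V → ℝ} (hH : Nondeg H) (hU : C2Hom1 U) :
    ∀ᶠ t : ℝ in 𝓝 0, Nondeg (fun y => H y + t * U y) := by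
  have h1 : ∀ᶠ t : ℝ in 𝓝 0, ∀ s ∈ (univ : Set (sphere (0 : V) 1)),
      0 < H s + t * U s ∧ (hatHess H s + t • hess U s).det ≠ 0 := by
    refine isCompact_univ.eventually_forall_of_forall_eventually fun s _ => ?_
    have c1 : Continuous fun q : ℝ × sphere (0 : V) 1 => H q.2 + q.1 * U q.2 :=
      (hH.continuous.comp continuous_snd).add
        (continuous_fst.mul (hU.continuous.comp continuous_snd))
    have c2 : Continuous fun q : ℝ × sphere (0 : V) 1 =>
        (hatHess H q.2 + q.1 • hess U q.2).det :=
      LpMinkowski.continuous_det.comp ((hH.continuous_hatHess.comp continuous_snd).add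
        (continuous_fst.smul (hU.continuous_hess.comp continuous_snd)))
    refine Filter.Eventually.and ?_ ?_
    · refine c1.continuousAt.eventually (lt_mem_nhds ?_)
      simpa using hH.pos s (ne_zero_of_mem_sphere s)
    · refine c2.continuousAt.eventually (isOpen_ne.mem_nhds ?_)
      simpa using (isUnit_iff_det_ne_zero _).1 (hH.isUnit s (by simp))
  filter_upwards [h1] with t ht
  have hC := hH.toC2Hom1.add (hU.const_mul t)
  refine ⟨hC, fun x hx => ?_, fun x hx => ?_⟩
  · have := (ht ⟨‖x‖⁻¹ • x, by simpa using norm_inv_norm_smul hx⟩ trivial).1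
    rw [hC.hom.eq_norm_mul hx]
    exact mul_pos (norm_pos_iff.2 hx) this
  · rw [isUnit_iff_det_ne_zero, hatHess_add_const_mul hH.toC2Hom1 hU t (ne_zero_of_norm_eq_one hx)]
    exact (ht ⟨x, by simpa using hx⟩ trivial).2

variable [MeasurableSpace V] [BorelSpace V] [Nontrivial V] (μ : Measure V) [μ.IsAddHaarMeasure]

lemma integrable_sphere {f : sphere (0 : V) 1 → ℝ} (hf : Continuous f) :
    Integrable f μ.toSphere :=
  hf.integrable_of_hasCompactSupport (HasCompactSupport.of_compactSpace _)

lemma gradient_const_fun (c : ℝ) (x : V) : gradient (fun _ : V => c) x = 0 := by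
  simp [gradient]

open Polynomial in
/-- The integrated **Bochner formula**. Green's formula with `f = 1` for the perturbed function
`H + t U` and `Z = U / (H + t U)` reads `∫ (H + t U) D' - (n - 1) U D = 0` with
`D (t) = det (D² H + t D² U)`; the formula is its linear term in `t`. -/
theorem bochner {H U : V → ℝ} (hH : Nondeg H) (hU : C2Hom1 U) :
    ∫ s : sphere (0 : V) 1, (hatHess H s).det * (H s *
      (tr (Ring.inverse (hatHess H s) * hess U s) ^ 2 -
        tr (Ring.inverse (hatHess H s) * hess U s * (Ring.inverse (hatHess H s) * hess U s))) -
      (Module.finrank ℝ V - 2) * (U s * tr (Ring.inverse (hatHess H s) * hess U s)))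
      ∂μ.toSphere = 0 := by
  set d : ℝ := (Module.finrank ℝ V : ℝ) with hd
  let D : sphere (0 : V) 1 → ℝ[X] := fun s => detPoly (hatHess H s) (hess U s)
  let P : sphere (0 : V) 1 → ℝ[X] := fun s =>
    (C (H s) + C (U s) * X) * derivative (D s) - C ((d - 1) * U s) * D s
  have hev := hH.eventually_add hU
  have hu : ∀ t : ℝ, Nondeg (fun y => H y + t * U y) → ∀ s : sphere (0 : V) 1,
      (P s).eval t = (hatHess (fun y => H y + t * U y) s).det *
        ((H s + t * U s) * tr (Ring.inverse (hatHess (fun y => H y + t * U y) s) * hess U s) -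
          (d - 1) * U s) := by
    intro t ht s
    have hs := hatHess_add_const_mul hH.toC2Hom1 hU t (ne_zero_of_mem_sphere s)
    have hun := ht.isUnit s (by simp)
    rw [hs] at hun ⊢
    simp only [P, D, eval_sub, eval_mul, eval_add, eval_C, eval_X, eval_derivative_detPoly hun,
      eval_detPoly]
    ring
  have key := integral_coeff_eq_zero (μ := μ.toSphere) (P := P) (d := Module.finrank ℝ V + 1)
    (T := {t | Nondeg (fun y => H y + t * U y)}) ?_ (infinite_of_mem_nhds 0 hev) ?_ ?_ 1
  · rw [← key]
    refine integral_congr_ae (.of_forall fun s => ?_)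
    have h1 := coeff_one_detPoly (B := hess U s) (hH.isUnit s (by simp))
    have h2 := two_mul_coeff_two_detPoly (B := hess U s) (hH.isUnit s (by simp))
    have h3 : (P s).coeff 1 = H s * (2 * (D s).coeff 2) + U s * (D s).coeff 1 -
        (d - 1) * U s * (D s).coeff 1 := by
      simp only [P, add_mul, coeff_sub, coeff_add, coeff_C_mul, mul_assoc, coeff_derivative,
        coeff_X_mul]
      norm_num
      left
      ring
    simp only [h3, D, h1, h2]
    ring
  · intro s
    have h1 : (D s).natDegree ≤ Module.finrank ℝ V := natDegree_detPoly_le _ _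
    refine (natDegree_sub_le _ _).trans (max_le ?_ ?_)
    · refine natDegree_mul_le.trans ?_
      have h2 : (C (H s) + C (U s) * X : ℝ[X]).natDegree ≤ 1 := by compute_degree
      have h3 := natDegree_derivative_le (D s)
      omega
    · exact (natDegree_C_mul_le _ _).trans (h1.trans (Nat.le_succ _))
  · intro t ht
    simp_rw [hu t ht]
    refine integrable_sphere μ ?_
    refine ht.toC2Hom1.continuous_det.mul ((ht.toC2Hom1.continuous.mul (ht.continuous_tr hU)).sub
      (continuous_const.mul hU.continuous))
  · intro t ht
    have ht' : Nondeg (fun y => H y + t * U y) := ht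
    have hne : ∀ x ≠ 0, H x + t * U x ≠ 0 := fun x hx => (ht'.pos x hx).ne'
    have hone : C1Hom0 (fun _ : V => (1 : ℝ)) := ⟨contDiffOn_const, fun _ _ _ => rfl⟩
    have hg := green μ hone (hU.div ht'.toC2Hom1 hne) ht'
    rw [← hg]
    refine integral_congr_ae (.of_forall fun s => ?_)
    have hfun : (fun y => U y / (H y + t * U y) * (H y + t * U y)) = U := by
      funext y
      by_cases hy : y = 0
      · simp [hy, hU.hom.map_zero]
      · exact div_mul_cancel₀ _ (hne y hy)
    simp only [hu t ht', hfun, gradient_const_fun, inner_zero_left]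
    have := hne s (ne_zero_of_mem_sphere s)
    field_simp
    ring

end Bochner

/-! ### Integral inequalities for the Hilbert–Brunn–Minkowski operator -/

section Inequalities

variable {V : Type*} [NormedAddCommGroup V] [InnerProductSpace ℝ V] [FiniteDimensional ℝ V]

/-- The analytic content of a support function of class `𝒦₊²`: a positive 1-homogeneous `C²`
function whose Hessian is positive definite on the tangent spaces of the sphere. -/
structure StrictlyConvex (H : V → ℝ) : Prop extends C2Hom1 H where
  pos : ∀ x ≠ 0, 0 < H x
  hess_pos : ∀ x, ‖x‖ = 1 → ∀ v ≠ 0, inner ℝ x v = (0 : ℝ) → 0 < inner ℝ (hess H x v) v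

namespace StrictlyConvex

variable {H : V → ℝ} (hH : StrictlyConvex H)
include hH

lemma inner_hatHess_pos {x : V} (hx : ‖x‖ = 1) {v : V} (hv : v ≠ 0) :
    0 < inner ℝ (hatHess H x v) v := by
  have hx0 := ne_zero_of_norm_eq_one hx
  have hxx : inner ℝ x x = (1 : ℝ) := by simp [hx]
  have h1 : inner ℝ (hatHess H x v) v = inner ℝ (hess H x (v - (inner ℝ x v : ℝ) • x))
      (v - (inner ℝ x v : ℝ) • x) + (inner ℝ x v : ℝ) ^ 2 := by
    have h2 : inner ℝ (hess H x v) x = (0 : ℝ) := by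
      rw [inner_hess_symm hH.contDiffOn hx0, hH.hess_self hx0, inner_zero_right]
    simp only [hatHess, add_apply, rankOne_apply, map_sub, map_smul, hH.hess_self hx0, smul_zero,
      sub_zero, inner_sub_right, inner_smul_right, h2, inner_add_left, inner_smul_left,
      RCLike.conj_to_real]
    ring
  rw [h1]
  by_cases h : v - (inner ℝ x v : ℝ) • x = 0
  · have h2 : (inner ℝ x v : ℝ) ≠ 0 := by
      intro h3
      rw [h3, zero_smul, sub_zero] at h
      exact hv h
    rw [h]
    simp only [inner_zero_right, zero_add]
    positivity
  · have := hH.hess_pos x hx _ h (by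
      simp only [inner_sub_right, inner_smul_right, hxx]; ring)
    positivity

lemma hatHess_symm {x : V} (hx : ‖x‖ = 1) (v w : V) :
    inner ℝ (hatHess H x v) w = (inner ℝ v (hatHess H x w) : ℝ) := by
  simp only [hatHess, add_apply, rankOne_apply, inner_add_left, inner_add_right, inner_smul_left,
    inner_smul_right, inner_hess_symm hH.contDiffOn (ne_zero_of_norm_eq_one hx),
    RCLike.conj_to_real, real_inner_comm x v]
  ring

lemma isUnit_hatHess {x : V} (hx : ‖x‖ = 1) : IsUnit (hatHess H x) := by
  rw [isUnit_iff_det_ne_zero]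
  intro h
  obtain ⟨v, hv, hv0⟩ := (LinearMap.bot_lt_ker_of_det_eq_zero h).ne' |> Submodule.exists_mem_ne_zero_of_ne_bot
  have h1 := hH.inner_hatHess_pos hx hv0
  have h2 : hatHess H x v = 0 := hv
  simp [h2] at h1

lemma nondeg : Nondeg H := ⟨hH.toC2Hom1, hH.pos, fun _ hx => hH.isUnit_hatHess hx⟩

lemma det_pos {x : V} (hx : ‖x‖ = 1) : 0 < (hatHess H x).det := by
  have hs : (hatHess H x).toLinearMap.IsSymmetric := hH.hatHess_symm hx
  rw [ContinuousLinearMap.det, hs.det_eq_prod_eigenvalues rfl]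
  refine Finset.prod_pos fun i _ => ?_
  have h1 := hH.inner_hatHess_pos hx
    (v := hs.eigenvectorBasis rfl i) (by
      intro h; simpa [h] using (hs.eigenvectorBasis rfl).orthonormal.1 i)
  have h2 : hatHess H x (hs.eigenvectorBasis rfl i) =
    (hs.eigenvalues rfl i) • (hs.eigenvectorBasis rfl i) := hs.apply_eigenvectorBasis rfl i
  rw [h2, inner_smul_left] at h1
  simpa using h1

lemma inner_inverse_pos {x : V} (hx : ‖x‖ = 1) {v : V} (hv : v ≠ 0) :
    0 < inner ℝ v (Ring.inverse (hatHess H x) v) := by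
  have h1 : hatHess H x (Ring.inverse (hatHess H x) v) = v :=
    congrArg (fun f : V →L[ℝ] V => f v) (Ring.mul_inverse_cancel _ (hH.isUnit_hatHess hx))
  have := hH.inner_hatHess_pos hx (v := Ring.inverse (hatHess H x) v) fun h => hv (by simpa [h] using h1.symm)
  rwa [h1] at this

lemma inner_inverse_nonneg {x : V} (hx : ‖x‖ = 1) (v : V) :
    0 ≤ inner ℝ v (Ring.inverse (hatHess H x) v) := by
  by_cases h : v = 0
  · simp [h]
  · exact (hH.inner_inverse_pos hx h).le

/-- The Cauchy–Schwarz inequality for the eigenvalues of `R D²U`, where `R` is inverse to the Hessian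
of `H` on the tangent space. -/
lemma sq_tr_le {U : V → ℝ} (hU : C2Hom1 U) {x : V} (hx : ‖x‖ = 1) (hd : 2 ≤ Module.finrank ℝ V) :
    tr (Ring.inverse (hatHess H x) * hess U x) ^ 2 ≤ (Module.finrank ℝ V - 1) *
      tr (Ring.inverse (hatHess H x) * hess U x * (Ring.inverse (hatHess H x) * hess U x)) := by
  have hx0 := ne_zero_of_norm_eq_one hx
  have hA := hH.nondeg.hessAt hx
  set d : ℝ := (Module.finrank ℝ V : ℝ) with hd'
  have hd1 : 0 < d - 1 := by
    have : (2 : ℝ) ≤ (Module.finrank ℝ V : ℝ) := by exact_mod_cast hd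
    linarith
  set R := Ring.inverse (hatHess H x) with hR
  set τ := tr (R * hess U x) with hτ
  set a := τ / (d - 1) with ha
  have hsymm : ∀ v w, inner ℝ ((hess U x - a • hess H x) v) w =
      (inner ℝ v ((hess U x - a • hess H x) w) : ℝ) := by
    intro v w
    simp [inner_sub_left, inner_sub_right, inner_smul_left, inner_smul_right,
      inner_hess_symm hU.contDiffOn hx0, inner_hess_symm hH.contDiffOn hx0]
  have h1 := sum_norm_sq_le_tr (stdOrthonormalBasis ℝ V) (hH.hatHess_symm hx)
    (fun v hv => hH.inner_hatHess_pos hx hv) hsymm le_rfl (hH.isUnit_hatHess hx)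
  have hpos : 0 < ‖hatHess H x‖ := by
    rw [norm_pos_iff]
    intro h
    have := hH.inner_hatHess_pos hx hx0
    simp [h] at this
  have h2 := nonneg_of_mul_nonneg_right
    ((Finset.sum_nonneg fun i _ => sq_nonneg _).trans h1) (by positivity)
  have hM : R * (hess U x - a • hess H x) = R * hess U x - a • (1 - rankOne ℝ x x) := by
    have : R * hess H x = 1 - rankOne ℝ x x := hA.inverse_mul
    rw [mul_sub, mul_smul_comm, this]
  have hMx : (R * hess U x) x = 0 := by rw [clm_mul_apply, hU.hess_self hx0, map_zero]
  have hxM : tr (rankOne ℝ x x * (R * hess U x)) = 0 := by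
    rw [tr_mul_comm, mul_rankOne, hMx, tr_rankOne, inner_zero_right]
  have hxx : tr (rankOne ℝ x x * rankOne ℝ x x : V →L[ℝ] V) = 1 := by
    rw [mul_rankOne, tr_rankOne]; simp [hx]
  have hx1 : tr (rankOne ℝ x x : V →L[ℝ] V) = 1 := by rw [tr_rankOne]; simp [hx]
  rw [← hR, hM] at h2
  have h3 : tr ((R * hess U x - a • (1 - rankOne ℝ x x)) *
      (R * hess U x - a • (1 - rankOne ℝ x x))) =
      tr (R * hess U x * (R * hess U x)) - 2 * a * τ + a ^ 2 * (d - 1) := by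
    simp only [sub_mul, mul_sub, tr_sub, smul_mul_assoc, mul_smul_comm, tr_smul, one_mul, mul_one,
      hxM, tr_mul_comm _ (rankOne ℝ x x), hxx, hx1, tr_one]
    ring
  rw [h3, ha] at h2
  have h4 := mul_nonneg hd1.le h2
  field_simp at h4
  nlinarith [h4]

end StrictlyConvex

/-- The operator `-L` on `0`-homogeneous extensions, for `H` the support function. -/
noncomputable def negL (H Z : V → ℝ) (s : V) : ℝ :=
  Z s - tr (Ring.inverse (hatHess H s) * hess (fun y => Z y * H y) s) / (Module.finrank ℝ V - 1)

/-- The density of the cone-volume measure, up to the factor `1 / n`. -/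
noncomputable def coneDensity (H : V → ℝ) (s : V) : ℝ := H s * (hatHess H s).det

/-- The density of the Dirichlet form of `-L` with respect to the cone-volume measure. -/
noncomputable def dirichletForm (H f g : V → ℝ) (s : V) : ℝ :=
  H s / (Module.finrank ℝ V - 1) *
    inner ℝ (gradient f s) (Ring.inverse (hatHess H s) (gradient g s))

namespace StrictlyConvex

variable {H : V → ℝ} (hH : StrictlyConvex H)
include hH

lemma coneDensity_pos {x : V} (hx : ‖x‖ = 1) : 0 < coneDensity H x :=
  mul_pos (hH.pos x (ne_zero_of_norm_eq_one hx)) (hH.det_pos hx)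

lemma continuous_coneDensity : Continuous fun s : sphere (0 : V) 1 => coneDensity H s :=
  hH.continuous.mul hH.continuous_det

lemma continuous_negL {Z : V → ℝ} (hZ : C2Hom0 Z) :
    Continuous fun s : sphere (0 : V) 1 => negL H Z s :=
  hZ.c1.continuous.sub ((hH.nondeg.continuous_tr (hZ.mul hH.toC2Hom1)).div_const _)

lemma continuous_dirichletForm {f g : V → ℝ} (hf : C1Hom0 f) (hg : C1Hom0 g) :
    Continuous fun s : sphere (0 : V) 1 => dirichletForm H f g s :=
  (hH.continuous.div_const _).mul (hf.continuous_gradient.inner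
    (hH.nondeg.continuous_inverse.clm_apply hg.continuous_gradient))

lemma dirichletForm_symm (f g : V → ℝ) {x : V} (hx : ‖x‖ = 1) :
    dirichletForm H f g x = dirichletForm H g f x := by
  simp only [dirichletForm]
  have := (hH.nondeg.hessAt hx).inverse_symm (gradient g x) (gradient f x)
  change inner ℝ (Ring.inverse (hatHess H x) _) _ = inner ℝ _ (Ring.inverse (hatHess H x) _) at this
  rw [← this, real_inner_comm]

variable [MeasurableSpace V] [BorelSpace V] [Nontrivial V] (μ : Measure V) [μ.IsAddHaarMeasure]

/-- Green's formula for the cone-volume measure. -/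
theorem integral_mul_negL (hd : 2 ≤ Module.finrank ℝ V) {f Z : V → ℝ} (hf : C1Hom0 f)
    (hZ : C2Hom0 Z) :
    ∫ s : sphere (0 : V) 1, coneDensity H s * (f s * negL H Z s) ∂μ.toSphere =
      ∫ s : sphere (0 : V) 1, coneDensity H s * dirichletForm H f Z s ∂μ.toSphere := by
  have hd1 : (Module.finrank ℝ V : ℝ) - 1 ≠ 0 := by
    have : (2 : ℝ) ≤ (Module.finrank ℝ V : ℝ) := by exact_mod_cast hd
    linarith
  rw [← sub_eq_zero, ← integral_sub]
  · have h := congrArg (fun t : ℝ => -(((Module.finrank ℝ V : ℝ) - 1)⁻¹ * t)) (green μ hf hZ hH.nondeg)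
    simp only [mul_zero, neg_zero, ← integral_const_mul, ← integral_neg] at h
    rw [← h]
    refine integral_congr_ae (.of_forall fun s => ?_)
    simp only [coneDensity, negL, dirichletForm]
    field_simp
    ring
  · exact integrable_sphere μ (hH.continuous_coneDensity.mul (hf.continuous.mul (hH.continuous_negL hZ)))
  · exact integrable_sphere μ (hH.continuous_coneDensity.mul (hH.continuous_dirichletForm hf hZ.c1))

/-- The Dirichlet principle: `2 ⟨f, -L Z⟩ - ⟨Z, -L Z⟩ ≤ 𝓔 (f)`. -/
lemma two_mul_integral_sub_le (hd : 2 ≤ Module.finrank ℝ V) {f Z : V → ℝ} (hf : C1Hom0 f)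
    (hZ : C2Hom0 Z) :
    2 * ∫ s : sphere (0 : V) 1, coneDensity H s * (f s * negL H Z s) ∂μ.toSphere -
      ∫ s : sphere (0 : V) 1, coneDensity H s * (Z s * negL H Z s) ∂μ.toSphere ≤
      ∫ s : sphere (0 : V) 1, coneDensity H s * dirichletForm H f f s ∂μ.toSphere := by
  have hi : ∀ {f g : V → ℝ}, C1Hom0 f → C1Hom0 g → Integrable (fun s : sphere (0 : V) 1 =>
      coneDensity H s * dirichletForm H f g s) μ.toSphere := fun hf hg =>
    integrable_sphere μ (hH.continuous_coneDensity.mul (hH.continuous_dirichletForm hf hg))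
  rw [hH.integral_mul_negL μ hd hf hZ, hH.integral_mul_negL μ hd hZ.c1 hZ, ← integral_const_mul,
    ← integral_sub ((hi hf hZ.c1).const_mul 2) (hi hZ.c1 hZ.c1)]
  refine integral_mono (((hi hf hZ.c1).const_mul 2).sub (hi hZ.c1 hZ.c1)) (hi hf hf) fun s => ?_
  have hs : ‖(s : V)‖ = 1 := by simp
  have h1 := hH.inner_inverse_nonneg hs (gradient f s - gradient Z s)
  have h2 := hH.dirichletForm_symm f Z hs
  have hd1 : 0 < (Module.finrank ℝ V : ℝ) - 1 := by
    have : (2 : ℝ) ≤ (Module.finrank ℝ V : ℝ) := by exact_mod_cast hd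
    linarith
  have h3 : 0 ≤ H s / (Module.finrank ℝ V - 1) := div_nonneg (hH.pos _ (ne_zero_of_norm_eq_one hs)).le hd1.le
  have h4 := mul_nonneg (hH.coneDensity_pos hs).le (mul_nonneg h3 h1)
  simp only [map_sub, inner_sub_left, inner_sub_right] at h4
  simp only [dirichletForm] at h2 ⊢
  linear_combination h4 + coneDensity H s * h2

lemma tr_eq_negL (hd : 2 ≤ Module.finrank ℝ V) (Z : V → ℝ) (x : V) :
    tr (Ring.inverse (hatHess H x) * hess (fun y => Z y * H y) x) =
      (Module.finrank ℝ V - 1) * (Z x - negL H Z x) := by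
  have hd2 : (2 : ℝ) ≤ (Module.finrank ℝ V : ℝ) := by exact_mod_cast hd
  have : (Module.finrank ℝ V : ℝ) - 1 ≠ 0 := by linarith
  simp only [negL]
  field_simp
  ring

/-- The Bochner formula in terms of the operator. -/
theorem integral_tr_sq (hd : 2 ≤ Module.finrank ℝ V) {Z : V → ℝ} (hZ : C2Hom0 Z) :
    ∫ s : sphere (0 : V) 1, coneDensity H s *
      tr (Ring.inverse (hatHess H s) * hess (fun y => Z y * H y) s *
        (Ring.inverse (hatHess H s) * hess (fun y => Z y * H y) s)) ∂μ.toSphere =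
    (Module.finrank ℝ V - 1) * ∫ s : sphere (0 : V) 1, coneDensity H s *
      ((Z s - negL H Z s) * (Z s - (Module.finrank ℝ V - 1) * negL H Z s)) ∂μ.toSphere := by
  have hU := hZ.mul hH.toC2Hom1
  have c1 : Integrable (fun s : sphere (0 : V) 1 => coneDensity H s *
      tr (Ring.inverse (hatHess H s) * hess (fun y => Z y * H y) s *
        (Ring.inverse (hatHess H s) * hess (fun y => Z y * H y) s))) μ.toSphere :=
    integrable_sphere μ (hH.continuous_coneDensity.mul (hH.nondeg.continuous_tr_sq hU))
  have c2 : Integrable (fun s : sphere (0 : V) 1 => coneDensity H s *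
      ((Z s - negL H Z s) * (Z s - (Module.finrank ℝ V - 1) * negL H Z s))) μ.toSphere := by
    have h1 := hH.continuous_negL hZ
    have h2 := hZ.c1.continuous
    exact integrable_sphere μ (hH.continuous_coneDensity.mul ((h2.sub h1).mul
      (h2.sub (continuous_const.mul h1))))
  rw [← integral_const_mul, ← sub_eq_zero, ← integral_sub c1 (c2.const_mul _), ← neg_eq_zero,
    ← integral_neg, ← bochner μ hH.nondeg hU]
  refine integral_congr_ae (.of_forall fun s => ?_)
  have h3 := hH.tr_eq_negL hd Z s
  simp only [coneDensity]
  rw [h3]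
  ring

/-- `⟨Z, -L Z⟩ ≤ ‖L Z‖²`, the form of the Brunn–Minkowski inequality that Bochner's formula
yields. -/
theorem integral_mul_negL_le (hd : 3 ≤ Module.finrank ℝ V) {Z : V → ℝ} (hZ : C2Hom0 Z) :
    ∫ s : sphere (0 : V) 1, coneDensity H s * (Z s * negL H Z s) ∂μ.toSphere ≤
      ∫ s : sphere (0 : V) 1, coneDensity H s * negL H Z s ^ 2 ∂μ.toSphere := by
  have hd3 : (3 : ℝ) ≤ (Module.finrank ℝ V : ℝ) := by exact_mod_cast hd
  have hU := hZ.mul hH.toC2Hom1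
  have hw := hH.continuous_negL hZ
  have hz := hZ.c1.continuous
  have c1 : Integrable (fun s : sphere (0 : V) 1 => coneDensity H s * negL H Z s ^ 2)
    μ.toSphere := integrable_sphere μ (hH.continuous_coneDensity.mul (hw.pow 2))
  have c2 : Integrable (fun s : sphere (0 : V) 1 => coneDensity H s * (Z s * negL H Z s))
    μ.toSphere := integrable_sphere μ (hH.continuous_coneDensity.mul (hz.mul hw))
  have c3 : Integrable (fun s : sphere (0 : V) 1 => coneDensity H s *
      ((Z s - negL H Z s) * (Z s - (Module.finrank ℝ V - 1) * negL H Z s))) μ.toSphere :=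
    integrable_sphere μ (hH.continuous_coneDensity.mul ((hz.sub hw).mul
      (hz.sub (continuous_const.mul hw))))
  have c4 : Integrable (fun s : sphere (0 : V) 1 => coneDensity H s * (Z s - negL H Z s) ^ 2)
    μ.toSphere := integrable_sphere μ (hH.continuous_coneDensity.mul ((hz.sub hw).pow 2))
  have c5 := integrable_sphere μ (hH.continuous_coneDensity.mul (hH.nondeg.continuous_tr_sq hU))
  have h1 : (Module.finrank ℝ V - 1 : ℝ) *
      ∫ s : sphere (0 : V) 1, coneDensity H s * (Z s - negL H Z s) ^ 2 ∂μ.toSphere ≤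
      (Module.finrank ℝ V - 1) * ∫ s : sphere (0 : V) 1, coneDensity H s *
        ((Z s - negL H Z s) * (Z s - (Module.finrank ℝ V - 1) * negL H Z s)) ∂μ.toSphere := by
    rw [← hH.integral_tr_sq μ (by omega) hZ, ← integral_const_mul]
    refine integral_mono (c4.const_mul _) c5 fun s => ?_
    have hs : ‖(s : V)‖ = 1 := by simp
    have h2 := hH.sq_tr_le hU hs (by omega)
    rw [hH.tr_eq_negL (by omega) Z s, mul_pow, pow_two (_ - (1 : ℝ)), mul_assoc] at h2
    have h3 := mul_le_mul_of_nonneg_left (le_of_mul_le_mul_left h2 (by linarith))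
      (hH.coneDensity_pos hs).le
    simp only
    linarith
  have h2 := le_of_mul_le_mul_left h1 (by linarith)
  rw [← sub_nonneg, ← integral_sub c3 c4] at h2
  rw [← sub_nonneg, ← integral_sub c1 c2]
  refine nonneg_of_mul_nonneg_right (h2.trans_eq ?_)
    (show 0 < (Module.finrank ℝ V - 2 : ℝ) by linarith)
  rw [← integral_const_mul]
  refine integral_congr_ae (.of_forall fun s => ?_)
  ring

omit [MeasurableSpace V] [BorelSpace V] in
/-- On the compact sphere the energy density is comparable with the round one. -/
lemma exists_norm_sq_le_dirichletForm (hd : 2 ≤ Module.finrank ℝ V) :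
    ∃ C : ℝ, 0 ≤ C ∧ ∀ (f : V → ℝ) (s : sphere (0 : V) 1),
      ‖gradient f s‖ ^ 2 ≤ C * (coneDensity H s * dirichletForm H f f s) := by
  have hd2 : (2 : ℝ) ≤ (Module.finrank ℝ V : ℝ) := by exact_mod_cast hd
  let q : sphere (0 : V) 1 × sphere (0 : V) 1 → ℝ := fun p =>
    coneDensity H p.1 * (H p.1 / (Module.finrank ℝ V - 1) *
      inner ℝ (p.2 : V) (Ring.inverse (hatHess H p.1) p.2))
  have hq : Continuous q := (hH.continuous_coneDensity.comp continuous_fst).mul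
    (((hH.continuous.div_const _).comp continuous_fst).mul
      ((continuous_subtype_val.comp continuous_snd).inner
        ((hH.nondeg.continuous_inverse.comp continuous_fst).clm_apply
          (continuous_subtype_val.comp continuous_snd))))
  have hq0 : ∀ p, 0 < q p := fun p => by
    have h1 : ‖(p.1 : V)‖ = 1 := by simp
    have h2 := hH.pos _ (ne_zero_of_mem_sphere p.1)
    have h3 := hH.inner_inverse_pos h1 (ne_zero_of_mem_sphere p.2)
    have h4 := hH.coneDensity_pos h1
    have h5 : 0 < (Module.finrank ℝ V : ℝ) - 1 := by linarith
    positivity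
  have : Nonempty (sphere (0 : V) 1) := by
    obtain ⟨x, hx⟩ := exists_ne (0 : V)
    exact ⟨⟨‖x‖⁻¹ • x, by simpa using norm_inv_norm_smul hx⟩⟩
  obtain ⟨p₀, -, hp₀⟩ := isCompact_univ.exists_isMinOn univ_nonempty hq.continuousOn
  refine ⟨(q p₀)⁻¹, (inv_pos.2 (hq0 p₀)).le, fun f s => ?_⟩
  rw [inv_mul_eq_div, le_div_iff₀ (hq0 p₀)]
  by_cases h : gradient f s = 0
  · simp [h, dirichletForm]
  · have h1 : q p₀ ≤ _ := hp₀ (mem_univ (s, (⟨‖gradient f s‖⁻¹ • gradient f s, by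
      simpa using norm_inv_norm_smul h⟩ : sphere (0 : V) 1)))
    have hn := norm_pos_iff.2 h
    have h2 := mul_le_mul_of_nonneg_left h1 (sq_nonneg ‖gradient f s‖)
    refine h2.trans_eq ?_
    simp only [q, dirichletForm, map_smul, inner_smul_left, inner_smul_right, RCLike.conj_to_real]
    field_simp

omit hH [MeasurableSpace V] [BorelSpace V] [Nontrivial V] in
lemma exists_le_sphere {f : sphere (0 : V) 1 → ℝ} (hf : Continuous f) :
    ∃ b : ℝ, 0 < b ∧ ∀ s, f s ≤ b := by
  obtain ⟨b, hb⟩ := isCompact_univ.bddAbove_image hf.continuousOn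
  exact ⟨max b 1, by positivity, fun s =>
    (hb (mem_image_of_mem f (mem_univ s))).trans (le_max_left _ _)⟩

/-- The Poincaré inequality for the cone-volume measure: the energy controls the distance to the
constants. -/
theorem exists_integral_sub_const_le (hd : 3 ≤ Module.finrank ℝ V) :
    ∃ C : ℝ, 0 ≤ C ∧ ∀ Z : V → ℝ, C2Hom0 Z → ∃ m : ℝ,
      ∫ s : sphere (0 : V) 1, coneDensity H s * (Z s - m) ^ 2 ∂μ.toSphere ≤
        C * ∫ s : sphere (0 : V) 1, coneDensity H s * (Z s * negL H Z s) ∂μ.toSphere := by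
  obtain ⟨C₁, hC₁, h₁⟩ := exists_poincare (V := V) μ hd
  obtain ⟨C₂, hC₂, h₂⟩ := hH.exists_norm_sq_le_dirichletForm (by omega)
  obtain ⟨b, hb0, hb⟩ := exists_le_sphere hH.continuous_coneDensity
  refine ⟨b * (C₁ * C₂), by positivity, fun Z hZ => ?_⟩
  obtain ⟨m, hm⟩ := h₁ Z hZ.c1
  refine ⟨m, ?_⟩
  have hz := hZ.c1.continuous
  have c1 : Integrable (fun s : sphere (0 : V) 1 => coneDensity H s * (Z s - m) ^ 2) μ.toSphere :=
    integrable_sphere μ (hH.continuous_coneDensity.mul ((hz.sub continuous_const).pow 2))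
  have c2 : Integrable (fun s : sphere (0 : V) 1 => (Z s - m) ^ 2) μ.toSphere :=
    integrable_sphere μ ((hz.sub continuous_const).pow 2)
  have c3 : Integrable (fun s : sphere (0 : V) 1 => ‖gradient Z s‖ ^ 2) μ.toSphere :=
    integrable_sphere μ (hZ.c1.continuous_gradient.norm.pow 2)
  have c4 := integrable_sphere μ
    (hH.continuous_coneDensity.mul (hH.continuous_dirichletForm hZ.c1 hZ.c1))
  calc _ ≤ b * ∫ s : sphere (0 : V) 1, (Z s - m) ^ 2 ∂μ.toSphere := by
        rw [← integral_const_mul]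
        exact integral_mono c1 (c2.const_mul b) fun s =>
          mul_le_mul_of_nonneg_right (hb s) (sq_nonneg _)
    _ ≤ b * (C₁ * ∫ s : sphere (0 : V) 1, ‖gradient Z s‖ ^ 2 ∂μ.toSphere) := by gcongr
    _ ≤ b * (C₁ * (C₂ * ∫ s : sphere (0 : V) 1, coneDensity H s * dirichletForm H Z Z s
          ∂μ.toSphere)) := by
        gcongr
        rw [← integral_const_mul]
        exact integral_mono c3 (c4.const_mul C₂) fun s => h₂ Z s
    _ = _ := by rw [hH.integral_mul_negL μ (by omega) hZ.c1 hZ]; ring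

/-- Stability of the eigenspace of the eigenvalue `1`: by Bochner's formula a small
`‖Z - (-L) Z‖` makes the Hessian of `Z H` small, so that `Z H` is nearly linear. -/
theorem exists_integral_sub_linear_le (hd : 3 ≤ Module.finrank ℝ V) :
    ∃ C : ℝ, 0 ≤ C ∧ ∀ Z : V → ℝ, C2Hom0 Z → ∃ v : V,
      ∫ s : sphere (0 : V) 1, coneDensity H s * (Z s - inner ℝ (s : V) v / H s) ^ 2 ∂μ.toSphere ≤
        C * ∫ s : sphere (0 : V) 1, coneDensity H s *
          ((Z s - negL H Z s) * (Z s - (Module.finrank ℝ V - 1) * negL H Z s)) ∂μ.toSphere := by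
  have hd3 : (3 : ℝ) ≤ (Module.finrank ℝ V : ℝ) := by exact_mod_cast hd
  have hpos : ∀ s : sphere (0 : V) 1, 0 < H s := fun s => hH.pos _ (ne_zero_of_mem_sphere s)
  obtain ⟨C₁, hC₁, h₁⟩ := exists_poincare (V := V) μ hd
  obtain ⟨b, hb0, hb⟩ := exists_le_sphere (hH.continuous_coneDensity.div
    (hH.continuous.pow 2) fun s => pow_ne_zero 2 (hpos s).ne')
  obtain ⟨Λ, hΛ0, hΛ⟩ := exists_le_sphere hH.continuous_hatHess.norm
  obtain ⟨a, ha0, ha⟩ := exists_le_sphere (hH.continuous_coneDensity.inv₀ fun s =>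
    (hH.coneDensity_pos (by simp)).ne')
  refine ⟨b * (C₁ * (Λ ^ 2 * a * (Module.finrank ℝ V - 1))), ?_, fun Z hZ => ?_⟩
  · have : 0 ≤ (Module.finrank ℝ V : ℝ) - 1 := by linarith
    positivity
  have hU := hZ.mul hH.toC2Hom1
  set U : V → ℝ := fun y => Z y * H y with hUdef
  let e := stdOrthonormalBasis ℝ V
  choose m hm using fun i => h₁ _ (hU.c1Hom0_gradient (e i))
  refine ⟨∑ i, m i • e i, ?_⟩
  have c1 : Integrable (fun s : sphere (0 : V) 1 =>
      coneDensity H s * (Z s - inner ℝ (s : V) (∑ i, m i • e i) / H s) ^ 2) μ.toSphere :=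
    integrable_sphere μ (hH.continuous_coneDensity.mul ((hZ.c1.continuous.sub
      ((continuous_subtype_val.inner continuous_const).div hH.continuous
        fun s => (hpos s).ne')).pow 2))
  have c2 : ∀ i, Integrable (fun s : sphere (0 : V) 1 => (inner ℝ (gradient U s) (e i) - m i) ^ 2)
      μ.toSphere := fun i =>
    integrable_sphere μ (((hU.c1Hom0_gradient (e i)).continuous.sub continuous_const).pow 2)
  have c3 : ∀ i, Integrable (fun s : sphere (0 : V) 1 => ‖hess U s (e i)‖ ^ 2) μ.toSphere :=
    fun i => integrable_sphere μ ((hU.continuous_hess.clm_apply continuous_const).norm.pow 2)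
  have c4 : Integrable (fun s : sphere (0 : V) 1 => coneDensity H s *
      tr (Ring.inverse (hatHess H s) * hess U s * (Ring.inverse (hatHess H s) * hess U s)))
      μ.toSphere :=
    integrable_sphere μ (hH.continuous_coneDensity.mul (hH.nondeg.continuous_tr_sq hU))
  calc _ ≤ b * ∑ i, ∫ s : sphere (0 : V) 1, (inner ℝ (gradient U s) (e i) - m i) ^ 2
          ∂μ.toSphere := by
        rw [← integral_finsetSum _ fun i _ => c2 i, ← integral_const_mul]
        refine integral_mono c1 ((integrable_finsetSum _ fun i _ => c2 i).const_mul b) fun s => ?_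
        have hs : ‖(s : V)‖ = 1 := by simp
        set v := ∑ i, m i • e i with hv
        have e1 : Z s - inner ℝ (s : V) v / H s = inner ℝ (gradient U s - v) (s : V) / H s := by
          rw [inner_sub_left, hU.inner_gradient_self (ne_zero_of_mem_sphere s), hUdef,
            real_inner_comm v]
          field_simp [(hpos s).ne']
        have e2 : ‖gradient U s - v‖ ^ 2 = ∑ i, (inner ℝ (gradient U s) (e i) - m i) ^ 2 := by
          rw [← e.sum_sq_norm_inner_right]
          refine Finset.sum_congr rfl fun i _ => ?_
          rw [inner_sub_right, hv, e.orthonormal.inner_right_fintype, Real.norm_eq_abs, sq_abs,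
            real_inner_comm]
        have e3 : (inner ℝ (gradient U s - v) (s : V) : ℝ) ^ 2 ≤ ‖gradient U s - v‖ ^ 2 := by
          rw [← sq_abs]
          refine pow_le_pow_left₀ (abs_nonneg _) ((abs_real_inner_le_norm _ _).trans ?_) 2
          rw [hs, mul_one]
        simp only
        rw [e1, ← e2, div_pow]
        refine (le_of_eq ?_).trans (mul_le_mul (hb s) e3 (sq_nonneg _) hb0.le)
        simp only [Pi.div_apply, Pi.pow_apply]
        ring
    _ ≤ b * ∑ i, C₁ * ∫ s : sphere (0 : V) 1, ‖hess U s (e i)‖ ^ 2 ∂μ.toSphere := by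
        gcongr with i
        refine (hm i).trans_eq ?_
        congr 1
        refine integral_congr_ae (.of_forall fun s => ?_)
        simp only [hU.gradient_inner_gradient (e i) (ne_zero_of_mem_sphere s)]
    _ ≤ b * (C₁ * (Λ ^ 2 * a * ∫ s : sphere (0 : V) 1, coneDensity H s *
          tr (Ring.inverse (hatHess H s) * hess U s * (Ring.inverse (hatHess H s) * hess U s))
          ∂μ.toSphere)) := by
        rw [← Finset.mul_sum]
        gcongr
        rw [← integral_finsetSum _ fun i _ => c3 i, ← integral_const_mul]
        refine integral_mono (integrable_finsetSum _ fun i _ => c3 i) (c4.const_mul _) fun s => ?_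
        have hs : ‖(s : V)‖ = 1 := by simp
        have h2 := sum_norm_sq_le_tr e (hH.hatHess_symm hs)
          (fun v hv => hH.inner_hatHess_pos hs hv)
          (inner_hess_symm hU.contDiffOn (ne_zero_of_mem_sphere s)) (hΛ s) (hH.isUnit_hatHess hs)
        refine h2.trans ?_
        have h3 := nonneg_of_mul_nonneg_right
          ((Finset.sum_nonneg fun i _ => sq_nonneg _).trans h2) (by positivity)
        have h4 : 1 ≤ a * coneDensity H s := by
          have := ha s
          rwa [Pi.inv_apply, inv_le_iff_one_le_mul₀ (hH.coneDensity_pos hs)] at this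
        have h5 := mul_le_mul_of_nonneg_left h4 (mul_nonneg (sq_nonneg Λ) h3)
        linarith
    _ = _ := by
        rw [hUdef, hH.integral_tr_sq μ (by omega) hZ]; ring

end StrictlyConvex

end Inequalities

/-! ### A spectral gap for closed symmetric relations -/

section Spectral

variable {E : Type*} [NormedAddCommGroup E] [InnerProductSpace ℝ E] [CompleteSpace E]

lemma notMem_of_le_increasingEnum {σ : Set ℝ} (h0 : (0 : ℝ) ∈ σ) (h1 : (1 : ℝ) ∈ σ) {c : ℝ}
    (hc : c ≤ increasingEnum σ 2) {r : ℝ} (hr : r ∈ Ioo 1 c) : r ∉ σ := by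
  intro hrσ
  have e0 : increasingEnum σ 0 ≤ 0 := by
    by_cases hb : BddBelow σ
    · exact csInf_le hb h0
    · exact (Real.sInf_of_not_bddBelow hb).le
  have e1 : increasingEnum σ 1 ≤ 1 :=
    csInf_le ⟨increasingEnum σ 0, fun x hx => le_of_lt hx.2⟩
      ⟨h1, show increasingEnum σ 0 < 1 by linarith⟩
  have e2 : increasingEnum σ 2 ≤ r :=
    csInf_le ⟨increasingEnum σ 1, fun x hx => le_of_lt hx.2⟩
      ⟨hrσ, show increasingEnum σ 1 < r by linarith [hr.1]⟩
  linarith [hr.2]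

/-- Symmetry of a linear relation. -/
def IsSymmRel (G : Submodule ℝ (E × E)) : Prop :=
  ∀ a ∈ G, ∀ b ∈ G, inner ℝ a.2 b.1 = (inner ℝ a.1 b.2 : ℝ)

variable {G : Submodule ℝ (E × E)}

/-- The resolvent of a symmetric relation at a point outside its spectrum. -/
lemma exists_resolvent (hG : IsSymmRel G) {m : ℝ} (hm : m ∉ graphSpectrum G) :
    ∃ S : E →L[ℝ] E, (∀ x y, inner ℝ (S x) y = (inner ℝ x (S y) : ℝ)) ∧
      (∀ g, (S g, g + m • S g) ∈ G) ∧ ∀ f h, (f, h) ∈ G → S (h - m • f) = f := by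
  have hex : ∀ g : E, ∃! f : E, (f, g + m • f) ∈ G := not_not.1 hm
  choose S hS hu using hex
  have hlin : ∀ f g, (f, g + m • f) ∈ G → S g = f := fun f g h => (hu g f h).symm
  let T : E →ₗ[ℝ] E :=
    { toFun := S
      map_add' := fun x y => hlin _ _ (by
        have := G.add_mem (hS x) (hS y)
        convert this using 1
        ext1 <;> simp only [Prod.mk_add_mk]
        module)
      map_smul' := fun c x => hlin _ _ (by
        have := G.smul_mem c (hS x)
        convert this using 1
        ext1 <;> simp only [Prod.smul_mk, RingHom.id_apply]
        module) }
  have hT : T.IsSymmetric := by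
    intro x y
    have := hG _ (hS x) _ (hS y)
    simp only [inner_add_left, inner_add_right, inner_smul_left, inner_smul_right,
      RCLike.conj_to_real] at this
    change inner ℝ (S x) y = (inner ℝ x (S y) : ℝ)
    linarith
  refine ⟨⟨T, hT.continuous⟩, hT, hS, fun f h hfh => hlin _ _ ?_⟩
  rwa [sub_add_cancel]

/-- A bounded symmetric operator `S` such that `1 - t S` is bijective for `|t| < δ` has norm at
most `1 / δ`. -/
lemma norm_le_of_bijective {S : E →L[ℝ] E} (hS : ∀ x y, inner ℝ (S x) y = (inner ℝ x (S y) : ℝ))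
    {δ : ℝ} (hδ : 0 < δ) (hb : ∀ t : ℝ, |t| < δ → Function.Bijective fun x => x - t • S x) (x : E) :
    δ * ‖S x‖ ≤ ‖x‖ := by
  by_contra! hx
  have hN : δ⁻¹ < ‖S‖ := by
    have h1 := S.le_opNorm x
    have hx0 : 0 < ‖x‖ := norm_pos_iff.2 fun h => by simp [h] at hx
    rw [inv_lt_iff_one_lt_mul₀ hδ]
    have : ‖x‖ * 1 < ‖x‖ * (‖S‖ * δ) := by nlinarith
    exact lt_of_mul_lt_mul_left this hx0.le
  have hN0 : 0 < ‖S‖ := (inv_pos.2 hδ).trans hN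
  set t := ‖S‖⁻¹ with ht
  have ht0 : 0 < t := inv_pos.2 hN0
  have htδ : |t| < δ := by rw [abs_of_pos ht0]; exact inv_lt_of_inv_lt₀ hδ hN
  let T : E →L[ℝ] E := (1 - t • S) ∘L (1 + t • S)
  have hT : Function.Bijective T := by
    have h1 := hb t htδ
    have h2 := hb (-t) (by rwa [abs_neg])
    have := h1.comp h2
    convert this using 1
    ext y
    simp only [T, ContinuousLinearMap.comp_apply, sub_apply, add_apply, smul_apply,
      one_apply_eq_self, map_add, map_smul, Function.comp_apply, map_sub]
    module
  let e := ContinuousLinearEquiv.ofBijective T (LinearMap.ker_eq_bot.2 hT.1)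
    (LinearMap.range_eq_top.2 hT.2)
  set C := ‖(e.symm : E →L[ℝ] E)‖ + 1 with hC
  have hC0 : 0 < C := by positivity
  have hCT : ∀ y, ‖y‖ ≤ C * ‖T y‖ := by
    intro y
    have h1 := (e.symm : E →L[ℝ] E).le_opNorm (T y)
    have h2 : (e.symm : E →L[ℝ] E) (T y) = y := e.symm_apply_apply y
    rw [h2] at h1
    nlinarith [norm_nonneg (T y)]
  have hTy : ∀ y, ‖T y‖ ^ 2 ≤ ‖y‖ ^ 2 - (t * ‖S y‖) ^ 2 := by
    intro y
    have h1 : T y = y - (t ^ 2) • S (S y) := by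
      simp only [T, ContinuousLinearMap.comp_apply, sub_apply, add_apply, smul_apply,
        one_apply_eq_self, map_add, map_smul]
      module
    have h2 : t * ‖S (S y)‖ ≤ ‖S y‖ := by
      have := S.le_opNorm (S y)
      rw [ht, inv_mul_le_iff₀ hN0]; exact this
    rw [h1, norm_sub_sq_real, inner_smul_right, ← hS, real_inner_self_eq_norm_sq, norm_smul,
      Real.norm_eq_abs, abs_of_pos (by positivity)]
    have h3 : (t * (t * ‖S (S y)‖)) ^ 2 ≤ (t * ‖S y‖) ^ 2 :=
      pow_le_pow_left₀ (by positivity) (mul_le_mul_of_nonneg_left h2 ht0.le) 2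
    nlinarith
  have hkey : ∀ y, ‖S y‖ ≤ (‖S‖ * √(1 - (C ^ 2)⁻¹)) * ‖y‖ := by
    intro y
    have h1 := pow_le_pow_left₀ (norm_nonneg _) (hCT y) 2
    rw [mul_pow] at h1
    have h2 := h1.trans (mul_le_mul_of_nonneg_left (hTy y) (sq_nonneg C))
    have h3 : ‖S y‖ ^ 2 ≤ ‖S‖ ^ 2 * ((1 - (C ^ 2)⁻¹) * ‖y‖ ^ 2) := by
      rw [ht] at h2
      field_simp at h2 ⊢
      nlinarith
    rw [← Real.sqrt_sq hN0.le, ← Real.sqrt_mul (sq_nonneg _), ← Real.sqrt_sq (norm_nonneg y),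
      ← Real.sqrt_mul' _ (sq_nonneg _), mul_assoc]
    exact Real.le_sqrt_of_sq_le h3
  have h1 := S.opNorm_le_bound (by positivity) hkey
  have h2 : √(1 - (C ^ 2)⁻¹) < 1 := by
    rw [Real.sqrt_lt' one_pos]
    have : 0 < (C ^ 2)⁻¹ := by positivity
    linarith
  nlinarith

/-- If a symmetric form `X ≥ 0` satisfies `X² ≥ a X`, then `X ≥ a` on its range. -/
lemma mul_norm_sq_le_inner {X : E →L[ℝ] E} (hX : ∀ x y, inner ℝ (X x) y = (inner ℝ x (X y) : ℝ))
    {a : ℝ} (ha : 0 < a) {x : E}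
    (h1 : 0 ≤ (inner ℝ (X (x - a⁻¹ • X x)) (x - a⁻¹ • X x) : ℝ))
    (h2 : a * inner ℝ (X x) x ≤ ‖X x‖ ^ 2) : a * ‖X x‖ ^ 2 ≤ inner ℝ (X (X x)) (X x) := by
  simp only [map_sub, map_smul, inner_sub_left, inner_sub_right, inner_smul_left, inner_smul_right,
    RCLike.conj_to_real, hX (X x) x, real_inner_self_eq_norm_sq] at h1
  field_simp at h1
  nlinarith

/-- Let the nonnegative symmetric relation `A` satisfy `A² ≥ A`, and let its spectrum avoid
`(1, c)`. Then `A ≥ c` on the orthogonal complement of the kernels of `A` and `A - 1`, in the sense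
that `A⁻¹ ≤ 1 / c` there. -/
theorem exists_preimage_of_gap (hG : IsSymmRel G) (hpos : ∀ a ∈ G, 0 ≤ (inner ℝ a.1 a.2 : ℝ))
    (hBM : ∀ a ∈ G, inner ℝ a.1 a.2 ≤ ‖a.2‖ ^ 2) {c : ℝ} (hc : 1 < c)
    (hgap : ∀ r ∈ Ioo 1 c, r ∉ graphSpectrum G) {y : E}
    (hy0 : ∀ k, (k, (0 : E)) ∈ G → inner ℝ y k = (0 : ℝ))
    (hy1 : ∀ k, (k, k) ∈ G → inner ℝ y k = (0 : ℝ)) :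
    ∃ z, (z, y) ∈ G ∧ c * inner ℝ y z ≤ ‖y‖ ^ 2 := by
  set m := (1 + c) / 2 with hm
  set δ := (c - 1) / 2 with hδ
  have hδ0 : 0 < δ := by rw [hδ]; linarith
  have hm0 : 0 < m := by rw [hm]; linarith
  have hmδ : m = 1 + δ := by rw [hm, hδ]; ring
  have hcδ : c = m + δ := by rw [hm, hδ]; ring
  obtain ⟨S, hS, hSG, hGS⟩ := exists_resolvent hG (hgap m ⟨by linarith, by linarith⟩)
  have hbij : ∀ t : ℝ, |t| < δ → Function.Bijective fun x => x - t • S x := by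
    intro t ht
    have hr : m + t ∉ graphSpectrum G := hgap _ (by
      rw [abs_lt] at ht
      constructor <;> linarith [ht.1, ht.2])
    have hex : ∀ g : E, ∃! f : E, (f, g + (m + t) • f) ∈ G := not_not.1 hr
    have hiff : ∀ f g, (f, g + (m + t) • f) ∈ G ↔ f = S (g + t • f) := by
      intro f g
      constructor
      · intro h
        rw [← hGS _ _ h]
        congr 1
        rw [hGS _ _ h]
        module
      · intro h
        have := hSG (g + t • f)
        rw [← h] at this
        convert this using 2
        module
    constructor
    · intro x x' hxx
      have h0 : x - x' = S (0 + t • (x - x')) := by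
        simp only [zero_add, map_smul, map_sub]
        have : x - t • S x = x' - t • S x' := hxx
        rw [smul_sub]
        exact sub_eq_sub_iff_sub_eq_sub.1 this
      have h1 : (0 : E) = S (0 + t • (0 : E)) := by simp
      exact sub_eq_zero.1 ((hex 0).unique ((hiff _ _).2 h0) ((hiff _ _).2 h1))
    · intro k
      obtain ⟨f, hf, -⟩ := hex (t • k)
      have := (hiff _ _).1 hf
      refine ⟨k + f, ?_⟩
      simp only
      rw [← smul_add, map_smul] at this
      rw [← this]
      abel
  have hnorm := norm_le_of_bijective hS hδ0 hbij
  have q1 : ∀ x, 0 ≤ (inner ℝ (S x) x : ℝ) + m * ‖S x‖ ^ 2 := fun x => by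
    have := hpos _ (hSG x)
    simpa [inner_add_right, inner_smul_right] using this
  have q2 : ∀ x, 0 ≤ ‖x‖ ^ 2 + (m + δ) * (inner ℝ (S x) x : ℝ) + m * δ * ‖S x‖ ^ 2 := fun x => by
    have := hBM _ (hSG x)
    simp only [inner_add_right, inner_smul_right, real_inner_self_eq_norm_sq, norm_add_sq_real,
      norm_smul, mul_pow, Real.norm_eq_abs, sq_abs, real_inner_comm (S x) x] at this
    rw [hmδ] at this ⊢
    nlinarith
  have q3 : ∀ x, |inner ℝ (S x) x| * δ ≤ ‖x‖ ^ 2 := fun x => by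
    have h1 := abs_real_inner_le_norm (S x) x
    have h2 := mul_le_mul_of_nonneg_right (hnorm x) (norm_nonneg x)
    nlinarith
  -- On the range of `1 + δ S` the operator `1 + m S` is nonnegative.
  have h_one_add_nonneg : ∀ g, 0 ≤ ‖g + δ • S g‖ ^ 2 +
      m * (inner ℝ (S (g + δ • S g)) (g + δ • S g) : ℝ) := by
    intro g
    have hX : ∀ x y, inner ℝ ((1 + δ • S) x) y = (inner ℝ x ((1 + δ • S) y) : ℝ) := fun x y => by
      simp [inner_add_left, inner_add_right, inner_smul_left, inner_smul_right, hS]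
    have ha : 0 < 1 / m := by positivity
    have h := mul_norm_sq_le_inner hX ha (x := g) ?_ ?_
    · simp only [add_apply, smul_apply, one_apply_eq_self, inner_add_left (g + δ • S g),
        real_inner_self_eq_norm_sq, inner_smul_left, RCLike.conj_to_real] at h
      rw [one_div, inv_mul_le_iff₀ hm0] at h
      have : m = 1 + δ := hmδ
      nlinarith
    · set x := g - (1 / m)⁻¹ • (1 + δ • S) g
      have := q3 x
      simp only [add_apply, smul_apply, one_apply_eq_self, inner_add_left,
        real_inner_self_eq_norm_sq, inner_smul_left, RCLike.conj_to_real]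
      nlinarith [neg_abs_le (inner ℝ (S x) x : ℝ)]
    · have := q2 g
      simp only [add_apply, smul_apply, one_apply_eq_self, inner_add_left, norm_add_sq_real,
        real_inner_self_eq_norm_sq, inner_smul_left, RCLike.conj_to_real, inner_smul_right,
        norm_smul, mul_pow, Real.norm_eq_abs, sq_abs, real_inner_comm (S g) g]
      rw [one_div, inv_mul_le_iff₀ hm0]
      have h5 := mul_nonneg hδ0.le this
      rw [hmδ] at h5 ⊢
      linarith
  -- On the range of `(1 + m S) (1 + δ S)` the operator `S` is nonnegative.
  have hS_nonneg : ∀ g, 0 ≤ (inner ℝ (S (g + δ • S g + m • S (g + δ • S g)))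
      (g + δ • S g + m • S (g + δ • S g)) : ℝ) := by
    intro g
    have hX : ∀ x y, inner ℝ ((1 + m • S) x) y = (inner ℝ x ((1 + m • S) y) : ℝ) := fun x y => by
      simp [inner_add_left, inner_add_right, inner_smul_left, inner_smul_right, hS]
    set x := g + δ • S g with hx
    have h := mul_norm_sq_le_inner hX one_pos (x := x) ?_ ?_
    · simp only [add_apply, smul_apply, one_apply_eq_self, inner_add_left (x + m • S x),
        real_inner_self_eq_norm_sq, inner_smul_left, RCLike.conj_to_real, one_mul] at h
      exact nonneg_of_mul_nonneg_right (by linarith) hm0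
    · have e : x - (1 : ℝ)⁻¹ • (1 + m • S) x = (-m • S g) + δ • S (-m • S g) := by
        simp only [hx, add_apply, smul_apply, one_apply_eq_self, map_add, map_smul]
        module
      have := h_one_add_nonneg (-m • S g)
      rw [← e] at this
      simp only [add_apply (1 : E →L[ℝ] E), smul_apply, one_apply_eq_self, inner_add_left,
        real_inner_self_eq_norm_sq, inner_smul_left, RCLike.conj_to_real] at this ⊢
      exact this
    · have := q1 x
      simp only [add_apply, smul_apply, one_apply_eq_self, inner_add_left, norm_add_sq_real,
        real_inner_self_eq_norm_sq, inner_smul_left, RCLike.conj_to_real, inner_smul_right,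
        norm_smul, mul_pow, Real.norm_eq_abs, sq_abs, real_inner_comm (S x) x]
      nlinarith
  let T : E →L[ℝ] E := (1 + m • S) ∘L (1 + δ • S)
  have hTapp : ∀ g, T g = g + δ • S g + m • S (g + δ • S g) := fun g => by
    simp only [T, ContinuousLinearMap.comp_apply, add_apply, smul_apply, one_apply_eq_self]
  have hTS : ∀ g, T (S g) = S (T g) := fun g => by simp only [hTapp, map_add, map_smul]
  have hTsymm : ∀ x y, inner ℝ (T x) y = (inner ℝ x (T y) : ℝ) := fun x y => by
    simp only [hTapp, inner_add_left, inner_add_right, inner_smul_left, inner_smul_right, hS,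
      map_add, map_smul, RCLike.conj_to_real]
  let W : Submodule ℝ E := (LinearMap.range T.toLinearMap).topologicalClosure
  have hWc : IsClosed (W : Set E) := Submodule.isClosed_topologicalClosure _
  have : CompleteSpace W := hWc.completeSpace_coe
  have hWind : ∀ {P : E → Prop}, IsClosed {x | P x} → (∀ g, P (T g)) → ∀ x ∈ W, P x := by
    intro P hP h x hx
    have : closure (LinearMap.range T.toLinearMap : Set E) ⊆ {x | P x} :=
      closure_minimal (by rintro _ ⟨g, rfl⟩; exact h g) hP
    exact this hx
  have hWS : ∀ x ∈ W, S x ∈ W := hWind (P := fun x => S x ∈ W) (hWc.preimage S.continuous)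
    fun g => by
      rw [← hTS]
      exact Submodule.le_topologicalClosure _ ⟨S g, rfl⟩
  have hWpos : ∀ x ∈ W, 0 ≤ (inner ℝ (S x) x : ℝ) :=
    hWind (P := fun x => 0 ≤ (inner ℝ (S x) x : ℝ))
      (isClosed_le continuous_const (by fun_prop)) fun g => by
        have := hS_nonneg g
        rwa [← hTapp] at this
  have hyW : y ∈ W := by
    rw [show W = (LinearMap.range T.toLinearMap)ᗮᗮ from
      (Submodule.orthogonal_orthogonal_eq_closure _).symm]
    rw [Submodule.mem_orthogonal']
    intro x hx
    have hTx : T x = 0 := by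
      rw [Submodule.mem_orthogonal] at hx
      have := hx (T (T x)) ⟨T x, rfl⟩
      rw [hTsymm] at this
      exact inner_self_eq_zero.1 this
    have hmem : ∀ {k : E} {r : ℝ}, k + (m - r) • S k = 0 → (k, r • k) ∈ G := by
      intro k r hk
      have h1 := G.smul_mem (-(m - r)) (hSG k)
      have h2 : -(m - r) • S k = k := by rw [neg_smul, ← add_eq_zero_iff_neg_eq', hk]
      rw [Prod.smul_mk, smul_add, smul_comm (-(m - r)) m, h2] at h1
      convert h1 using 2
      module
    have k1 : inner ℝ y (x + δ • S x) = (0 : ℝ) := hy0 _ (by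
      have := hmem (k := x + δ • S x) (r := 0) (by rw [sub_zero, ← hTapp, hTx])
      rwa [zero_smul] at this)
    have k2 : inner ℝ y (x + m • S x) = (0 : ℝ) := hy1 _ (by
      have := hmem (k := x + m • S x) (r := 1) (by
        rw [← hTx, hTapp, hmδ]
        simp only [map_add, map_smul]
        module)
      rwa [one_smul] at this)
    have e : x = m • (x + δ • S x) - δ • (x + m • S x) := by rw [hmδ]; module
    rw [e, inner_sub_right, inner_smul_right, inner_smul_right, k1, k2]
    simp
  -- Invert `1 + m S` on `W`, extended by the identity on the orthogonal complement.
  have hunit : IsUnit (1 + m • (S ∘L W.starProjection)) := by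
    refine ContinuousLinearMap.isUnit_of_forall_le_norm_inner_map _ one_pos fun x => ?_
    have h1 : inner ℝ (S (W.starProjection x)) x =
        (inner ℝ (S (W.starProjection x)) (W.starProjection x) : ℝ) := by
      have := W.starProjection_inner_eq_zero x _ (hWS _ (W.starProjection_apply_mem x))
      rw [inner_sub_left, sub_eq_zero, real_inner_comm, real_inner_comm _ (W.starProjection x)] at this
      exact this
    have h2 := hWpos _ (W.starProjection_apply_mem x)
    rw [NNReal.coe_one, mul_one]
    refine le_trans ?_ (le_abs_self _)
    simp only [add_apply, smul_apply, one_apply_eq_self, inner_add_left, inner_smul_left,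
      real_inner_self_eq_norm_sq, ContinuousLinearMap.comp_apply, h1, RCLike.conj_to_real]
    nlinarith
  obtain ⟨x, hx⟩ : ∃ x, x + m • S (W.starProjection x) = y := by
    obtain ⟨u, hu⟩ := hunit
    refine ⟨(↑u⁻¹ : E →L[ℝ] E) y, ?_⟩
    have := congrArg (fun f : E →L[ℝ] E => f y) u.mul_inv
    rw [hu] at this
    simpa using this
  have hxW : x ∈ W := by
    rw [eq_sub_of_add_eq hx]
    exact W.sub_mem hyW (W.smul_mem _ (hWS _ (W.starProjection_apply_mem x)))
  rw [Submodule.starProjection_eq_self_iff.2 hxW] at hx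
  refine ⟨S x, hx ▸ hSG x, ?_⟩
  have p1 := hWpos _ (W.sub_mem hxW (W.smul_mem δ (hWS x hxW)))
  have p2 := q3 (S x)
  have p3 := q3 x
  have p4 := hWpos x hxW
  rw [← hx, hcδ]
  rw [abs_of_nonneg p4] at p3
  have p5 := mul_le_mul_of_nonneg_right (le_abs_self (inner ℝ (S (S x)) (S x) : ℝ)) hδ0.le
  simp only [map_sub, map_smul, inner_sub_left, inner_sub_right, inner_smul_left, inner_smul_right,
    RCLike.conj_to_real, inner_add_left, norm_add_sq_real, norm_smul, mul_pow, Real.norm_eq_abs,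
    sq_abs, real_inner_self_eq_norm_sq, hS (S x) x, real_inner_comm (S x) x] at p1 ⊢
  have p6 := mul_le_mul_of_nonneg_left (p5.trans p2) hδ0.le
  have p7 : 0 ≤ m * ((inner ℝ (S x) x : ℝ) - δ * ‖S x‖ ^ 2) := mul_nonneg hm0.le (by linarith)
  linarith

end Spectral

/-! ### Regularity of the support function -/

section Regularity

variable {V : Type*} [NormedAddCommGroup V] [InnerProductSpace ℝ V] [FiniteDimensional ℝ V]

lemma eventually_lt_of_hasDerivAt_neg {φ : ℝ → ℝ} {φ' : ℝ} (h : HasDerivAt φ φ' 0) (hφ : φ' < 0) :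
    ∀ᶠ t in 𝓝[>] (0 : ℝ), φ t < φ 0 := by
  have h1 := (hasDerivAt_iff_tendsto_slope.1 h).eventually (gt_mem_nhds hφ)
  have h2 := h1.filter_mono (nhdsWithin_mono (0 : ℝ) fun t (ht : t ∈ Ioi (0 : ℝ)) => ne_of_gt ht)
  filter_upwards [h2, self_mem_nhdsWithin] with t ht ht0
  have ht0' : (0 : ℝ) < t := ht0
  rw [slope_def_field, sub_zero, div_lt_iff₀ ht0', zero_mul] at ht
  linarith

/-- `y` is a point of `K` with outer normal `x`. -/
def IsSupportPoint (K : Set V) (x y : V) : Prop :=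
  y ∈ K ∧ ∀ z ∈ K, (inner ℝ x z : ℝ) ≤ inner ℝ x y

/-- The local description of a boundary point: near `y` the body is the sublevel set of `ρ`. -/
structure DefinedBy (K : Set V) (ρ : V → ℝ) (y : V) : Prop where
  contDiffAt : ContDiffAt ℝ 2 ρ y
  gradient_ne : gradient ρ y ≠ 0
  eventually : ∀ᶠ z in 𝓝 y, z ∈ K ↔ ρ z ≤ 0

variable {K : Set V} {ρ : V → ℝ} {x y : V}

lemma DefinedBy.eventually_definedBy (h : DefinedBy K ρ y) : ∀ᶠ z in 𝓝 y, DefinedBy K ρ z := by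
  have h1 : ContinuousAt (gradient ρ) y :=
    (toDual ℝ V).symm.continuous.continuousAt.comp (h.contDiffAt.continuousAt_fderiv (by norm_num))
  filter_upwards [h.contDiffAt.eventually (by simp), h1.eventually_ne h.gradient_ne,
    h.eventually.eventually_nhds] with z h1 h2 h3 using ⟨h1, h2, h3⟩

lemma tendsto_line (y v : V) : Tendsto (fun t : ℝ => y + t • v) (𝓝[>] 0) (𝓝 y) := by
  have h : Continuous fun t : ℝ => y + t • v := by fun_prop
  have := h.tendsto 0
  rw [zero_smul, add_zero] at this
  exact this.mono_left nhdsWithin_le_nhds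

lemma hasDerivAt_line (y v : V) (t : ℝ) : HasDerivAt (fun t : ℝ => y + t • v) v t := by
  simpa using ((hasDerivAt_id t).smul_const v).const_add y

lemma DefinedBy.apply_eq_zero (h : DefinedBy K ρ y) (hx : x ≠ 0) (hy : IsSupportPoint K x y) :
    ρ y = 0 := by
  refine le_antisymm (h.eventually.self_of_nhds.1 hy.1) (not_lt.1 fun hlt => ?_)
  have h1 : ∀ᶠ z in 𝓝 y, z ∈ K := by
    filter_upwards [h.contDiffAt.continuousAt.eventually (gt_mem_nhds hlt), h.eventually]
      with z hz1 hz2 using hz2.2 hz1.le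
  obtain ⟨t, ht, ht0⟩ := (((tendsto_line y x).eventually h1).and self_mem_nhdsWithin).exists
  have ht0' : (0 : ℝ) < t := ht0
  have h2 := hy.2 _ ht
  rw [inner_add_right, inner_smul_right, real_inner_self_eq_norm_sq] at h2
  have : 0 < t * ‖x‖ ^ 2 := by positivity
  linarith

/-- The outer normal at a boundary point is a positive multiple of the gradient of the defining
function. -/
lemma DefinedBy.eq_smul_gradient (h : DefinedBy K ρ y) (hx : x ≠ 0) (hy : IsSupportPoint K x y) :
    x = (‖x‖ / ‖gradient ρ y‖) • gradient ρ y := by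
  set a := gradient ρ y with ha
  have ha0 : 0 < ‖a‖ := norm_pos_iff.2 h.gradient_ne
  have hy0 := h.apply_eq_zero hx hy
  have key : ∀ v : V, (inner ℝ a v : ℝ) < 0 → (inner ℝ x v : ℝ) ≤ 0 := by
    intro v hv
    have hd : HasFDerivAt ρ (fderiv ℝ ρ y) (y + (0 : ℝ) • v) := by
      rw [zero_smul, add_zero]
      exact (h.contDiffAt.differentiableAt (by norm_num)).hasFDerivAt
    have h1 : HasDerivAt (fun t : ℝ => ρ (y + t • v)) (fderiv ℝ ρ y v) 0 :=
      hd.comp_hasDerivAt (0 : ℝ) (hasDerivAt_line y v 0)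
    rw [ha, inner_gradient] at hv
    obtain ⟨t, ⟨ht1, ht2⟩, ht0⟩ := (((eventually_lt_of_hasDerivAt_neg h1 hv).and
      ((tendsto_line y v).eventually h.eventually)).and self_mem_nhdsWithin).exists
    have ht0' : (0 : ℝ) < t := ht0
    rw [zero_smul, add_zero, hy0] at ht1
    have h2 := hy.2 _ (ht2.2 ht1.le)
    rw [inner_add_right, inner_smul_right] at h2
    exact nonpos_of_mul_nonpos_right (by linarith) ht0'
  have h1 : 0 ≤ (inner ℝ x a : ℝ) := by
    have := key (-a) (by rw [inner_neg_right, real_inner_self_eq_norm_sq]; nlinarith)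
    rw [inner_neg_right] at this
    linarith
  have h2 : ∀ ε : ℝ, 0 < ε → ‖a‖ ^ 2 * ‖x‖ ^ 2 ≤ (inner ℝ x a : ℝ) ^ 2 + ε * inner ℝ x a := by
    intro ε hε
    have := key (‖a‖ ^ 2 • x - (inner ℝ x a + ε : ℝ) • a) (by
      rw [inner_sub_right, inner_smul_right, inner_smul_right, real_inner_self_eq_norm_sq,
        real_inner_comm]
      have : 0 < ε * ‖a‖ ^ 2 := by positivity
      linarith)
    rw [inner_sub_right, inner_smul_right, inner_smul_right, real_inner_self_eq_norm_sq] at this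
    linarith
  have h3 : ‖a‖ ^ 2 * ‖x‖ ^ 2 ≤ (inner ℝ x a : ℝ) ^ 2 := by
    have h4 : Continuous fun ε : ℝ => (inner ℝ x a : ℝ) ^ 2 + ε * inner ℝ x a := by fun_prop
    have h5 := (h4.tendsto 0).mono_left (nhdsWithin_le_nhds (s := Ioi 0))
    rw [zero_mul, add_zero] at h5
    exact ge_of_tendsto h5 (by filter_upwards [self_mem_nhdsWithin] with ε hε using h2 ε hε)
  have h4 : ‖x‖ * ‖a‖ ≤ inner ℝ x a := by
    refine le_of_sq_le_sq ?_ h1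
    linarith [mul_pow ‖x‖ ‖a‖ 2]
  have h5 := (inner_eq_norm_mul_iff_real).1 (le_antisymm (real_inner_le_norm x a) h4)
  rw [div_eq_inv_mul, mul_smul, ← h5, inv_smul_smul₀ ha0.ne']

/-- A point of positive curvature is the only point with its outer normal. -/
lemma DefinedBy.eq_of_isSupportPoint (h : DefinedBy K ρ y) (hK : Convex ℝ K) (hx : x ≠ 0)
    (hpos : ∀ v ≠ 0, fderiv ℝ ρ y v = 0 → 0 < fderiv ℝ (fderiv ℝ ρ) y v v)
    (hy : IsSupportPoint K x y) {z : V} (hz : IsSupportPoint K x z) : z = y := by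
  by_contra hne
  set v := z - y with hv
  have hv0 : v ≠ 0 := sub_ne_zero.2 hne
  have hxv : (inner ℝ x v : ℝ) = 0 := by
    rw [hv, inner_sub_right, sub_eq_zero]
    exact le_antisymm (hy.2 z hz.1) (hz.2 y hy.1)
  have hdv : fderiv ℝ ρ y v = 0 := by
    rw [h.eq_smul_gradient hx hy, inner_smul_left, inner_gradient] at hxv
    have : ‖x‖ / ‖gradient ρ y‖ ≠ 0 :=
      div_ne_zero (norm_ne_zero_iff.2 hx) (norm_ne_zero_iff.2 h.gradient_ne)
    simpa [this] using hxv
  have h1 : HasFDerivAt (fderiv ℝ ρ) (fderiv ℝ (fderiv ℝ ρ) y) (y + (0 : ℝ) • v) := by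
    rw [zero_smul, add_zero]
    exact ((h.contDiffAt.fderiv_right (m := 1) (by norm_num)).differentiableAt
      (by norm_num)).hasFDerivAt
  have h2 : HasDerivAt (fun t : ℝ => -(fderiv ℝ ρ (y + t • v) v)) (-(fderiv ℝ (fderiv ℝ ρ) y v v)) 0 :=
    (((ContinuousLinearMap.apply ℝ ℝ v).hasFDerivAt).comp_hasDerivAt (0 : ℝ)
      (h1.comp_hasDerivAt (0 : ℝ) (hasDerivAt_line y v 0))).neg
  have h3 := eventually_lt_of_hasDerivAt_neg h2 (neg_neg_of_pos (hpos v hv0 hdv))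
  simp only [zero_smul, add_zero, hdv, neg_zero, neg_lt_zero] at h3
  have hIoo : Ioo (0 : ℝ) 1 ∈ 𝓝[>] (0 : ℝ) := Ioo_mem_nhdsGT one_pos
  obtain ⟨ε, hε0, hε⟩ := mem_nhdsGT_iff_exists_Ioc_subset.1 (h3.and
    (((tendsto_line y v).eventually h.eventually_definedBy).and hIoo))
  have hε0' : (0 : ℝ) < ε := hε0
  have hder : ∀ t ∈ Icc 0 ε, HasDerivAt (fun t : ℝ => ρ (y + t • v)) (fderiv ℝ ρ (y + t • v) v) t := by
    intro t ht
    have : DifferentiableAt ℝ ρ (y + t • v) := by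
      rcases ht.1.eq_or_lt with rfl | ht0
      · rw [zero_smul, add_zero]; exact h.contDiffAt.differentiableAt (by norm_num)
      · exact (hε ⟨ht0, ht.2⟩).2.1.contDiffAt.differentiableAt (by norm_num)
    exact this.hasFDerivAt.comp_hasDerivAt t (hasDerivAt_line y v t)
  have hmono : StrictMonoOn (fun t : ℝ => ρ (y + t • v)) (Icc 0 ε) := by
    refine strictMonoOn_of_deriv_pos (convex_Icc _ _)
      (fun t ht => (hder t ht).continuousAt.continuousWithinAt) fun t ht => ?_
    rw [interior_Icc] at ht
    rw [(hder t (Ioo_subset_Icc_self ht)).deriv]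
    exact (hε (Ioo_subset_Ioc_self ht)).1
  have h4 := hmono (left_mem_Icc.2 hε0'.le) (right_mem_Icc.2 hε0'.le) hε0'
  simp only [zero_smul, add_zero, h.apply_eq_zero hx hy] at h4
  obtain ⟨-, h5, h6⟩ := hε (right_mem_Ioc.2 hε0')
  have h7 : y + ε • v ∈ K := by
    have := hK hy.1 hz.1 (show 0 ≤ 1 - ε by linarith [h6.2]) h6.1.le (by ring)
    convert this using 1
    rw [hv]; module
  exact absurd (h5.eventually.self_of_nhds.1 h7) (not_le.2 h4)

variable {Y : V → V}

lemma tendsto_supportPoint (hK : IsCompact K) (hY : ∀ ξ, IsSupportPoint K ξ (Y ξ))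
    (huniq : ∀ z, IsSupportPoint K x z → z = Y x) : Tendsto Y (𝓝 x) (𝓝 (Y x)) := by
  rw [_root_.tendsto_nhds]
  intro U hU hxU
  have hc : IsCompact (K \ U) := hK.diff hU
  have h : ∀ᶠ ξ in 𝓝 x, ∀ z ∈ K \ U, (inner ℝ ξ (z - Y x) : ℝ) < 0 := by
    refine hc.eventually_forall_of_forall_eventually fun z hz => ?_
    have hcont : Continuous fun q : V × V => (inner ℝ q.1 (q.2 - Y x) : ℝ) := by fun_prop
    refine hcont.continuousAt.eventually (gt_mem_nhds ?_)
    by_contra! hge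
    simp only [inner_sub_right] at hge
    have : z = Y x := huniq z ⟨hz.1, fun w hw => ((hY x).2 w hw).trans (by linarith)⟩
    exact hz.2 (this ▸ hxU)
  filter_upwards [h] with ξ hξ
  by_contra hn
  have h1 := hξ _ ⟨(hY ξ).1, hn⟩
  have h2 := (hY ξ).2 _ (hY x).1
  rw [inner_sub_right] at h1
  linarith

/-- The map `(y, s) ↦ (s ∇ρ (y), ρ (y))`, which takes a boundary point and the length of an outer
normal to that normal. -/
noncomputable def normalMap (ρ : V → ℝ) (q : V × ℝ) : V × ℝ := (q.2 • gradient ρ q.1, ρ q.1)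

lemma contDiffAt_gradient (h : ContDiffAt ℝ 2 ρ y) : ContDiffAt ℝ 1 (gradient ρ) y :=
  (toDual ℝ V).symm.contDiff.contDiffAt.comp y (h.fderiv_right (by norm_num))

lemma inner_fderiv_gradient (h : ContDiffAt ℝ 2 ρ y) (v w : V) :
    inner ℝ (fderiv ℝ (gradient ρ) y v) w = fderiv ℝ (fderiv ℝ ρ) y v w := by
  have h1 : HasFDerivAt (fderiv ℝ ρ) (fderiv ℝ (fderiv ℝ ρ) y) y :=
    ((h.fderiv_right (m := 1) (by norm_num)).differentiableAt (by norm_num)).hasFDerivAt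
  have h2 := ((toDual ℝ V).symm.toContinuousLinearEquiv.toContinuousLinearMap.hasFDerivAt
    (x := fderiv ℝ ρ y)).comp y h1
  have h3 : fderiv ℝ (gradient ρ) y = _ := h2.fderiv
  rw [h3]
  simp

lemma contDiffAt_normalMap (h : ContDiffAt ℝ 2 ρ y) (s : ℝ) :
    ContDiffAt ℝ 1 (normalMap ρ) (y, s) := by
  have h1 : ContDiffAt ℝ 1 (fun q : V × ℝ => gradient ρ q.1) (y, s) :=
    ContDiffAt.comp (y, s) (g := gradient ρ) (f := Prod.fst) (contDiffAt_gradient h) contDiffAt_fst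
  have h2 : ContDiffAt ℝ 1 (fun q : V × ℝ => ρ q.1) (y, s) :=
    ContDiffAt.comp (y, s) (g := ρ) (f := Prod.fst) (h.of_le (by norm_num)) contDiffAt_fst
  exact (contDiffAt_snd.smul h1).prodMk h2

lemma hasFDerivAt_normalMap (h : ContDiffAt ℝ 2 ρ y) (s : ℝ) (v : V) (σ : ℝ) :
    fderiv ℝ (normalMap ρ) (y, s) (v, σ) =
      (s • fderiv ℝ (gradient ρ) y v + σ • gradient ρ y, fderiv ℝ ρ y v) := by
  have h1 : HasFDerivAt (fun q : V × ℝ => gradient ρ q.1)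
      (fderiv ℝ (gradient ρ) y ∘L ContinuousLinearMap.fst ℝ V ℝ) (y, s) :=
    HasFDerivAt.comp (y, s) (g := gradient ρ) (f := Prod.fst)
      ((contDiffAt_gradient h).differentiableAt (by norm_num)).hasFDerivAt hasFDerivAt_fst
  have h2 : HasFDerivAt (fun q : V × ℝ => ρ q.1)
      (fderiv ℝ ρ y ∘L ContinuousLinearMap.fst ℝ V ℝ) (y, s) :=
    HasFDerivAt.comp (y, s) (g := ρ) (f := Prod.fst)
      (h.differentiableAt (by norm_num)).hasFDerivAt hasFDerivAt_fst
  have h3 : HasFDerivAt (normalMap ρ) _ (y, s) := (hasFDerivAt_snd.smul h1).prodMk h2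
  rw [h3.fderiv]
  simp

/-- The inverse Gauss map is `C¹`, with positive definite derivative on the tangent space. -/
theorem DefinedBy.contDiffAt_supportPoint (hK : IsCompact K) (hKc : Convex ℝ K)
    (hY : ∀ ξ, IsSupportPoint K ξ (Y ξ)) (hx : x ≠ 0) (h : DefinedBy K ρ (Y x))
    (hpos : ∀ v ≠ 0, fderiv ℝ ρ (Y x) v = 0 → 0 < fderiv ℝ (fderiv ℝ ρ) (Y x) v v) :
    ContDiffAt ℝ 1 Y x ∧ ∀ v ≠ 0, inner ℝ x v = (0 : ℝ) → 0 < inner ℝ (fderiv ℝ Y x v) v := by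
  set y := Y x with hy
  set a := gradient ρ y with ha
  have ha0 : 0 < ‖a‖ := norm_pos_iff.2 h.gradient_ne
  have hxa := h.eq_smul_gradient hx (hY x)
  have hy0 := h.apply_eq_zero hx (hY x)
  set s := ‖x‖ / ‖a‖ with hs
  have hs0 : 0 < s := div_pos (norm_pos_iff.2 hx) ha0
  have hρ := h.contDiffAt
  have hF := contDiffAt_normalMap hρ s
  set F' := fderiv ℝ (normalMap ρ) (y, s) with hF'
  have hinj : Function.Injective F' := by
    rw [injective_iff_map_eq_zero]
    rintro ⟨v, σ⟩ hv
    rw [hF', hasFDerivAt_normalMap hρ, Prod.mk_eq_zero] at hv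
    have h1 := congrArg (fun u => (inner ℝ u v : ℝ)) hv.1
    simp only [inner_add_left, inner_smul_left, inner_gradient, hv.2, inner_zero_left, mul_zero,
      add_zero, RCLike.conj_to_real, inner_fderiv_gradient hρ] at h1
    have hv0 : v = 0 := by
      by_contra hne
      exact (mul_pos hs0 (hpos v hne hv.2)).ne' h1
    have h2 := hv.1
    rw [hv0, map_zero, smul_zero, zero_add, smul_eq_zero] at h2
    rw [hv0, h2.resolve_right h.gradient_ne]
    rfl
  have hFs : HasStrictFDerivAt (normalMap ρ)
      ((ContinuousLinearEquiv.ofBijective F' (LinearMap.ker_eq_bot.2 hinj)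
        (LinearMap.range_eq_top.2 (LinearMap.injective_iff_surjective.1 hinj)) :
          (V × ℝ) ≃L[ℝ] (V × ℝ)) : (V × ℝ) →L[ℝ] (V × ℝ)) (y, s) := by
    have := hF.hasStrictFDerivAt (by norm_num)
    rw [ContinuousLinearEquiv.coe_ofBijective]
    exact this
  set e := ContinuousLinearEquiv.ofBijective F' (LinearMap.ker_eq_bot.2 hinj)
        (LinearMap.range_eq_top.2 (LinearMap.injective_iff_surjective.1 hinj)) with he
  have hFval : normalMap ρ (y, s) = (x, 0) := by
    simp only [normalMap, hy0]
    rw [← ha, ← hxa]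
  have hg : ContDiffAt ℝ 1 (hFs.localInverse (normalMap ρ) e (y, s)) (x, 0) := by
    rw [← hFval]
    exact hF.to_localInverse hFs.hasFDerivAt (by norm_num)
  have htY := tendsto_supportPoint hK hY fun z hz => h.eq_of_isSupportPoint hKc hx hpos (hY x) hz
  have htg : Tendsto (fun ξ => gradient ρ (Y ξ)) (𝓝 x) (𝓝 a) :=
    (contDiffAt_gradient hρ).continuousAt.tendsto.comp htY
  have hts : Tendsto (fun ξ => ‖ξ‖ / ‖gradient ρ (Y ξ)‖) (𝓝 x) (𝓝 s) :=
    (continuous_norm.tendsto x).div htg.norm ha0.ne'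
  have hq : Tendsto (fun ξ => (Y ξ, ‖ξ‖ / ‖gradient ρ (Y ξ)‖)) (𝓝 x) (𝓝 (y, s)) :=
    htY.prodMk_nhds hts
  have hev : ∀ᶠ ξ in 𝓝 x, normalMap ρ (Y ξ, ‖ξ‖ / ‖gradient ρ (Y ξ)‖) = (ξ, 0) := by
    filter_upwards [htY.eventually h.eventually_definedBy, isOpen_ne.mem_nhds hx] with ξ h1 h2
    simp only [normalMap]
    rw [← h1.eq_smul_gradient h2 (hY ξ), h1.apply_eq_zero h2 (hY ξ)]
  have hYg : ∀ᶠ ξ in 𝓝 x, Y ξ = (hFs.localInverse (normalMap ρ) e (y, s) (ξ, 0)).1 := by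
    filter_upwards [hq.eventually hFs.eventually_left_inverse, hev] with ξ h1 h2
    rw [← h2, h1]
  have hYc : ContDiffAt ℝ 1 Y x := by
    refine ContDiffAt.congr_of_eventuallyEq ?_ hYg
    exact (hg.comp x (contDiffAt_id.prodMk contDiffAt_const)).fst
  refine ⟨hYc, fun v hv hxv => ?_⟩
  -- Differentiate the relation between the normal and the boundary point.
  have hYd := (hYc.differentiableAt (by norm_num)).hasFDerivAt
  have hgd : DifferentiableAt ℝ (fun ξ => gradient ρ (Y ξ)) x :=
    DifferentiableAt.comp x (g := gradient ρ) ((contDiffAt_gradient hρ).differentiableAt (by norm_num))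
      hYd.differentiableAt
  have hsd : DifferentiableAt ℝ (fun ξ => ‖ξ‖ / ‖gradient ρ (Y ξ)‖) x :=
    ((contDiffAt_norm ℝ hx (n := 1)).differentiableAt (by norm_num)).mul
      ((hgd.norm ℝ h.gradient_ne).inv ha0.ne')
  have hcomp := ((hF.differentiableAt (by norm_num)).hasFDerivAt).comp x
    (hYd.prodMk hsd.hasFDerivAt)
  have hcomp2 : HasFDerivAt (fun ξ : V => (ξ, (0 : ℝ))) _ x :=
    hcomp.congr_of_eventuallyEq (by filter_upwards [hev] with ξ hξ using hξ.symm)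
  have huni := hcomp2.unique ((hasFDerivAt_id x).prodMk (hasFDerivAt_const (0 : ℝ) x))
  have h1 := congrArg (fun L : V →L[ℝ] V × ℝ => L v) huni
  simp only [ContinuousLinearMap.comp_apply, ContinuousLinearMap.prod_apply] at h1
  rw [hasFDerivAt_normalMap hρ] at h1
  simp only [ContinuousLinearMap.id_apply, zero_apply, Prod.mk.injEq] at h1
  set u := fderiv ℝ Y x v with hu
  have hu0 : u ≠ 0 := by
    intro hu0
    rw [hu0, map_zero, smul_zero, zero_add] at h1
    apply hv
    have h2 : (inner ℝ v v : ℝ) = 0 := by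
      rw [hxa, inner_smul_left, mul_eq_zero] at hxv
      nth_rewrite 1 [← h1.1]
      rw [inner_smul_left, hxv.resolve_left (by simpa using hs0.ne'), mul_zero]
    exact inner_self_eq_zero.1 h2
  have h2 : (inner ℝ u v : ℝ) = s * fderiv ℝ (fderiv ℝ ρ) y u u := by
    conv_lhs => rw [← h1.1]
    rw [inner_add_right, inner_smul_right, inner_smul_right, real_inner_comm, inner_fderiv_gradient hρ,
      real_inner_comm, inner_gradient, h1.2]
    ring
  rw [h2]
  exact mul_pos hs0 (hpos u hu0 h1.2)

/-- The support function of a compact convex set all of whose boundary points have positive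
curvature. -/
theorem strictlyConvex_of_isSupportPoint {H : V → ℝ} (hK : IsCompact K) (hKc : Convex ℝ K)
    (h0 : (0 : V) ∈ interior K) (hY : ∀ ξ, IsSupportPoint K ξ (Y ξ)) (hH : ∀ ξ, H ξ = inner ℝ ξ (Y ξ))
    (hbd : ∀ y ∈ frontier K, ∃ ρ, DefinedBy K ρ y ∧
      ∀ v ≠ 0, fderiv ℝ ρ y v = 0 → 0 < fderiv ℝ (fderiv ℝ ρ) y v v) :
    StrictlyConvex H ∧ ∀ x ≠ 0, gradient H x = Y x := by
  have hfr : ∀ ξ ≠ 0, Y ξ ∈ frontier K := by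
    intro ξ hξ
    rw [hK.isClosed.frontier_eq]
    refine ⟨(hY ξ).1, fun hint => ?_⟩
    obtain ⟨t, ht, ht0⟩ := (((tendsto_line (Y ξ) ξ).eventually
      (mem_interior_iff_mem_nhds.1 hint)).and self_mem_nhdsWithin).exists
    have ht0' : (0 : ℝ) < t := ht0
    have h2 := (hY ξ).2 _ ht
    rw [inner_add_right, inner_smul_right, real_inner_self_eq_norm_sq] at h2
    have : 0 < t * ‖ξ‖ ^ 2 := by positivity
    linarith
  have hC : ∀ ξ ≠ 0, ContDiffAt ℝ 1 Y ξ ∧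
      ∀ v ≠ 0, inner ℝ ξ v = (0 : ℝ) → 0 < inner ℝ (fderiv ℝ Y ξ v) v := by
    intro ξ hξ
    obtain ⟨ρ, hρ, hpos⟩ := hbd _ (hfr ξ hξ)
    exact hρ.contDiffAt_supportPoint hK hKc hY hξ hpos
  have hHf : H = fun ξ => inner ℝ ξ (Y ξ) := funext hH
  have hgrad : ∀ x ≠ 0, gradient H x = Y x := by
    intro x hx
    have hd : DifferentiableAt ℝ H x := by
      rw [hHf]
      exact differentiableAt_id.inner ℝ ((hC x hx).1.differentiableAt (by norm_num))
    have hmin : IsLocalMin (fun ξ => H ξ - inner ℝ ξ (Y x)) x := .of_forall fun ξ => by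
      simp only [hH]
      have := (hY ξ).2 _ (hY x).1
      linarith
    have h1 : HasFDerivAt (fun ξ : V => (inner ℝ ξ (Y x) : ℝ))
        (fderiv ℝ (fun ξ : V => (inner ℝ ξ (Y x) : ℝ)) x) x :=
      ((contDiff_linear (Y x)).differentiable (by norm_num) x).hasFDerivAt
    have h2 := hmin.hasFDerivAt_eq_zero (hd.hasFDerivAt.sub h1)
    rw [← gradient_linear (Y x) x, gradient, gradient, sub_eq_zero.1 h2]
  have hYon : ContDiffOn ℝ 1 Y {0}ᶜ := fun x hx => (hC x hx).1.contDiffWithinAt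
  have hev : ∀ x ≠ 0, gradient H =ᶠ[𝓝 x] Y := fun x hx => by
    filter_upwards [isOpen_compl_singleton.mem_nhds hx] with z hz using hgrad z hz
  have hH2 : ContDiffOn ℝ 2 H {0}ᶜ := by
    have hf : ∀ x ∈ ({0}ᶜ : Set V), fderiv ℝ H x = toDual ℝ V (Y x) := fun x hx => by
      rw [← hgrad x hx, gradient, LinearIsometryEquiv.apply_symm_apply]
    rw [show (2 : WithTop ℕ∞) = 1 + 1 by norm_num,
      contDiffOn_succ_iff_fderiv_of_isOpen isOpen_compl_singleton]
    refine ⟨fun x hx => ?_, by simp, ?_⟩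
    · rw [hHf]
      exact (differentiableAt_id.inner ℝ
        ((hC x hx).1.differentiableAt (by norm_num))).differentiableWithinAt
    · exact ((toDual ℝ V).contDiff.comp_contDiffOn hYon).congr hf
  refine ⟨⟨⟨hH2, fun r hr x => ?_⟩, fun x hx => ?_, fun x hx v hv hxv => ?_⟩, hgrad⟩
  · have h1 := (hY (r • x)).2 _ (hY x).1
    have h2 := (hY x).2 _ (hY (r • x)).1
    simp only [hH, smul_eq_mul]
    rw [inner_smul_left, inner_smul_left] at h1
    rw [inner_smul_left]
    simp only [RCLike.conj_to_real] at h1 ⊢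
    exact le_antisymm (mul_le_mul_of_nonneg_left h2 hr.le) h1
  · obtain ⟨t, ht, ht0⟩ := (((tendsto_line (0 : V) x).eventually
      (mem_interior_iff_mem_nhds.1 h0)).and self_mem_nhdsWithin).exists
    have ht0' : (0 : ℝ) < t := ht0
    have h2 := (hY x).2 _ ht
    rw [zero_add, inner_smul_right, real_inner_self_eq_norm_sq] at h2
    rw [hH]
    have : 0 < t * ‖x‖ ^ 2 := by positivity
    linarith
  · have hx0 := ne_zero_of_norm_eq_one hx
    rw [hess, (hev x hx0).fderiv_eq]
    exact (hC x hx0).2 v hv hxv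

end Regularity

section SupportFunction

variable {n : ℕ}

lemma exists_isSupportPoint (K : ConvexBody (E n)) (ξ : E n) :
    ∃ y, IsSupportPoint (K : Set (E n)) ξ y := by
  obtain ⟨y, hy, hmax⟩ := K.isCompact.exists_isMaxOn K.nonempty
    (f := fun z => (inner ℝ ξ z : ℝ)) (by fun_prop)
  exact ⟨y, hy, fun z hz => hmax hz⟩

lemma homExt_apply {h : S n → ℝ} {y : E n} (hy : y ≠ 0) :
    homExt h y = ‖y‖ * h ⟨‖y‖⁻¹ • y, by simp [norm_smul, hy]⟩ := by
  simp [homExt, hy]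

lemma homExt_sphere (h : S n → ℝ) (x : S n) : homExt h (x : E n) = h x := by
  rw [homExt_apply (ne_zero_of_mem_sphere x)]
  simp

lemma supportFn_eq {K : ConvexBody (E n)} {x : S n} {y : E n}
    (hy : IsSupportPoint (K : Set (E n)) x y) : supportFn K x = inner ℝ (x : E n) y :=
  IsGreatest.csSup_eq ⟨mem_image_of_mem _ hy.1, by rintro _ ⟨z, hz, rfl⟩; exact hy.2 z hz⟩

lemma homExt_supportFn {K : ConvexBody (E n)} {ξ y : E n} (hy : IsSupportPoint (K : Set (E n)) ξ y) :
    homExt (supportFn K) ξ = inner ℝ ξ y := by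
  by_cases hξ : ξ = 0
  · simp [homExt, hξ]
  · have h0 : 0 < ‖ξ‖ := norm_pos_iff.2 hξ
    rw [homExt_apply hξ, supportFn_eq (y := y) ⟨hy.1, fun z hz => ?_⟩]
    · rw [inner_smul_left]
      simp [h0.ne']
    · simp only [inner_smul_left, RCLike.conj_to_real]
      exact mul_le_mul_of_nonneg_left (hy.2 z hz) (inv_pos.2 h0).le

theorem IsKPlus2.strictlyConvex {K : ConvexBody (E n)} (hK : IsKPlus2 K) :
    StrictlyConvex (homExt (supportFn K)) := by
  choose Y hY using exists_isSupportPoint K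
  refine (strictlyConvex_of_isSupportPoint K.isCompact K.convex hK.zero_mem_interior hY
    (fun ξ => homExt_supportFn (hY ξ)) fun y hy => ?_).1
  obtain ⟨ρ, h1, h2, h3, h4⟩ := hK.boundary y hy
  refine ⟨ρ, ⟨h1, fun h => h2 ?_, h3⟩, h4⟩
  rw [gradient] at h
  exact (toDual ℝ (E n)).symm.map_eq_zero_iff.1 h

end SupportFunction

/-! ### Moment identities -/

section Moments

variable {V : Type*} [NormedAddCommGroup V] [InnerProductSpace ℝ V] [FiniteDimensional ℝ V]

lemma div_mul_self_eq {U H : V → ℝ} (hU : C2Hom1 U) (h0 : ∀ x ≠ 0, H x ≠ 0) :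
    (fun y => U y / H y * H y) = U := by
  funext y
  by_cases hy : y = 0
  · simp [hy, hU.hom.map_zero]
  · exact div_mul_cancel₀ _ (h0 y hy)

lemma C2Hom1.smul_gradient_div {U H : V → ℝ} (hU : C2Hom1 U) (hH : C2Hom1 H)
    (h0 : ∀ x ≠ 0, H x ≠ 0) {x : V} (hx : x ≠ 0) :
    H x • gradient (fun y => U y / H y) x = gradient U x - (U x / H x) • gradient H x := by
  have hZ := hU.div hH h0
  have h1 := gradient_mul (differentiableAt_of_contDiffOn hZ.contDiffOn two_ne_zero hx)
    (differentiableAt_of_contDiffOn hH.contDiffOn two_ne_zero hx)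
  rw [div_mul_self_eq hU h0] at h1
  rw [h1]
  abel

lemma C2Hom1.gradient_div_norm {U : V → ℝ} (hU : C2Hom1 U) {x : V} (hx : ‖x‖ = 1) :
    gradient (fun y => U y / ‖y‖) x = gradient U x - U x • x := by
  have hx0 := ne_zero_of_norm_eq_one hx
  have := hU.smul_gradient_div c2Hom1_norm (fun y hy => norm_ne_zero_iff.2 hy) hx0
  rw [gradient_norm hx0] at this
  simpa [hx] using this

lemma hatHess_norm {x : V} (hx : ‖x‖ = 1) : hatHess (fun y : V => ‖y‖) x = 1 := by
  rw [hatHess, hess_norm hx, sub_add_cancel]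

lemma nondeg_norm : Nondeg (fun y : V => ‖y‖) :=
  ⟨c2Hom1_norm, fun _ hx => norm_pos_iff.2 hx, fun _ hx => by rw [hatHess_norm hx]; exact isUnit_one⟩

namespace StrictlyConvex

variable {H : V → ℝ} (hH : StrictlyConvex H)
include hH

lemma ne_zero : ∀ x ≠ 0, H x ≠ 0 := fun x hx => (hH.pos x hx).ne'

lemma negL_one (hd : 2 ≤ Module.finrank ℝ V) {x : V} (hx : ‖x‖ = 1) :
    negL H (fun _ => 1) x = 0 := by
  have hd2 : (2 : ℝ) ≤ (Module.finrank ℝ V : ℝ) := by exact_mod_cast hd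
  have h1 := (hH.nondeg.hessAt hx).tr_inverse_mul
  have h2 : (Module.finrank ℝ V : ℝ) - 1 ≠ 0 := by linarith
  simp only [negL, one_mul]
  change 1 - tr (Ring.inverse (hess H x + rankOne ℝ x x) * hess H x) / _ = 0
  rw [h1, div_self h2, sub_self]

/-- The quotients of linear functions by `H` are eigenfunctions for the eigenvalue `1`. -/
lemma negL_linear (w x : V) :
    negL H (fun y => inner ℝ y w / H y) x = inner ℝ x w / H x := by
  simp only [negL]
  rw [div_mul_self_eq (c2Hom1_linear w) hH.ne_zero, hess_linear, mul_zero, tr_zero]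
  simp

lemma c2Hom0_linear (w : V) : C2Hom0 (fun y => inner ℝ y w / H y) :=
  (c2Hom1_linear w).div hH.toC2Hom1 hH.ne_zero

/-- The function `(H / ‖·‖) ^ r`, the degree-zero extension of a power of `H`. -/
lemma c1Hom0_rpow (r : ℝ) : C1Hom0 (fun y => (H y / ‖y‖) ^ r) := by
  have h := (hH.toC2Hom1.div c2Hom1_norm (fun y hy => norm_ne_zero_iff.2 hy)).c1
  refine ⟨h.contDiffOn.rpow_const_of_ne fun x hx => ?_, fun t ht x => ?_⟩
  · exact div_ne_zero (hH.ne_zero x hx) (norm_ne_zero_iff.2 hx)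
  · exact congrArg (fun u : ℝ => u ^ r) (h.hom t ht x)

lemma gradient_rpow (r : ℝ) {x : V} (hx : ‖x‖ = 1) :
    gradient (fun y => (H y / ‖y‖) ^ r) x = (r * H x ^ (r - 1)) • (gradient H x - H x • x) := by
  have hx0 := ne_zero_of_norm_eq_one hx
  have h := hH.toC2Hom1.div c2Hom1_norm (fun y hy => norm_ne_zero_iff.2 hy)
  have h1 : HasDerivAt (fun t : ℝ => t ^ r) (r * H x ^ (r - 1)) (H x / ‖x‖) := by
    rw [hx, div_one]
    exact Real.hasDerivAt_rpow_const (Or.inl (hH.ne_zero x hx0))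
  rw [gradient_comp (f := fun y => H y / ‖y‖) (g := fun t => t ^ r) h1
    (differentiableAt_of_contDiffOn h.contDiffOn two_ne_zero hx0),
    hH.gradient_div_norm hx]

variable [MeasurableSpace V] [BorelSpace V] [Nontrivial V] (μ : Measure V) [μ.IsAddHaarMeasure]

lemma integral_linear_div (hd : 2 ≤ Module.finrank ℝ V) (w : V) :
    ∫ s : sphere (0 : V) 1, coneDensity H s * (inner ℝ (s : V) w / H s) ∂μ.toSphere = 0 := by
  have hone : C1Hom0 (fun _ : V => (1 : ℝ)) := ⟨contDiffOn_const, fun _ _ _ => rfl⟩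
  have h := hH.integral_mul_negL μ hd hone (hH.c2Hom0_linear w)
  simp only [hH.negL_linear, one_mul, dirichletForm, gradient_const_fun, inner_zero_left, mul_zero,
    integral_zero] at h
  exact h

/-- The divergence theorem on the body with support function `H`, with boundary point `∇H`. -/
lemma integral_gradient_mul_linear_div (hd : 2 ≤ Module.finrank ℝ V) (v w : V) :
    ∫ s : sphere (0 : V) 1, coneDensity H s * (inner ℝ (gradient H s) v *
      (inner ℝ (s : V) w / H s)) ∂μ.toSphere =
      inner ℝ v w / Module.finrank ℝ V * ∫ s : sphere (0 : V) 1, coneDensity H s ∂μ.toSphere := by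
  have hd2 : (2 : ℝ) ≤ (Module.finrank ℝ V : ℝ) := by exact_mod_cast hd
  have hX := hH.c1Hom0_gradient v
  have h := hH.integral_mul_negL μ hd hX (hH.c2Hom0_linear w)
  simp only [hH.negL_linear] at h
  have c1 : Integrable (fun s : sphere (0 : V) 1 => coneDensity H s * (inner ℝ (gradient H s) v *
      (inner ℝ (s : V) w / H s))) μ.toSphere :=
    integrable_sphere μ (hH.continuous_coneDensity.mul (hX.continuous.mul
      (hH.c2Hom0_linear w).c1.continuous))
  have c2 := integrable_sphere μ hH.continuous_coneDensity
  have h2 : ∫ s : sphere (0 : V) 1, coneDensity H s * dirichletForm H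
      (fun y => inner ℝ (gradient H y) v) (fun y => inner ℝ y w / H y) s ∂μ.toSphere =
      ((Module.finrank ℝ V : ℝ) - 1)⁻¹ * ((∫ s : sphere (0 : V) 1, coneDensity H s ∂μ.toSphere) *
        inner ℝ v w - ∫ s : sphere (0 : V) 1, coneDensity H s * (inner ℝ (gradient H s) v *
      (inner ℝ (s : V) w / H s)) ∂μ.toSphere) := by
    rw [← integral_mul_const, ← integral_sub (c2.mul_const _) c1, ← integral_const_mul]
    refine integral_congr_ae (.of_forall fun s => ?_)
    have hs : ‖(s : V)‖ = 1 := by simp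
    have hs0 := ne_zero_of_mem_sphere s
    have hA := hH.nondeg.hessAt hs
    have hh := hH.ne_zero s hs0
    have e1 : gradient (fun y => inner ℝ y w / H y) (s : V) =
        (H s)⁻¹ • (w - (inner ℝ (s : V) w / H s : ℝ) • gradient H s) := by
      rw [eq_inv_smul_iff₀ hh, (c2Hom1_linear w).smul_gradient_div hH.toC2Hom1 hH.ne_zero hs0,
        gradient_linear]
    have e2 : inner ℝ (hess H s v) (Ring.inverse (hatHess H s)
        (gradient (fun y => inner ℝ y w / H y) (s : V))) =
        (inner ℝ (v - (inner ℝ (s : V) v : ℝ) • (s : V))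
          (gradient (fun y => inner ℝ y w / H y) (s : V)) : ℝ) := by
      have := hA.inverse_symm (hess H s v) (gradient (fun y => inner ℝ y w / H y) (s : V))
      rw [hA.inverse_apply] at this
      exact this.symm
    simp only [dirichletForm]
    rw [hH.gradient_inner_gradient v hs0, e2, e1]
    simp only [inner_smul_right, inner_sub_right, inner_sub_left, inner_smul_left,
      RCLike.conj_to_real]
    rw [real_inner_comm (gradient H s) v, real_inner_comm (gradient H s) (s : V),
      hH.inner_gradient_self hs0]
    have : (Module.finrank ℝ V : ℝ) - 1 ≠ 0 := by linarith
    field_simp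
    ring
  rw [h2] at h
  have : (Module.finrank ℝ V : ℝ) - 1 ≠ 0 := by linarith
  have : (Module.finrank ℝ V : ℝ) ≠ 0 := by linarith
  field_simp at h ⊢
  linarith

omit [MeasurableSpace V] [BorelSpace V] [Nontrivial V] in
/-- The energy density of the position vector `∇H`. -/
lemma sum_dirichletForm {ι : Type*} [Fintype ι] (e : OrthonormalBasis ι ℝ V) {x : V} (hx : ‖x‖ = 1) :
    ∑ i, dirichletForm H (fun y => inner ℝ (gradient H y) (e i))
      (fun y => inner ℝ (gradient H y) (e i)) x =
      H x / (Module.finrank ℝ V - 1) * tr (hess H x) := by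
  have hx0 := ne_zero_of_norm_eq_one hx
  have hA := hH.nondeg.hessAt hx
  simp only [dirichletForm]
  rw [← Finset.mul_sum, tr_eq_sum_inner _ e]
  congr 1
  refine Finset.sum_congr rfl fun i _ => ?_
  rw [hH.gradient_inner_gradient (e i) hx0]
  have h1 : Ring.inverse (hatHess H x) (hess H x (e i)) = e i - (inner ℝ x (e i) : ℝ) • x :=
    hA.inverse_apply (e i)
  rw [h1, inner_sub_right, inner_smul_right, real_inner_comm x, hA.inner_apply, mul_zero, sub_zero,
    real_inner_comm]

/-- Integration by parts on the round sphere, for an `L_p` Minkowski solution. -/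
lemma integral_mul_tr_hess {p : ℝ} (hp : ∀ s : sphere (0 : V) 1, coneDensity H s = H s ^ p) :
    ∫ s : sphere (0 : V) 1, coneDensity H s * (H s * tr (hess H s)) ∂μ.toSphere =
      (Module.finrank ℝ V - 1) * ∫ s : sphere (0 : V) 1, coneDensity H s * H s ^ 2 ∂μ.toSphere -
      (p + 1) * ∫ s : sphere (0 : V) 1, coneDensity H s *
        ‖gradient H s - H s • (s : V)‖ ^ 2 ∂μ.toSphere := by
  have hω := hH.continuous_coneDensity
  have c1 : Integrable (fun s : sphere (0 : V) 1 => coneDensity H s * (H s * tr (hess H s)))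
      μ.toSphere := integrable_sphere μ (hω.mul (hH.continuous.mul
        (LpMinkowski.continuous_tr.comp hH.continuous_hess)))
  have c2 : Integrable (fun s : sphere (0 : V) 1 => coneDensity H s * H s ^ 2)
      μ.toSphere := integrable_sphere μ (hω.mul (hH.continuous.pow 2))
  have c3 : Integrable (fun s : sphere (0 : V) 1 => coneDensity H s *
        ‖gradient H s - H s • (s : V)‖ ^ 2)
      μ.toSphere := integrable_sphere μ (hω.mul ((hH.continuous_gradient.sub
        (hH.continuous.smul continuous_subtype_val)).norm.pow 2))
  have c4 : Integrable (fun s : sphere (0 : V) 1 => (Module.finrank ℝ V - 1) *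
      (coneDensity H s * H s ^ 2) - (p + 1) * (coneDensity H s *
        ‖gradient H s - H s • (s : V)‖ ^ 2)) μ.toSphere := (c2.const_mul _).sub (c3.const_mul _)
  have h := green μ (hH.c1Hom0_rpow (p + 1))
    (hH.toC2Hom1.div c2Hom1_norm (fun y hy => norm_ne_zero_iff.2 hy)) nondeg_norm
  rw [← sub_eq_zero, ← integral_const_mul, ← integral_const_mul,
    ← integral_sub (c2.const_mul _) (c3.const_mul _), ← integral_sub c1 c4, ← h]
  refine integral_congr_ae (.of_forall fun s => ?_)
  have hs : ‖(s : V)‖ = 1 := by simp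
  have hs0 := ne_zero_of_mem_sphere s
  simp only [hatHess_norm hs, Ring.inverse_one, one_mul, det_one, one_apply_eq_self, hs,
    div_mul_self_eq hH.toC2Hom1 (fun y hy => norm_ne_zero_iff.2 hy), div_one, hp s,
    hH.gradient_rpow (p + 1) hs, hH.gradient_div_norm hs, inner_smul_left,
    real_inner_self_eq_norm_sq, RCLike.conj_to_real]
  rw [Real.rpow_add (hH.pos s hs0), Real.rpow_one, add_sub_cancel_right]
  ring

lemma integral_mul_linear {p : ℝ} (hp : ∀ s : sphere (0 : V) 1, coneDensity H s = H s ^ p) (w : V) :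
    (Module.finrank ℝ V - 1) *
      ∫ s : sphere (0 : V) 1, coneDensity H s * (H s * inner ℝ (s : V) w) ∂μ.toSphere =
      (p + 1) * ∫ s : sphere (0 : V) 1, coneDensity H s *
        inner ℝ (gradient H s - H s • (s : V)) w ∂μ.toSphere := by
  have hω := hH.continuous_coneDensity
  have c1 : Integrable (fun s : sphere (0 : V) 1 => coneDensity H s * (H s * inner ℝ (s : V) w))
      μ.toSphere := integrable_sphere μ (hω.mul (hH.continuous.mul
        (continuous_subtype_val.inner continuous_const)))
  have c3 : Integrable (fun s : sphere (0 : V) 1 => coneDensity H s *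
        inner ℝ (gradient H s - H s • (s : V)) w)
      μ.toSphere := integrable_sphere μ (hω.mul ((hH.continuous_gradient.sub
        (hH.continuous.smul continuous_subtype_val)).inner continuous_const))
  have h := green μ (hH.c1Hom0_rpow (p + 1))
    ((c2Hom1_linear w).div c2Hom1_norm (fun y hy => norm_ne_zero_iff.2 hy)) nondeg_norm
  rw [← sub_eq_zero, ← integral_const_mul, ← integral_const_mul,
    ← integral_sub (c1.const_mul _) (c3.const_mul _), ← neg_eq_zero, ← integral_neg, ← h]
  refine integral_congr_ae (.of_forall fun s => ?_)
  have hs : ‖(s : V)‖ = 1 := by simp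
  have hs0 := ne_zero_of_mem_sphere s
  have e1 : (inner ℝ (gradient H s - H s • (s : V)) (s : V) : ℝ) = 0 := by
    rw [inner_sub_left, hH.inner_gradient_self hs0, inner_smul_left]
    simp [hs]
  simp only [hatHess_norm hs, Ring.inverse_one, one_mul, det_one, one_apply_eq_self, hs,
    div_mul_self_eq (c2Hom1_linear w) (fun y hy => norm_ne_zero_iff.2 hy), div_one, hp s,
    hH.gradient_rpow (p + 1) hs, (c2Hom1_linear w).gradient_div_norm hs, inner_smul_left,
    RCLike.conj_to_real, gradient_linear, hess_linear, tr_zero, inner_sub_right _ w,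
    inner_smul_right, e1]
  rw [Real.rpow_add (hH.pos s hs0), Real.rpow_one, add_sub_cancel_right]
  ring

end StrictlyConvex

end Moments

/-! ### The operator in `L²(V_K)` -/

section Translation

variable {n : ℕ}

lemma isHom1_homExt (h : S n → ℝ) : IsHom1 (homExt h) := by
  intro r hr x
  by_cases hx : x = 0
  · simp [hx, homExt]
  · have hrx : r • x ≠ 0 := smul_ne_zero hr.ne' hx
    have e : ‖r • x‖⁻¹ • r • x = ‖x‖⁻¹ • x := by
      rw [norm_smul, Real.norm_eq_abs, abs_of_pos hr, smul_smul]
      congr 1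
      field_simp
    rw [homExt_apply hrx, homExt_apply hx]
    simp only [e]
    have hn : ‖r • x‖ = r * ‖x‖ := by rw [norm_smul, Real.norm_eq_abs, abs_of_pos hr]
    exact (congrArg (fun t => t * _) hn).trans (mul_assoc _ _ _)

lemma IsC2.c2Hom1 {h : S n → ℝ} (hh : IsC2 h) : C2Hom1 (homExt h) := ⟨hh, isHom1_homExt h⟩

lemma homExt_restrict {U : E n → ℝ} (hU : IsHom1 U) : homExt (fun s : S n => U s) = U := by
  funext y
  by_cases hy : y = 0
  · simp [hy, homExt, hU.map_zero]
  · rw [homExt_apply hy, hU.eq_norm_mul hy]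

lemma homExt_mul (z h : S n → ℝ) :
    homExt (fun u => z u * h u) = fun y => homExt z y / ‖y‖ * homExt h y := by
  funext y
  by_cases hy : y = 0
  · simp [hy, homExt]
  · have := norm_ne_zero_iff.2 hy
    rw [homExt_apply hy, homExt_apply hy, homExt_apply hy]
    field_simp

lemma coe_D2 {h : S n → ℝ} (hh : C2Hom1 (homExt h)) (x : S n) (v : tangent x) :
    (D2 h x v : E n) = hess (homExt h) x v := by
  have hx0 := ne_zero_of_mem_sphere x
  have hmem : hess (homExt h) (x : E n) v ∈ tangent x := by
    rw [Submodule.mem_orthogonal_singleton_iff_inner_right, ← inner_hess_symm hh.contDiffOn hx0,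
      hh.hess_self hx0, inner_zero_left]
  exact Submodule.starProjection_eq_self_iff.2 hmem

lemma inner_tangent (x : S n) (v : tangent x) : inner ℝ (x : E n) (v : E n) = (0 : ℝ) :=
  Submodule.mem_orthogonal_singleton_iff_inner_right.1 v.2

lemma det_D2 {h : S n → ℝ} (hh : C2Hom1 (homExt h)) (x : S n) :
    LinearMap.det (D2 h x) = (hatHess (homExt h) x).det := by
  refine det_eq_det_of_block _ ?_ _ fun v => ?_
  · simp [hatHess, hh.hess_self (ne_zero_of_mem_sphere x)]
  · rw [coe_D2 hh]
    simp [hatHess, inner_tangent]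

lemma trace_D2 {h u : S n → ℝ} (hh : Nondeg (homExt h)) (hu : C2Hom1 (homExt u)) (x : S n) :
    LinearMap.trace ℝ (tangent x) (Ring.inverse (D2 h x) * D2 u x) =
      tr (Ring.inverse (hatHess (homExt h) x) * hess (homExt u) x) := by
  have hx : ‖(x : E n)‖ = 1 := by simp
  have hA := hh.hessAt hx
  have hunit : IsUnit (D2 h x) := by
    rw [LinearMap.isUnit_iff_isUnit_det, det_D2 hh.toC2Hom1]
    exact ((isUnit_iff_det_ne_zero _).1 (hh.isUnit _ hx)).isUnit
  refine trace_eq_tr_of_block _ ?_ _ fun v => ?_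
  · rw [clm_mul_apply, hu.hess_self (ne_zero_of_mem_sphere x), map_zero]
  · set w := (Ring.inverse (D2 h x) * D2 u x) v with hw
    have h1 : D2 h x w = D2 u x v := by
      rw [hw, Module.End.mul_apply, ← Module.End.mul_apply, Ring.mul_inverse_cancel _ hunit]
      rfl
    have h2 := congrArg (fun t : tangent x => (t : E n)) h1
    simp only [coe_D2 hh.toC2Hom1, coe_D2 hu] at h2
    rw [clm_mul_apply, ← h2]
    have h3 : Ring.inverse (hatHess (homExt h) x) (hess (homExt h) x w) = _ :=
      hA.inverse_apply (w : E n)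
    rw [h3, inner_tangent, zero_smul, sub_zero]

variable {K : ConvexBody (E n)}

lemma neg_hbmOperator (hK : IsKPlus2 K) {z : S n → ℝ} (hz : IsC2 z) (x : S n) :
    -hbmOperator K z x = negL (homExt (supportFn K)) (fun y => homExt z y / ‖y‖) x := by
  have hH := hK.strictlyConvex
  have hZ := hz.c2Hom1.div c2Hom1_norm (fun y hy => norm_ne_zero_iff.2 hy)
  have hU := hZ.mul hH.toC2Hom1
  rw [← homExt_mul] at hU
  simp only [hbmOperator, negL]
  rw [trace_D2 hH.nondeg hU, homExt_mul, homExt_sphere, finrank_euclideanSpace_fin]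
  simp
  ring

lemma coneVolume_eq (hK : IsKPlus2 K) : coneVolume K = (n : ENNReal)⁻¹ •
    (volume : Measure (E n)).toSphere.withDensity
      fun x => ENNReal.ofReal (coneDensity (homExt (supportFn K)) x) := by
  rw [coneVolume, lpSurfaceArea, sphereMeasure]
  congr 2
  funext x
  rw [sub_zero, Real.rpow_one, coneDensity, det_D2 hK.strictlyConvex.toC2Hom1, homExt_sphere]

lemma integral_coneVolume (hK : IsKPlus2 K) (f : S n → ℝ) :
    ∫ x, f x ∂coneVolume K = (n : ℝ)⁻¹ * ∫ x : S n, coneDensity (homExt (supportFn K)) x * f x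
      ∂(volume : Measure (E n)).toSphere := by
  have hH := hK.strictlyConvex
  rw [coneVolume_eq hK, integral_smul_measure, integral_withDensity_eq_integral_toReal_smul₀]
  · simp only [ENNReal.toReal_inv, ENNReal.toReal_natCast, smul_eq_mul]
    congr 1
    refine integral_congr_ae (.of_forall fun x => ?_)
    simp only
    rw [ENNReal.toReal_ofReal (hH.coneDensity_pos (by simp)).le]
  · exact hH.continuous_coneDensity.measurable.ennreal_ofReal.aemeasurable
  · exact .of_forall fun x => ENNReal.ofReal_lt_top

lemma isFiniteMeasure_coneVolume (hK : IsKPlus2 K) (hn : n ≠ 0) [Nontrivial (E n)] :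
    IsFiniteMeasure (coneVolume K) := by
  have hH := hK.strictlyConvex
  have hi := integrable_sphere (volume : Measure (E n)) hH.continuous_coneDensity
  have : IsFiniteMeasure ((volume : Measure (E n)).toSphere.withDensity
      fun x => ENNReal.ofReal (coneDensity (homExt (supportFn K)) x)) :=
    isFiniteMeasure_withDensity_ofReal hi.2
  rw [coneVolume_eq hK]
  refine ⟨?_⟩
  rw [Measure.smul_apply, smul_eq_mul]
  exact ENNReal.mul_lt_top (ENNReal.inv_lt_top.2 (by exact_mod_cast Nat.pos_of_ne_zero hn))
    (measure_lt_top _ _)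

end Translation

section Hilbert

variable {n : ℕ} {K : ConvexBody (E n)}

/-- The class in `L²(V_K)` of a continuous function. -/
noncomputable def toL2 (K : ConvexBody (E n)) [IsFiniteMeasure (coneVolume K)] :
    C(S n, ℝ) →L[ℝ] L2 K := ContinuousMap.toLp 2 (coneVolume K) ℝ

/-- The restriction of a 0-homogeneous function to the sphere. -/
def C1Hom0.toC {f : E n → ℝ} (hf : C1Hom0 f) : C(S n, ℝ) := ⟨fun s => f s, hf.continuous⟩

/-- `-L Z` on the sphere. -/
noncomputable def negLC (hK : IsKPlus2 K) {Z : E n → ℝ} (hZ : C2Hom0 Z) : C(S n, ℝ) :=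
  ⟨fun s => negL (homExt (supportFn K)) Z s, hK.strictlyConvex.continuous_negL hZ⟩

variable [IsFiniteMeasure (coneVolume K)]

lemma inner_toL2 (hK : IsKPlus2 K) (f g : C(S n, ℝ)) : inner ℝ (toL2 K f) (toL2 K g) =
    (n : ℝ)⁻¹ * ∫ x : S n, coneDensity (homExt (supportFn K)) x * (f x * g x)
      ∂(volume : Measure (E n)).toSphere := by
  rw [← integral_coneVolume hK, toL2, ContinuousMap.inner_toLp]
  refine integral_congr_ae (.of_forall fun x => ?_)
  simp [mul_comm]

lemma eq_toL2 {f : L2 K} {g : C(S n, ℝ)} (h : f =ᵐ[coneVolume K] g) : f = toL2 K g :=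
  Lp.ext (h.trans (ContinuousMap.coeFn_toLp _ g).symm)

lemma mem_graphC2 (hK : IsKPlus2 K) (a : L2 K × L2 K) : a ∈ graphC2 K ↔
    ∃ (Z : E n → ℝ) (hZ : C2Hom0 Z), a = (toL2 K hZ.c1.toC, toL2 K (negLC hK hZ)) := by
  constructor
  · rintro ⟨z, hz, h1, h2⟩
    have hZ := hz.c2Hom1.div c2Hom1_norm (fun y hy => norm_ne_zero_iff.2 hy)
    refine ⟨_, hZ, Prod.ext (eq_toL2 (h1.trans (.of_forall fun x => ?_)))
      (eq_toL2 (h2.trans (.of_forall fun x => ?_)))⟩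
    · simp [C1Hom0.toC, homExt_sphere]
    · exact neg_hbmOperator hK hz x
  · rintro ⟨Z, hZ, rfl⟩
    have hU : C2Hom1 (fun y => Z y * ‖y‖) := hZ.mul c2Hom1_norm
    have hz : homExt (fun s : S n => Z s) = fun y => Z y * ‖y‖ := by
      rw [← homExt_restrict hU.hom]
      congr 1
      funext s
      simp
    have hC2 : IsC2 (fun s : S n => Z s) := by
      rw [IsC2, hz]; exact hU.contDiffOn
    refine ⟨fun s => Z s, hC2, ContinuousMap.coeFn_toLp _ _, ?_⟩
    refine (ContinuousMap.coeFn_toLp _ _).trans (.of_forall fun x => ?_)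
    change _ = -hbmOperator K (fun s => Z s) x
    rw [neg_hbmOperator hK hC2, hz]
    have h2 : (fun y => Z y * ‖y‖ / ‖y‖ * homExt (supportFn K) y) =
        fun y => Z y * homExt (supportFn K) y := by
      funext y
      by_cases hy : y = 0
      · simp [hy, (isHom1_homExt (supportFn K)).map_zero]
      · rw [mul_div_cancel_right₀ _ (norm_ne_zero_iff.2 hy)]
    simp only [negLC, negL, ContinuousMap.coe_mk, h2]
    simp

lemma negL_add {H Z W : E n → ℝ} (hH : C2Hom1 H) (hZ : C2Hom0 Z) (hW : C2Hom0 W) (c : ℝ) {x : E n}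
    (hx : x ≠ 0) : negL H (fun y => Z y + c * W y) x = negL H Z x + c * negL H W x := by
  have e : (fun y => (Z y + c * W y) * H y) = fun y => Z y * H y + c * (W y * H y) := by
    funext y; ring
  simp only [negL]
  rw [e, hess_add (hZ.mul hH).contDiffOn ((hW.mul hH).const_mul c).contDiffOn hx,
    hess_const_mul (hW.mul hH).contDiffOn c hx, mul_add, tr_add, mul_smul_comm, tr_smul]
  ring

lemma C2Hom0.add_const_mul {Z W : E n → ℝ} (hZ : C2Hom0 Z) (hW : C2Hom0 W) (c : ℝ) :
    C2Hom0 (fun y => Z y + c * W y) :=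
  ⟨hZ.contDiffOn.add (contDiffOn_const.mul hW.contDiffOn), fun r hr x => by
    simp only [hZ.hom r hr, hW.hom r hr]⟩

lemma c2Hom0_const (c : ℝ) : C2Hom0 (fun _ : E n => c) := ⟨contDiffOn_const, fun _ _ _ => rfl⟩

lemma add_smul_mem_graphC2 (hK : IsKPlus2 K) {a b : L2 K × L2 K} (ha : a ∈ graphC2 K)
    (hb : b ∈ graphC2 K) (c : ℝ) : a + c • b ∈ graphC2 K := by
  obtain ⟨Z, hZ, rfl⟩ := (mem_graphC2 hK a).1 ha
  obtain ⟨W, hW, rfl⟩ := (mem_graphC2 hK b).1 hb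
  refine (mem_graphC2 hK _).2 ⟨_, hZ.add_const_mul hW c, ?_⟩
  simp only [Prod.smul_mk, Prod.mk_add_mk, ← map_smul, ← map_add]
  congr 2
  ext s
  exact (negL_add hK.strictlyConvex.toC2Hom1 hZ hW c (ne_zero_of_mem_sphere s)).symm

lemma zero_mem_graphC2 (hK : IsKPlus2 K) : 0 ∈ graphC2 K := by
  have h := (mem_graphC2 hK _).2 ⟨_, c2Hom0_const (n := n) 0, rfl⟩
  have := add_smul_mem_graphC2 hK h h (-1)
  change ((0, 0) : L2 K × L2 K) ∈ graphC2 K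
  simpa using this

lemma coe_graphSA (hK : IsKPlus2 K) : (graphSA K : Set (L2 K × L2 K)) = closure (graphC2 K) := by
  let C : Submodule ℝ (L2 K × L2 K) :=
    { carrier := graphC2 K
      add_mem' := fun {a b} ha hb => by simpa using add_smul_mem_graphC2 hK ha hb 1
      zero_mem' := zero_mem_graphC2 hK
      smul_mem' := fun c a ha => by
        simpa using add_smul_mem_graphC2 hK (zero_mem_graphC2 hK) ha c }
  have : Submodule.span ℝ (graphC2 K) = C := Submodule.span_eq C
  rw [graphSA, this]
  rfl

lemma graphSA_induction (hK : IsKPlus2 K) {P : L2 K × L2 K → Prop} (hP : IsClosed {a | P a})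
    (h : ∀ (Z : E n → ℝ) (hZ : C2Hom0 Z), P (toL2 K hZ.c1.toC, toL2 K (negLC hK hZ))) :
    ∀ a ∈ graphSA K, P a := by
  intro a ha
  have ha' : a ∈ closure (graphC2 K) := by rw [← coe_graphSA hK]; exact ha
  have hsub : graphC2 K ⊆ {a | P a} := by
    intro b hb
    obtain ⟨Z, hZ, rfl⟩ := (mem_graphC2 hK b).1 hb
    exact h Z hZ
  exact closure_minimal hsub hP ha'

lemma mem_graphSA (hK : IsKPlus2 K) {Z : E n → ℝ} (hZ : C2Hom0 Z) :
    (toL2 K hZ.c1.toC, toL2 K (negLC hK hZ)) ∈ graphSA K := by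
  have : _ ∈ closure (graphC2 K) := subset_closure ((mem_graphC2 hK _).2 ⟨Z, hZ, rfl⟩)
  rw [← coe_graphSA hK] at this
  exact this

end Hilbert

/-! ### The closure of `-L` -/

section Closure

variable {n : ℕ} {K : ConvexBody (E n)} [Nontrivial (E n)] [IsFiniteMeasure (coneVolume K)]

lemma norm_sq_toL2 (hK : IsKPlus2 K) (f : C(S n, ℝ)) : ‖toL2 K f‖ ^ 2 =
    (n : ℝ)⁻¹ * ∫ x : S n, coneDensity (homExt (supportFn K)) x * f x ^ 2
      ∂(volume : Measure (E n)).toSphere := by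
  rw [← real_inner_self_eq_norm_sq, inner_toL2 hK]
  simp only [pow_two]

lemma eq_zero_of_integral_nonpos {f : S n → ℝ} (hf : Continuous f) (h0 : ∀ x, 0 ≤ f x)
    (h : ∫ x, f x ∂(volume : Measure (E n)).toSphere ≤ 0) (x : S n) : f x = 0 := by
  have h1 := (integral_eq_zero_iff_of_nonneg h0 (integrable_sphere _ hf)).1
    (le_antisymm h (integral_nonneg h0))
  exact congrFun ((Continuous.ae_eq_iff_eq _ hf continuous_const).1 h1) x

lemma eq_zero_of_toL2_eq_zero (hK : IsKPlus2 K) (hn : n ≠ 0) {f : C(S n, ℝ)} (h : toL2 K f = 0)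
    (x : S n) : f x = 0 := by
  have hn' : (0 : ℝ) < (n : ℝ)⁻¹ := inv_pos.2 (by exact_mod_cast Nat.pos_of_ne_zero hn)
  have hH := hK.strictlyConvex
  have h1 := norm_sq_toL2 hK f
  rw [h, norm_zero, zero_pow two_ne_zero] at h1
  have h2 : ∫ x : S n, coneDensity (homExt (supportFn K)) x * f x ^ 2
      ∂(volume : Measure (E n)).toSphere = 0 :=
    (mul_eq_zero.1 h1.symm).resolve_left hn'.ne'
  have h3 := eq_zero_of_integral_nonpos (hH.continuous_coneDensity.mul (f.continuous.pow 2))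
    (fun x => mul_nonneg (hH.coneDensity_pos (by simp)).le (sq_nonneg _)) h2.le x
  exact pow_eq_zero_iff two_ne_zero |>.1
    ((mul_eq_zero.1 h3).resolve_left (hH.coneDensity_pos (by simp)).ne')

lemma isSymmRel_graphSA (hK : IsKPlus2 K) (hn : 3 ≤ n) : IsSymmRel (graphSA K) := by
  have hH := hK.strictlyConvex
  have hd : 2 ≤ Module.finrank ℝ (E n) := by rw [finrank_euclideanSpace_fin]; omega
  intro a ha b hb
  revert b
  refine graphSA_induction hK (isClosed_eq (by fun_prop) (by fun_prop)) fun W hW => ?_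
  revert a
  refine graphSA_induction hK (isClosed_eq (by fun_prop) (by fun_prop)) fun Z hZ => ?_
  rw [inner_toL2 hK, inner_toL2 hK]
  congr 1
  have h1 := hH.integral_mul_negL volume hd hW.c1 hZ
  have h2 := hH.integral_mul_negL volume hd hZ.c1 hW
  simp only [C1Hom0.toC, negLC, ContinuousMap.coe_mk]
  simp only [mul_comm (negL _ Z _)]
  rw [h1, h2]
  exact integral_congr_ae (.of_forall fun s => by
    simp only [hH.dirichletForm_symm W Z (show ‖(s : E n)‖ = 1 by simp)])

/-- The Dirichlet energy of a `C¹` function. -/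
noncomputable def energy (K : ConvexBody (E n)) (f : E n → ℝ) : ℝ :=
  (n : ℝ)⁻¹ * ∫ s : S n, coneDensity (homExt (supportFn K)) s *
    dirichletForm (homExt (supportFn K)) f f s ∂(volume : Measure (E n)).toSphere

lemma two_mul_inner_sub_le_energy (hK : IsKPlus2 K) (hn : 3 ≤ n) {f : E n → ℝ} (hf : C1Hom0 f) :
    ∀ a ∈ graphSA K, 2 * inner ℝ (toL2 K hf.toC) a.2 - inner ℝ a.1 a.2 ≤ energy K f := by
  have hH := hK.strictlyConvex
  have hd : 2 ≤ Module.finrank ℝ (E n) := by rw [finrank_euclideanSpace_fin]; omega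
  refine graphSA_induction hK (isClosed_le (by fun_prop) (by fun_prop)) fun Z hZ => ?_
  have h := mul_le_mul_of_nonneg_left (hH.two_mul_integral_sub_le volume hd hf hZ)
    (show 0 ≤ (n : ℝ)⁻¹ by positivity)
  rw [inner_toL2 hK, inner_toL2 hK]
  simp only [C1Hom0.toC, negLC, ContinuousMap.coe_mk, energy]
  linarith

lemma inner_nonneg_of_mem (hK : IsKPlus2 K) (hn : 3 ≤ n) :
    ∀ a ∈ graphSA K, 0 ≤ (inner ℝ a.1 a.2 : ℝ) := by
  intro a ha
  have h1 := two_mul_inner_sub_le_energy hK hn (c2Hom0_const (n := n) 0).c1 a ha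
  have h2 : toL2 K (c2Hom0_const (n := n) 0).c1.toC = 0 := map_zero (toL2 K)
  have h3 : energy K (fun _ => (0 : ℝ)) = 0 := by
    simp [energy, dirichletForm, gradient_const_fun]
  rw [h2, h3, inner_zero_left] at h1
  linarith

lemma inner_le_norm_sq_of_mem (hK : IsKPlus2 K) (hn : 3 ≤ n) :
    ∀ a ∈ graphSA K, inner ℝ a.1 a.2 ≤ ‖a.2‖ ^ 2 := by
  have hd : 3 ≤ Module.finrank ℝ (E n) := by rwa [finrank_euclideanSpace_fin]
  refine graphSA_induction hK (isClosed_le (by fun_prop) (by fun_prop)) fun Z hZ => ?_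
  rw [inner_toL2 hK, norm_sq_toL2 hK]
  exact mul_le_mul_of_nonneg_left (hK.strictlyConvex.integral_mul_negL_le volume hd hZ)
    (by positivity)

/-- The constant function `1` in `L²(V_K)`. -/
noncomputable def oneL2 (K : ConvexBody (E n)) [IsFiniteMeasure (coneVolume K)] : L2 K :=
  toL2 K (c2Hom0_const (n := n) 1).c1.toC

/-- The functions `⟨x, w⟩ / h_K (x)` in `L²(V_K)`, eigenfunctions of `-L` for the eigenvalue `1`. -/
noncomputable def linL2 (hK : IsKPlus2 K) : E n →ₗ[ℝ] L2 K where
  toFun w := toL2 K (hK.strictlyConvex.c2Hom0_linear w).c1.toC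
  map_add' v w := by
    rw [← map_add]
    congr 1
    ext s
    simp [C1Hom0.toC, inner_add_right, add_div]
  map_smul' c w := by
    rw [RingHom.id_apply, ← map_smul]
    congr 1
    ext s
    simp [C1Hom0.toC, inner_smul_right, mul_div_assoc]

lemma oneL2_mem (hK : IsKPlus2 K) (hn : 3 ≤ n) : (oneL2 K, (0 : L2 K)) ∈ graphSA K := by
  have hd : 2 ≤ Module.finrank ℝ (E n) := by rw [finrank_euclideanSpace_fin]; omega
  have h := mem_graphSA hK (c2Hom0_const (n := n) 1)
  have h2 : negLC hK (c2Hom0_const (n := n) 1) = 0 := by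
    ext s
    exact hK.strictlyConvex.negL_one hd (by simp)
  rwa [h2, map_zero] at h

lemma linL2_mem (hK : IsKPlus2 K) (w : E n) : (linL2 hK w, linL2 hK w) ∈ graphSA K := by
  have h := mem_graphSA hK (hK.strictlyConvex.c2Hom0_linear w)
  have h2 : negLC hK (hK.strictlyConvex.c2Hom0_linear w) =
      (hK.strictlyConvex.c2Hom0_linear w).c1.toC := by
    ext s
    exact hK.strictlyConvex.negL_linear w s
  rwa [h2] at h

lemma mem_of_forall_infDist {F : Type*} [NormedAddCommGroup F] [InnerProductSpace ℝ F]
    (W : Submodule ℝ F) [FiniteDimensional ℝ W] {k : F} (h : infDist k (W : Set F) ^ 2 ≤ 0) :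
    k ∈ W := by
  have h1 : infDist k (W : Set F) = 0 :=
    pow_eq_zero_iff two_ne_zero |>.1 (le_antisymm h (sq_nonneg _))
  exact (W.closed_of_finiteDimensional.mem_iff_infDist_zero ⟨0, W.zero_mem⟩).2 h1

lemma infDist_sq_le {F : Type*} [NormedAddCommGroup F] {W : Set F} {x y : F} (hy : y ∈ W) {c : ℝ}
    (h : ‖x - y‖ ^ 2 ≤ c) : infDist x W ^ 2 ≤ c :=
  (pow_le_pow_left₀ infDist_nonneg (infDist_le_dist_of_mem hy) 2).trans (by rwa [dist_eq_norm])

/-- The kernel of the closure of `-L` consists of the constants. -/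
lemma exists_eq_smul_oneL2 (hK : IsKPlus2 K) (hn : 3 ≤ n) {k : L2 K} (hk : (k, 0) ∈ graphSA K) :
    ∃ m : ℝ, k = m • oneL2 K := by
  have hd : 3 ≤ Module.finrank ℝ (E n) := by rwa [finrank_euclideanSpace_fin]
  obtain ⟨C, hC, h⟩ := hK.strictlyConvex.exists_integral_sub_const_le volume hd
  let W : Submodule ℝ (L2 K) := Submodule.span ℝ {oneL2 K}
  have key : ∀ a ∈ graphSA K, infDist a.1 (W : Set (L2 K)) ^ 2 ≤ C * inner ℝ a.1 a.2 := by
    refine graphSA_induction hK (isClosed_le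
      (((continuous_infDist_pt _).comp continuous_fst).pow 2) (by fun_prop)) fun Z hZ => ?_
    obtain ⟨m, hm⟩ := h Z hZ
    refine infDist_sq_le (Submodule.mem_span_singleton.2 ⟨m, rfl⟩) ?_
    rw [oneL2, ← map_smul, ← map_sub, norm_sq_toL2 hK, inner_toL2 hK, mul_left_comm]
    refine mul_le_mul_of_nonneg_left ?_ (by positivity)
    simpa [C1Hom0.toC, negLC] using hm
  have h1 := key _ hk
  rw [inner_zero_right, mul_zero] at h1
  obtain ⟨m, hm⟩ := Submodule.mem_span_singleton.1 (mem_of_forall_infDist W h1)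
  exact ⟨m, hm.symm⟩

/-- The eigenspace of the closure of `-L` for the eigenvalue `1` consists of the functions
`⟨x, w⟩ / h_K (x)`. -/
lemma exists_eq_linL2 (hK : IsKPlus2 K) (hn : 3 ≤ n) {k : L2 K} (hk : (k, k) ∈ graphSA K) :
    ∃ w, k = linL2 hK w := by
  have hd : 3 ≤ Module.finrank ℝ (E n) := by rwa [finrank_euclideanSpace_fin]
  obtain ⟨C, hC, h⟩ := hK.strictlyConvex.exists_integral_sub_linear_le volume hd
  let W : Submodule ℝ (L2 K) := LinearMap.range (linL2 hK)
  have key : ∀ a ∈ graphSA K, infDist a.1 (W : Set (L2 K)) ^ 2 ≤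
      C * inner ℝ (a.1 - a.2) (a.1 - ((n : ℝ) - 1) • a.2) := by
    refine graphSA_induction hK (isClosed_le
      (((continuous_infDist_pt _).comp continuous_fst).pow 2) (by fun_prop)) fun Z hZ => ?_
    obtain ⟨v, hv⟩ := h Z hZ
    refine infDist_sq_le (LinearMap.mem_range_self (linL2 hK) v) ?_
    simp only [linL2, LinearMap.coe_mk, AddHom.coe_mk]
    rw [← map_sub, ← map_sub, ← map_smul, ← map_sub, norm_sq_toL2 hK, inner_toL2 hK, mul_left_comm]
    refine mul_le_mul_of_nonneg_left ?_ (by positivity)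
    simpa [C1Hom0.toC, negLC] using hv
  have h1 := key _ hk
  rw [sub_self, inner_zero_left, mul_zero] at h1
  obtain ⟨w, hw⟩ := mem_of_forall_infDist W h1
  exact ⟨w, hw.symm⟩

lemma oneL2_ne_zero (hK : IsKPlus2 K) (hn : 3 ≤ n) : oneL2 K ≠ 0 := by
  intro h
  obtain ⟨x, hx⟩ := exists_ne (0 : E n)
  have := eq_zero_of_toL2_eq_zero hK (by omega) h
    (⟨‖x‖⁻¹ • x, by simpa using norm_inv_norm_smul hx⟩ : S n)
  exact one_ne_zero this

lemma linL2_ne_zero (hK : IsKPlus2 K) (hn : 3 ≤ n) {w : E n} (hw : w ≠ 0) : linL2 hK w ≠ 0 := by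
  intro h
  have hmem : ‖w‖⁻¹ • w ∈ sphere (0 : E n) 1 := by simpa using norm_inv_norm_smul hw
  have h1 := eq_zero_of_toL2_eq_zero hK (by omega) h (⟨‖w‖⁻¹ • w, hmem⟩ : S n)
  simp only [C1Hom0.toC, ContinuousMap.coe_mk, inner_smul_left, real_inner_self_eq_norm_sq,
    RCLike.conj_to_real] at h1
  have h2 := hK.strictlyConvex.pos _ (ne_zero_of_mem_sphere (⟨‖w‖⁻¹ • w, hmem⟩ : S n))
  have h3 := norm_pos_iff.2 hw
  have h4 : 0 < ‖w‖⁻¹ * ‖w‖ ^ 2 / homExt (supportFn K) (‖w‖⁻¹ • w) := div_pos (by positivity) h2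
  exact h4.ne' h1

/-- The bound for the second eigenvalue as an inequality for the inverse of `-L`, on the orthogonal
complement of the first two eigenspaces. -/
lemma exists_inverse_le (hK : IsKPlus2 K) (hn : 3 ≤ n) {c : ℝ} (hc : 1 < c)
    (hspec : c ≤ hbmEigenvalue K 2) {y : L2 K} (hy0 : inner ℝ y (oneL2 K) = (0 : ℝ))
    (hy1 : ∀ w, inner ℝ y (linL2 hK w) = (0 : ℝ)) :
    ∃ z, (z, y) ∈ graphSA K ∧ c * inner ℝ y z ≤ ‖y‖ ^ 2 := by
  have h0 : (0 : ℝ) ∈ graphSpectrum (graphSA K) := by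
    intro h
    refine oneL2_ne_zero hK hn ((h 0).unique ?_ ?_)
    · rw [zero_smul, add_zero]; exact oneL2_mem hK hn
    · rw [zero_smul, add_zero]; exact (graphSA K).zero_mem
  have h1 : (1 : ℝ) ∈ graphSpectrum (graphSA K) := by
    intro h
    obtain ⟨w, hw⟩ := exists_ne (0 : E n)
    refine linL2_ne_zero hK hn hw ((h 0).unique ?_ ?_)
    · rw [one_smul, zero_add]; exact linL2_mem hK w
    · rw [one_smul, zero_add]; exact (graphSA K).zero_mem
  refine exists_preimage_of_gap (isSymmRel_graphSA hK hn) (inner_nonneg_of_mem hK hn)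
    (inner_le_norm_sq_of_mem hK hn) hc (fun r hr => notMem_of_le_increasingEnum h0 h1 hspec hr) ?_ ?_
  · intro k hk
    obtain ⟨m, rfl⟩ := exists_eq_smul_oneL2 hK hn hk
    rw [inner_smul_right, hy0, mul_zero]
  · intro k hk
    obtain ⟨w, rfl⟩ := exists_eq_linL2 hK hn hk
    exact hy1 w

end Closure

/-! ### The spectral inequality applied to the position vector -/

section Position

variable {n : ℕ} {K : ConvexBody (E n)}

lemma coneDensity_eq_rpow (hK : IsKPlus2 K) {p : ℝ} (hsol : SolvesIsotropicLp K p) (s : S n) :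
    coneDensity (homExt (supportFn K)) s = homExt (supportFn K) s ^ p := by
  have hH := hK.strictlyConvex
  have hpos := hH.pos s (ne_zero_of_mem_sphere s)
  have h := hsol s
  rw [det_D2 hH.toC2Hom1, ← homExt_sphere (supportFn K)] at h
  have h1 : homExt (supportFn K) s ^ p * homExt (supportFn K) s ^ (1 - p) =
      homExt (supportFn K) s := by
    rw [← Real.rpow_add hpos, add_sub_cancel, Real.rpow_one]
  calc coneDensity (homExt (supportFn K)) s
      = homExt (supportFn K) s ^ p * (homExt (supportFn K) s ^ (1 - p) *
          (hatHess (homExt (supportFn K)) s).det) := by rw [← mul_assoc, h1, coneDensity]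
    _ = _ := by rw [h, mul_one]

lemma integral_lpSurfaceArea_two (hK : IsKPlus2 K) (f : S n → ℝ) :
    ∫ x, f x ∂lpSurfaceArea K 2 = ∫ x : S n, coneDensity (homExt (supportFn K)) x *
      (f x / homExt (supportFn K) x ^ 2) ∂(volume : Measure (E n)).toSphere := by
  have hH := hK.strictlyConvex
  have e : ∀ x : S n, supportFn K x ^ ((1 : ℝ) - 2) * LinearMap.det (D2 (supportFn K) x) =
      coneDensity (homExt (supportFn K)) x / homExt (supportFn K) x ^ 2 := by
    intro x
    have hpos := hH.pos x (ne_zero_of_mem_sphere x)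
    rw [det_D2 hH.toC2Hom1, ← homExt_sphere (supportFn K), coneDensity, show (1 : ℝ) - 2 = -1 by norm_num,
      Real.rpow_neg_one]
    field_simp
  have hc : Continuous fun x : S n =>
      coneDensity (homExt (supportFn K)) x / homExt (supportFn K) x ^ 2 :=
    hH.continuous_coneDensity.div (hH.continuous.pow 2)
      fun x => pow_ne_zero 2 (hH.ne_zero x (ne_zero_of_mem_sphere x))
  rw [lpSurfaceArea, sphereMeasure]
  simp only [e]
  rw [integral_withDensity_eq_integral_toReal_smul₀]
  · refine integral_congr_ae (.of_forall fun x => ?_)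
    have h1 := (hH.coneDensity_pos (x := (x : E n)) (by simp)).le
    simp only
    rw [ENNReal.toReal_ofReal (by positivity), smul_eq_mul]
    ring
  · exact hc.measurable.ennreal_ofReal.aemeasurable
  · exact .of_forall fun x => ENNReal.ofReal_lt_top

variable [Nontrivial (E n)] [IsFiniteMeasure (coneVolume K)]

/-- The total mass of `S₂ K`, divided by `n ^ 2`. When `K` is `S₂`-isotropic, this is the common
squared norm in `L²(V_K)` of the functions `⟨x, w⟩ / h_K (x)` with `w` a unit vector. -/
noncomputable def isoConst (K : ConvexBody (E n)) : ℝ :=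
  (n : ℝ)⁻¹ * ((n : ℝ)⁻¹ * ∫ x : S n, coneDensity (homExt (supportFn K)) x *
      (1 / homExt (supportFn K) x ^ 2) ∂(volume : Measure (E n)).toSphere)

lemma norm_sq_linL2 (hK : IsKPlus2 K) (hiso : IsS2Isotropic K) (w : E n) :
    ‖linL2 hK w‖ ^ 2 = isoConst K * ‖w‖ ^ 2 := by
  have h := hiso w
  have h1 : (lpSurfaceArea K 2).real univ = ∫ _, (1 : ℝ) ∂lpSurfaceArea K 2 := by
    rw [integral_const, smul_eq_mul, mul_one]
  rw [h1, integral_lpSurfaceArea_two hK, integral_lpSurfaceArea_two hK] at h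
  change ‖toL2 K _‖ ^ 2 = _
  rw [norm_sq_toL2 hK]
  simp only [C1Hom0.toC, ContinuousMap.coe_mk, div_pow]
  rw [h, isoConst]
  ring

lemma inner_linL2 (hK : IsKPlus2 K) (hiso : IsS2Isotropic K) (v w : E n) :
    inner ℝ (linL2 hK v) (linL2 hK w) = isoConst K * inner ℝ v w := by
  have h := norm_sq_linL2 hK hiso (v + w)
  rw [map_add, norm_add_sq_real, norm_add_sq_real, norm_sq_linL2 hK hiso,
    norm_sq_linL2 hK hiso] at h
  linarith

lemma isoConst_pos (hK : IsKPlus2 K) (hn : 3 ≤ n) (hiso : IsS2Isotropic K) : 0 < isoConst K := by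
  obtain ⟨w, hw⟩ := exists_ne (0 : E n)
  have h1 := norm_sq_linL2 hK hiso w
  have h2 : 0 < ‖linL2 hK w‖ ^ 2 := pow_pos (norm_pos_iff.2 (linL2_ne_zero hK hn hw)) 2
  rw [h1] at h2
  exact pos_of_mul_pos_left h2 (sq_nonneg _)

lemma inner_oneL2_linL2 (hK : IsKPlus2 K) (hn : 3 ≤ n) (w : E n) :
    inner ℝ (oneL2 K) (linL2 hK w) = (0 : ℝ) := by
  have hd : 2 ≤ Module.finrank ℝ (E n) := by rw [finrank_euclideanSpace_fin]; omega
  have h := hK.strictlyConvex.integral_linear_div volume hd w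
  change inner ℝ (toL2 K _) (toL2 K _) = _
  rw [inner_toL2 hK]
  simp only [C1Hom0.toC, ContinuousMap.coe_mk, one_mul]
  rw [h, mul_zero]

/-- The spectral inequality for a function whose component in the eigenspace of the eigenvalue `1`
is known: the components for `0`, `1` and the rest of the spectrum contribute to the energy with
weights at least `0`, `1` and `c`. -/
lemma le_energy (hK : IsKPlus2 K) (hn : 3 ≤ n) (hiso : IsS2Isotropic K) {c : ℝ} (hc : 1 < c)
    (hspec : c ≤ hbmEigenvalue K 2) {f : E n → ℝ} (hf : C1Hom0 f) {v : E n} (hv : ‖v‖ = 1) {m : ℝ}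
    (hfm : ∀ w, inner ℝ (toL2 K hf.toC) (linL2 hK w) = m * inner ℝ v w) :
    m ^ 2 / isoConst K + c * (‖toL2 K hf.toC‖ ^ 2 -
      (inner ℝ (oneL2 K) (toL2 K hf.toC)) ^ 2 / ‖oneL2 K‖ ^ 2 - m ^ 2 / isoConst K) ≤
      energy K f := by
  have hk := isoConst_pos hK hn hiso
  have hone : ‖oneL2 K‖ ^ 2 ≠ 0 := pow_ne_zero 2 (norm_ne_zero_iff.2 (oneL2_ne_zero hK hn))
  set k := isoConst K
  set X := toL2 K hf.toC with hX
  set o := oneL2 K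
  set b : ℝ := inner ℝ o X with hb
  set α : ℝ := m / k with hα
  set y : L2 K := X - (b / ‖o‖ ^ 2) • o - α • linL2 hK v with hy
  have hαk : α * k = m := div_mul_cancel₀ _ hk.ne'
  have hy0 : inner ℝ y o = (0 : ℝ) := by
    rw [hy, inner_sub_left, inner_sub_left, inner_smul_left, inner_smul_left,
      real_inner_comm o (linL2 hK v), inner_oneL2_linL2 hK hn, real_inner_self_eq_norm_sq,
      real_inner_comm o X, ← hb]
    simp only [RCLike.conj_to_real]
    rw [div_mul_cancel₀ _ hone, mul_zero, sub_self, sub_zero]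
  have hy1 : ∀ w, inner ℝ y (linL2 hK w) = (0 : ℝ) := by
    intro w
    rw [hy, inner_sub_left, inner_sub_left, inner_smul_left, inner_smul_left, hfm,
      inner_oneL2_linL2 hK hn, inner_linL2 hK hiso]
    simp only [RCLike.conj_to_real]
    linear_combination -(inner ℝ v w : ℝ) * hαk
  have hXv : inner ℝ X (linL2 hK v) = m := by
    rw [hfm, real_inner_self_eq_norm_sq, hv]; ring
  have hXy : inner ℝ X y = ‖y‖ ^ 2 := by
    have e : X = y + (b / ‖o‖ ^ 2) • o + α • linL2 hK v := by rw [hy]; abel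
    rw [e, inner_add_left, inner_add_left, inner_smul_left, inner_smul_left,
      real_inner_comm _ o, real_inner_comm _ (linL2 hK v), hy0, hy1, real_inner_self_eq_norm_sq]
    ring
  have hyn : ‖y‖ ^ 2 = ‖X‖ ^ 2 - b ^ 2 / ‖o‖ ^ 2 - m ^ 2 / k := by
    rw [← hXy, hy, inner_sub_right, inner_sub_right, inner_smul_right, inner_smul_right, hXv,
      real_inner_comm o X, ← hb, real_inner_self_eq_norm_sq, hα]
    ring
  obtain ⟨z, hz, hzy⟩ := exists_inverse_le hK hn hc hspec hy0 hy1
  -- The Dirichlet principle is tested with `a = α ℓ + c z` and `b = α ℓ + c y`, where `ℓ = linL2 hK v`.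
  have hzv : inner ℝ z (linL2 hK v) = (0 : ℝ) := by
    rw [← isSymmRel_graphSA hK hn _ hz _ (linL2_mem hK v)]
    exact hy1 v
  have hmem := (graphSA K).add_mem ((graphSA K).smul_mem α (linL2_mem hK v))
    ((graphSA K).smul_mem c hz)
  have h := two_mul_inner_sub_le_energy hK hn hf _ hmem
  simp only [Prod.smul_mk, Prod.mk_add_mk, inner_add_left, inner_add_right, inner_smul_left,
    inner_smul_right, RCLike.conj_to_real, ← hX, hXv, hXy, hzv, inner_linL2 hK hiso] at h
  rw [real_inner_comm y (linL2 hK v), hy1, real_inner_comm y z, real_inner_self_eq_norm_sq, hv] at h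
  rw [← hyn]
  have h2 : m ^ 2 / k = α * m := by rw [hα]; ring
  have h3 : α * (α * (k * 1 ^ 2)) = α * m := by rw [← hαk]; ring
  have h4 := mul_le_mul_of_nonneg_left hzy (show 0 ≤ c by linarith)
  change 2 * (α * m + c * ‖y‖ ^ 2) - (α * (α * (k * 1 ^ 2) + c * 0) +
    c * (α * 0 + c * inner ℝ y z)) ≤ energy K f at h
  rw [h2]
  linarith

/-- The components of the position vector `∇h_K`, as functions of the normal. -/
noncomputable def posL2 (hK : IsKPlus2 K) (w : E n) : L2 K :=
  toL2 K (hK.strictlyConvex.c1Hom0_gradient w).toC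

/-- The components of the tangential part `∇h_K - h_K x` of the position vector. -/
noncomputable def tanL2 (hK : IsKPlus2 K) (w : E n) : L2 K :=
  toL2 K ⟨fun s : S n => inner ℝ (gradient (homExt (supportFn K)) (s : E n) -
    homExt (supportFn K) s • (s : E n)) w, ((hK.strictlyConvex.continuous_gradient.sub
        (hK.strictlyConvex.continuous.smul continuous_subtype_val)).inner continuous_const)⟩

lemma inner_posL2_linL2 (hK : IsKPlus2 K) (hn : 3 ≤ n) (v w : E n) :
    inner ℝ (posL2 hK v) (linL2 hK w) = ‖oneL2 K‖ ^ 2 / n * inner ℝ v w := by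
  have hd : 2 ≤ Module.finrank ℝ (E n) := by rw [finrank_euclideanSpace_fin]; omega
  have h := hK.strictlyConvex.integral_gradient_mul_linear_div volume hd v w
  change inner ℝ (toL2 K _) (toL2 K _) = _
  rw [inner_toL2 hK, oneL2, norm_sq_toL2 hK]
  simp only [C1Hom0.toC, ContinuousMap.coe_mk, one_pow, mul_one]
  rw [h, finrank_euclideanSpace_fin]
  ring

/-- The mean of the position vector is a multiple of the mean of its tangential part. -/
lemma inner_oneL2_posL2 (hK : IsKPlus2 K) (hn : 3 ≤ n) {p : ℝ} (hsol : SolvesIsotropicLp K p)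
    (w : E n) : inner ℝ (oneL2 K) (posL2 hK w) =
      (n + p) / (n - 1) * inner ℝ (oneL2 K) (tanL2 hK w) := by
  have hH := hK.strictlyConvex
  have hn1 : (n : ℝ) - 1 ≠ 0 := by
    have : (3 : ℝ) ≤ n := by exact_mod_cast hn
    linarith
  have h := hH.integral_mul_linear volume (coneDensity_eq_rpow hK hsol) w
  rw [finrank_euclideanSpace_fin] at h
  have c1 : Integrable (fun s : S n => coneDensity (homExt (supportFn K)) s *
      (homExt (supportFn K) s * inner ℝ (s : E n) w)) (volume : Measure (E n)).toSphere :=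
    integrable_sphere _ (hH.continuous_coneDensity.mul (hH.continuous.mul
      (continuous_subtype_val.inner continuous_const)))
  have c2 : Integrable (fun s : S n => coneDensity (homExt (supportFn K)) s *
      inner ℝ (gradient (homExt (supportFn K)) s - homExt (supportFn K) s • (s : E n)) w)
      (volume : Measure (E n)).toSphere :=
    integrable_sphere _ (hH.continuous_coneDensity.mul ((hH.continuous_gradient.sub
        (hH.continuous.smul continuous_subtype_val)).inner continuous_const))
  rw [posL2, tanL2, oneL2, inner_toL2 hK, inner_toL2 hK]
  simp only [C1Hom0.toC, ContinuousMap.coe_mk, one_mul]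
  have e : ∫ s : S n, coneDensity (homExt (supportFn K)) s *
      inner ℝ (gradient (homExt (supportFn K)) s) w ∂(volume : Measure (E n)).toSphere =
      ∫ s : S n, coneDensity (homExt (supportFn K)) s * (homExt (supportFn K) s *
        inner ℝ (s : E n) w) ∂(volume : Measure (E n)).toSphere +
      ∫ s : S n, coneDensity (homExt (supportFn K)) s *
      inner ℝ (gradient (homExt (supportFn K)) s - homExt (supportFn K) s • (s : E n)) w
        ∂(volume : Measure (E n)).toSphere := by
    rw [← integral_add c1 c2]
    refine integral_congr_ae (.of_forall fun s => ?_)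
    simp only [inner_sub_left, inner_smul_left, RCLike.conj_to_real]
    ring
  rw [e]
  have h' := eq_div_of_mul_eq hn1 ((mul_comm _ _).trans h)
  rw [h']
  field_simp
  ring

lemma inner_oneL2_posL2_sq_le (hK : IsKPlus2 K) (hn : 3 ≤ n) {p : ℝ}
    (hsol : SolvesIsotropicLp K p) (w : E n) :
    (inner ℝ (oneL2 K) (posL2 hK w)) ^ 2 / ‖oneL2 K‖ ^ 2 ≤
      ((n + p) / (n - 1)) ^ 2 * ‖tanL2 hK w‖ ^ 2 := by
  have h0 : 0 < ‖oneL2 K‖ ^ 2 := pow_pos (norm_pos_iff.2 (oneL2_ne_zero hK hn)) 2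
  rw [inner_oneL2_posL2 hK hn hsol, div_le_iff₀ h0, mul_pow, mul_assoc]
  refine mul_le_mul_of_nonneg_left ?_ (sq_nonneg _)
  have h := sq_le_sq' (neg_le_of_abs_le (abs_real_inner_le_norm (oneL2 K) (tanL2 hK w)))
    (le_of_abs_le (abs_real_inner_le_norm (oneL2 K) (tanL2 hK w)))
  linarith [mul_pow ‖oneL2 K‖ ‖tanL2 hK w‖ 2]

/-- The `L²(V_K)` norm of `h_K`, squared. -/
noncomputable def supportSq (K : ConvexBody (E n)) : ℝ :=
  (n : ℝ)⁻¹ * ∫ s : S n, coneDensity (homExt (supportFn K)) s * homExt (supportFn K) s ^ 2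
    ∂(volume : Measure (E n)).toSphere

/-- The `L²(V_K)` norm of the tangential part of the position vector, squared. -/
noncomputable def tanSq (K : ConvexBody (E n)) : ℝ :=
  (n : ℝ)⁻¹ * ∫ s : S n, coneDensity (homExt (supportFn K)) s *
    ‖gradient (homExt (supportFn K)) (s : E n) - homExt (supportFn K) s • (s : E n)‖ ^ 2
    ∂(volume : Measure (E n)).toSphere

omit [IsFiniteMeasure (coneVolume K)] in
lemma sum_integral (hK : IsKPlus2 K) {ι : Type*} [Fintype ι] {f : ι → S n → ℝ} {g : S n → ℝ}
    (hf : ∀ i, Continuous (f i)) (h : ∀ s, ∑ i, f i s = g s) :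
    ∑ i, (n : ℝ)⁻¹ * ∫ s : S n, coneDensity (homExt (supportFn K)) s * f i s
        ∂(volume : Measure (E n)).toSphere =
      (n : ℝ)⁻¹ * ∫ s : S n, coneDensity (homExt (supportFn K)) s * g s
        ∂(volume : Measure (E n)).toSphere := by
  have hi : ∀ i, Integrable (fun s : S n => coneDensity (homExt (supportFn K)) s * f i s)
      (volume : Measure (E n)).toSphere := fun i =>
    integrable_sphere _ (hK.strictlyConvex.continuous_coneDensity.mul (hf i))
  rw [← Finset.mul_sum, ← integral_finsetSum _ fun i _ => hi i]
  congr 2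
  funext s
  rw [← Finset.mul_sum, h]

variable {ι : Type*} [Fintype ι] (e : OrthonormalBasis ι ℝ (E n))

lemma sum_norm_sq_tanL2 (hK : IsKPlus2 K) : ∑ i, ‖tanL2 hK (e i)‖ ^ 2 = tanSq K := by
  simp only [tanL2, norm_sq_toL2 hK]
  refine sum_integral hK (fun i => (ContinuousMap.continuous _).pow 2) fun s => ?_
  exact e.sum_sq_inner_left _

lemma sum_norm_sq_posL2 (hK : IsKPlus2 K) :
    ∑ i, ‖posL2 hK (e i)‖ ^ 2 = tanSq K + supportSq K := by
  have hH := hK.strictlyConvex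
  have hG : Continuous fun s : S n =>
      gradient (homExt (supportFn K)) (s : E n) - homExt (supportFn K) s • (s : E n) :=
    hH.continuous_gradient.sub (hH.continuous.smul continuous_subtype_val)
  have c1 : Integrable (fun s : S n => coneDensity (homExt (supportFn K)) s *
      ‖gradient (homExt (supportFn K)) (s : E n) - homExt (supportFn K) s • (s : E n)‖ ^ 2)
      (volume : Measure (E n)).toSphere :=
    integrable_sphere _ (hH.continuous_coneDensity.mul (hG.norm.pow 2))
  have c2 : Integrable (fun s : S n => coneDensity (homExt (supportFn K)) s *
      homExt (supportFn K) s ^ 2) (volume : Measure (E n)).toSphere :=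
    integrable_sphere _ (hH.continuous_coneDensity.mul (hH.continuous.pow 2))
  have h := sum_integral hK (f := fun i s => (hH.c1Hom0_gradient (e i)).toC s ^ 2)
    (g := fun s : S n => ‖gradient (homExt (supportFn K)) (s : E n)‖ ^ 2)
    (fun i => (hH.c1Hom0_gradient (e i)).toC.continuous.pow 2)
    fun s => e.sum_sq_inner_left _
  simp only [posL2, norm_sq_toL2 hK]
  rw [h, tanSq, supportSq, ← mul_add, ← integral_add c1 c2]
  congr 2
  funext s
  have hs : ‖(s : E n)‖ = 1 := by simp
  rw [← mul_add, norm_sub_sq_real, inner_smul_right,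
    hH.inner_gradient_self (ne_zero_of_mem_sphere s), norm_smul, hs, Real.norm_eq_abs, mul_one,
    sq_abs]
  ring

lemma sum_energy (hK : IsKPlus2 K) (hn : 3 ≤ n) {p : ℝ} (hsol : SolvesIsotropicLp K p) :
    ∑ i, energy K (fun y => inner ℝ (gradient (homExt (supportFn K)) y) (e i)) =
      supportSq K - (p + 1) / (n - 1) * tanSq K := by
  have hH := hK.strictlyConvex
  have hn1 : (n : ℝ) - 1 ≠ 0 := by
    have : (3 : ℝ) ≤ n := by exact_mod_cast hn
    linarith
  have h := hH.integral_mul_tr_hess volume (coneDensity_eq_rpow hK hsol)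
  rw [finrank_euclideanSpace_fin] at h
  have h1 := sum_integral hK (fun i => hH.continuous_dirichletForm (hH.c1Hom0_gradient (e i))
    (hH.c1Hom0_gradient (e i))) fun s => hH.sum_dirichletForm e (x := (s : E n)) (by simp)
  simp only [energy]
  rw [h1, finrank_euclideanSpace_fin]
  have h2 : ∫ s : S n, coneDensity (homExt (supportFn K)) s * (homExt (supportFn K) s /
      ((n : ℝ) - 1) * tr (hess (homExt (supportFn K)) s)) ∂(volume : Measure (E n)).toSphere =
      ((n : ℝ) - 1)⁻¹ * ∫ s : S n, coneDensity (homExt (supportFn K)) s * (homExt (supportFn K) s *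
        tr (hess (homExt (supportFn K)) s)) ∂(volume : Measure (E n)).toSphere := by
    rw [← integral_const_mul]
    refine integral_congr_ae (.of_forall fun s => ?_)
    simp only
    ring
  rw [h2, h, supportSq, tanSq]
  field_simp

/-- The reverse Cauchy–Schwarz inequality `∫ h_K² dV · ∫ h_K⁻² dV ≤ V(𝕊ⁿ⁻¹)²`: the sum over an
orthonormal basis of the spectral inequality for the components of the position vector. -/
lemma supportSq_le (hK : IsKPlus2 K) (hn : 3 ≤ n) (hiso : IsS2Isotropic K) {p : ℝ}
    (hsol : SolvesIsotropicLp K p) (hp0 : 0 < 2 * n - 1 + p) (hp1 : p < -(n : ℝ))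
    (hspec : ((n : ℝ) - 1) / (2 * n - 1 + p) ≤ hbmEigenvalue K 2) :
    supportSq K ≤ (‖oneL2 K‖ ^ 2) ^ 2 / (n * isoConst K) := by
  have hn3 : (3 : ℝ) ≤ n := by exact_mod_cast hn
  set c : ℝ := ((n : ℝ) - 1) / (2 * n - 1 + p) with hc_def
  have hc : 1 < c := by rw [hc_def, lt_div_iff₀ hp0]; linarith
  have hk := isoConst_pos hK hn hiso
  set q : ℝ := (n + p) / (n - 1) with hq
  set v : ℝ := ‖oneL2 K‖ ^ 2
  let e := EuclideanSpace.basisFun (Fin n) ℝ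
  have h1 : ∀ i, (v / n) ^ 2 / isoConst K + c * (‖posL2 hK (e i)‖ ^ 2 -
      q ^ 2 * ‖tanL2 hK (e i)‖ ^ 2 - (v / n) ^ 2 / isoConst K) ≤
      energy K (fun y => inner ℝ (gradient (homExt (supportFn K)) y) (e i)) := by
    intro i
    have ha := le_energy hK hn hiso hc hspec (hK.strictlyConvex.c1Hom0_gradient (e i))
      (e.norm_eq_one i) (inner_posL2_linL2 hK hn (e i))
    have hb := mul_le_mul_of_nonneg_left (inner_oneL2_posL2_sq_le hK hn hsol (e i))
      (show 0 ≤ c by linarith)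
    change _ + c * (‖posL2 hK (e i)‖ ^ 2 - (inner ℝ (oneL2 K) (posL2 hK (e i))) ^ 2 / v - _) ≤ _
      at ha
    linarith
  have h2 := Finset.sum_le_sum fun i (_ : i ∈ Finset.univ) => h1 i
  rw [sum_energy e hK hn hsol, Finset.sum_add_distrib, ← Finset.mul_sum, Finset.sum_sub_distrib,
    Finset.sum_sub_distrib, ← Finset.mul_sum, sum_norm_sq_posL2 e hK, sum_norm_sq_tanL2 e hK,
    Finset.sum_const, Finset.card_univ, Fintype.card_fin, nsmul_eq_mul] at h2
  have h3 : (n : ℝ) * ((v / n) ^ 2 / isoConst K) = v ^ 2 / (n * isoConst K) := by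
    field_simp
  rw [h3] at h2
  -- The terms in `tanSq K` cancel, by the choice of `c`.
  have h4 : c * (1 - q ^ 2) = -((p + 1) / (n - 1)) := by
    have hn1 : (n : ℝ) - 1 ≠ 0 := by linarith
    have e1 : 1 + q = (2 * n - 1 + p) / (n - 1) := by rw [hq]; field_simp; ring
    have e2 : 1 - q = -((p + 1) / (n - 1)) := by rw [hq]; field_simp; ring
    have e3 : c * (1 + q) = 1 := by rw [e1, hc_def, div_mul_div_cancel₀ hp0.ne', div_self hn1]
    rw [← e2]
    linear_combination (1 - q) * e3
  clear_value c q
  have h5 : (c - 1) * supportSq K ≤ (c - 1) * (v ^ 2 / (n * isoConst K)) := by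
    linear_combination h2 - tanSq K * h4
  exact le_of_mul_le_mul_left h5 (by linarith)

/-- Equality in the Cauchy–Schwarz inequality: `∫ (h_K - a / h_K)² dV ≤ 0` for the ratio `a` of
`V(𝕊ⁿ⁻¹)` and `∫ h_K⁻² dV`. -/
lemma exists_eq_const (hK : IsKPlus2 K) (hn : 3 ≤ n) (hiso : IsS2Isotropic K)
    (h : supportSq K ≤ (‖oneL2 K‖ ^ 2) ^ 2 / (n * isoConst K)) :
    ∃ r : ℝ, 0 < r ∧ ∀ s : S n, homExt (supportFn K) s = r := by
  have hH := hK.strictlyConvex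
  have hn3 : (3 : ℝ) ≤ n := by exact_mod_cast hn
  have hk := isoConst_pos hK hn hiso
  have hv0 : 0 < ‖oneL2 K‖ ^ 2 := pow_pos (norm_pos_iff.2 (oneL2_ne_zero hK hn)) 2
  have hpos : ∀ s : S n, 0 < homExt (supportFn K) s := fun s => hH.pos s (ne_zero_of_mem_sphere s)
  set a : ℝ := ‖oneL2 K‖ ^ 2 / (n * isoConst K) with ha
  have ha0 : 0 < a := by positivity
  have c1 : Integrable (fun s : S n => coneDensity (homExt (supportFn K)) s *
      homExt (supportFn K) s ^ 2) (volume : Measure (E n)).toSphere :=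
    integrable_sphere _ (hH.continuous_coneDensity.mul (hH.continuous.pow 2))
  have c2 : Integrable (fun s : S n => coneDensity (homExt (supportFn K)) s)
      (volume : Measure (E n)).toSphere := integrable_sphere _ hH.continuous_coneDensity
  have c3 : Integrable (fun s : S n => coneDensity (homExt (supportFn K)) s *
      (1 / homExt (supportFn K) s ^ 2)) (volume : Measure (E n)).toSphere :=
    integrable_sphere _ (hH.continuous_coneDensity.mul (continuous_const.div (hH.continuous.pow 2)
      fun s => pow_ne_zero 2 (hpos s).ne'))
  have c4 : Integrable (fun s : S n => coneDensity (homExt (supportFn K)) s *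
      homExt (supportFn K) s ^ 2 - 2 * a * coneDensity (homExt (supportFn K)) s)
      (volume : Measure (E n)).toSphere := c1.sub (c2.const_mul _)
  have hv : ‖oneL2 K‖ ^ 2 = (n : ℝ)⁻¹ * ∫ s : S n, coneDensity (homExt (supportFn K)) s
      ∂(volume : Measure (E n)).toSphere := by
    rw [oneL2, norm_sq_toL2 hK]
    simp [C1Hom0.toC]
  have hcont : Continuous fun s : S n => coneDensity (homExt (supportFn K)) s *
      (homExt (supportFn K) s - a / homExt (supportFn K) s) ^ 2 :=
    hH.continuous_coneDensity.mul ((hH.continuous.sub (continuous_const.div hH.continuous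
      fun s => (hpos s).ne')).pow 2)
  have hint : ∫ s : S n, coneDensity (homExt (supportFn K)) s *
      (homExt (supportFn K) s - a / homExt (supportFn K) s) ^ 2
      ∂(volume : Measure (E n)).toSphere ≤ 0 := by
    have e1 : ∫ s : S n, coneDensity (homExt (supportFn K)) s *
        (homExt (supportFn K) s - a / homExt (supportFn K) s) ^ 2
        ∂(volume : Measure (E n)).toSphere =
        n * (supportSq K - 2 * a * ‖oneL2 K‖ ^ 2 + a ^ 2 * (n * isoConst K)) := by
      have e2 : ∀ s : S n, coneDensity (homExt (supportFn K)) s *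
          (homExt (supportFn K) s - a / homExt (supportFn K) s) ^ 2 =
          coneDensity (homExt (supportFn K)) s * homExt (supportFn K) s ^ 2 -
          2 * a * coneDensity (homExt (supportFn K)) s + a ^ 2 *
          (coneDensity (homExt (supportFn K)) s * (1 / homExt (supportFn K) s ^ 2)) := by
        intro s
        have := (hpos s).ne'
        field_simp
        ring
      simp only [e2]
      rw [integral_add c4 (c3.const_mul _), integral_sub c1 (c2.const_mul _), integral_const_mul,
        integral_const_mul, hv, supportSq, isoConst]
      field_simp
    have e3 : a * (n * isoConst K) = ‖oneL2 K‖ ^ 2 := by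
      rw [ha]; field_simp
    have e4 : (‖oneL2 K‖ ^ 2) ^ 2 / (n * isoConst K) = a * ‖oneL2 K‖ ^ 2 := by
      rw [ha]; ring
    rw [e1]
    refine mul_nonpos_of_nonneg_of_nonpos (by linarith) ?_
    have e5 : a ^ 2 * (n * isoConst K) = a * ‖oneL2 K‖ ^ 2 := by rw [← e3]; ring
    linarith
  refine ⟨√a, Real.sqrt_pos.2 ha0, fun s => ?_⟩
  have h1 := eq_zero_of_integral_nonpos hcont
    (fun s => mul_nonneg (hH.coneDensity_pos (by simp)).le (sq_nonneg _)) hint s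
  have h2 := pow_eq_zero_iff two_ne_zero |>.1
    ((mul_eq_zero.1 h1).resolve_left (hH.coneDensity_pos (by simp)).ne')
  have h3 : homExt (supportFn K) s ^ 2 = a := by
    have := (hpos s).ne'
    field_simp at h2
    linarith
  rw [← h3, Real.sqrt_sq (hpos s).le]

end Position

/-! ### The unit ball -/

section Ball

variable {n : ℕ} {K : ConvexBody (E n)}

lemma homExt_eq_norm (hK : IsKPlus2 K) (hn : 3 ≤ n) {p : ℝ} (hsol : SolvesIsotropicLp K p)
    (hp : p < -(n : ℝ)) {r : ℝ} (hr : 0 < r) (h : ∀ s : S n, homExt (supportFn K) s = r) :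
    homExt (supportFn K) = fun y => ‖y‖ := by
  have hn3 : (3 : ℝ) ≤ n := by exact_mod_cast hn
  have hH : homExt (supportFn K) = fun y => r * ‖y‖ := by
    rw [← homExt_restrict (c2Hom1_norm.const_mul r).hom]
    congr 1
    funext s
    rw [← homExt_sphere (supportFn K), h]
    simp
  have : Nontrivial (E n) := Module.nontrivial_of_finrank_pos (R := ℝ) (by
    rw [finrank_euclideanSpace_fin]; omega)
  obtain ⟨x, hx0⟩ := exists_ne (0 : E n)
  set s : S n := ⟨‖x‖⁻¹ • x, by simpa using norm_inv_norm_smul hx0⟩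
  have hs : ‖(s : E n)‖ = 1 := by simp
  have hdet : (hatHess (homExt (supportFn K)) s).det = r ^ n * r⁻¹ := by
    have e : hatHess (homExt (supportFn K)) s =
        (r • (1 : E n →L[ℝ] E n)) * (1 + rankOne ℝ ((r⁻¹ - 1) • (s : E n)) (s : E n)) := by
      rw [hatHess, hH, hess_const_mul contDiffOn_norm r (ne_zero_of_mem_sphere s), hess_norm hs]
      ext1 v
      simp only [add_apply, smul_apply, sub_apply, rankOne_apply, clm_mul_apply, one_apply_eq_self]
      match_scalars <;> field_simp
      ring
    rw [e, det_mul, det_smul_one, det_one_add_rankOne, inner_smul_right, real_inner_self_eq_norm_sq,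
      hs, finrank_euclideanSpace_fin]
    ring
  have h1 := coneDensity_eq_rpow hK hsol s
  rw [coneDensity, hdet, h s, mul_left_comm, mul_inv_cancel₀ hr.ne', mul_one,
    ← Real.rpow_natCast] at h1
  have h2 : r ^ ((n : ℝ) - p) = 1 := by
    rw [Real.rpow_sub hr, h1, div_self (Real.rpow_pos_of_pos hr p).ne']
  have h3 : r = 1 := (Real.rpow_left_inj hr.le zero_le_one (by linarith)).1
    (h2.trans (Real.one_rpow _).symm)
  rw [hH, h3]
  simp

lemma eq_closedBall (h : homExt (supportFn K) = fun y => ‖y‖) :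
    (K : Set (E n)) = closedBall 0 1 := by
  ext y
  rw [mem_closedBall_zero_iff]
  constructor
  · intro hy
    obtain ⟨z, hz⟩ := exists_isSupportPoint K y
    have h1 : ‖y‖ ^ 2 ≤ ‖y‖ := by
      rw [← real_inner_self_eq_norm_sq]
      have := homExt_supportFn hz
      rw [h] at this
      exact (hz.2 y hy).trans this.ge
    by_contra! hlt
    nlinarith
  · intro hy
    by_contra hyK
    obtain ⟨f, u, hf, hu⟩ := geometric_hahn_banach_closed_point K.convex K.isClosed hyK
    obtain ⟨ξ, rfl⟩ := (toDual ℝ (E n)).surjective f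
    obtain ⟨z, hz⟩ := exists_isSupportPoint K ξ
    have h1 := homExt_supportFn hz
    rw [h] at h1
    have h2 := hf z hz.1
    rw [toDual_apply_apply] at h2 hu
    have h3 := real_inner_le_norm ξ y
    have h4 := mul_le_mul_of_nonneg_left hy (norm_nonneg ξ)
    simp only at h1
    linarith

end Ball

end LpMinkowski


theorem mainTheorem2 (n : ℕ) (hn : 3 ≤ n) (p : ℝ)
    (hp_lower : (1 - 3 * (n : ℝ) ^ 2) / (2 * n) ≤ p) (hp_upper : p < -(n : ℝ))
    (K : ConvexBody (LpMinkowski.E n)) (hK : LpMinkowski.IsKPlus2 K)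
    (hiso : LpMinkowski.IsS2Isotropic K) (hsol : LpMinkowski.SolvesIsotropicLp K p)
    (hspec : ((n : ℝ) - 1) / (2 * n - 1 + p) ≤ LpMinkowski.hbmEigenvalue K 2) :
    (K : Set (LpMinkowski.E n)) = Metric.closedBall 0 1 := by
  have hn3 : (3 : ℝ) ≤ n := by exact_mod_cast hn
  have hp0 : 0 < 2 * n - 1 + p := by
    rw [div_le_iff₀ (by linarith)] at hp_lower
    have : 0 < ((n : ℝ) - 1) ^ 2 := by
      have : (0 : ℝ) < n - 1 := by linarith
      positivity
    by_contra! hneg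
    have h2 := mul_nonpos_of_nonneg_of_nonpos (show (0 : ℝ) ≤ 2 * n by linarith) hneg
    linarith
  have : Nontrivial (LpMinkowski.E n) := Module.nontrivial_of_finrank_pos (R := ℝ) (by
    rw [finrank_euclideanSpace_fin]; omega)
  have := LpMinkowski.isFiniteMeasure_coneVolume hK (by omega)
  obtain ⟨r, hr, h⟩ := LpMinkowski.exists_eq_const hK hn hiso
    (LpMinkowski.supportSq_le hK hn hiso hsol hp0 hp_upper hspec)
  exact LpMinkowski.eq_closedBall (LpMinkowski.homExt_eq_norm hK hn hsol hp_upper hr h)
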